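/- Let $d\ge 2$ be an integer and let $p>1$, $q>0$, $\delta>0$, $C>0$ with $p>\frac{d}{d-1}$ and $q(p-1)>1$. Put $$\beta=p+d(q(p-1)-1),\qquad \gamma=\frac{p-1}{q(p-1)-1},\qquad \kappa=\frac{q(p-1)-1}{pq}\,\beta^{-\frac1{p-1}},$$ and, for $t\ge 0$ and $x\in\mathbb R^d$, $$w_\delta(t,x)=(t+\delta)^{-\frac d\beta}\Big[C-\kappa\big((t+\delta)^{-\frac1\beta}|x|\big)^{\frac p{p-1}}\Big]_+^{\gamma},\qquad \varrho_\delta(t,x)=|\nabla w_\delta(t,x)|^{p-2}\,w_\delta(t,x)^{(p-1)(q-1)},$$ where $\nabla$ is the gradient in $x$ (defined for a.e. $x$), $\varrho_\delta:=0$ outside the support of $w_\delta(t,\cdot)$ (convention $0\cdot\infty=0$), and $C>0$ is arbitrary (for instance the constant for which $\int w_\delta(t,x)\,dx=1$). For a measure $\mu$ on $\mathbb R^d$ with values in a finite-dimensional Euclidean space let $|\mu|$ be its variation measure and let $$\mathcal M|\mu|(x)=\sup_{r>0}\frac{|\mu|(B_r(x))}{\lambda^d(B_r(0))},\qquad x\in\mathbb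 R^d,$$ where $\lambda^d$ is Lebesgue measure; for $f\in L^1_{\rm loc}$ write $\mathcal M|f|$ for the maximal function of the measure $|f(x)|\,dx$. (i) For every $t\ge0$ the second order distributional derivatives $\partial_i\partial_j\varrho_\delta(t,\cdot)$, $1\le i,j\le d$, are finite signed Borel measures. Let $D_x\nabla\varrho_\delta(t,\cdot)$ be the matrix-valued measure with these entries. Then $(t,x)\mapsto\mathcal M|D_x\nabla\varrho_\delta(t,\cdot)|(x)\,w_\delta(t,x)$ is (Lebesgue) measurable on $[0,T]\times\mathbb R^d$ and $$\int_0^T\int_{\mathbb R^d}\mathcal M|D_x\nabla\varrho_\delta(t,\cdot)|(x)\,w_\delta(t,x)\,dx\,dt<\infty\qquad\text{for all } T\in(0,\infty).$$ (ii) Assume in addition that $q>\frac{|p-2|+d}{d(p-1)}$ (which by itself implies $q(p-1)>1$). Then for every $t\ge0$ the function $\varrho_\delta^{\frac{1+\gamma}2}(t,\cdot)$ is weakly differentiable with locally integrable weak gradient $\nabla\varrho_\delta^{\frac{1+\gamma}2}(t,\cdot)$, the function $(t,x)\mapsto\big(\mathcal M|\nabla\varrho_\delta^{\frac{1+\gamma}2}(t,\cdot)|(x)\big)^2|x|^{-\frac{p-2}{q(p-1)-1}}$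 is (Lebesgue) measurable on $[0,T]\times\mathbb R^d$, and $$\int_0^T\int_{\mathbb R^d}\Big(\mathcal M\big|\nabla\varrho_\delta^{\frac{1+\gamma}2}(t,\cdot)\big|(x)\Big)^2|x|^{-\frac{p-2}{q(p-1)-1}}\,dx\,dt<\infty\qquad\text{for all } T\in(0,\infty).$$ -/

import Mathlib

open MeasureTheory Set
open scoped ENNReal ContDiff

noncomputable section

namespace Leibenson

/-! ### Barenblatt solutions of the Leibenson equation and the coefficient `ϱ_δ` -/

/-- `β = p + d (q (p - 1) - 1)`. -/
def beta (d : ℕ) (p q : ℝ) : ℝ := p + d * (q * (p - 1) - 1)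

/-- `γ = (p - 1) / (q (p - 1) - 1)`. -/
def gam (p q : ℝ) : ℝ := (p - 1) / (q * (p - 1) - 1)

/-- `κ = (q (p - 1) - 1) / (p q) * β ^ (- 1 / (p - 1))`. -/
def kappa (d : ℕ) (p q : ℝ) : ℝ :=
  (q * (p - 1) - 1) / (p * q) * beta d p q ^ (-(1 / (p - 1)))

/-- The Barenblatt solution with pole at the origin,
`w(t,x) = t ^ (-d/β) * [C - κ (t ^ (-1/β) |x|) ^ (p/(p-1))]_+ ^ γ`, for `t > 0`. -/
def barenblatt (d : ℕ) (p q C : ℝ) (t : ℝ) (x : EuclideanSpace ℝ (Fin d)) : ℝ :=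
  t ^ (-((d : ℝ) / beta d p q)) *
    (max (C - kappa d p q * (t ^ (-(1 / beta d p q)) * ‖x‖) ^ (p / (p - 1))) 0) ^ gam p q

/-- `w_δ(t,x) = w(t + δ, x)`. -/
def wDelta (d : ℕ) (p q C δ : ℝ) (t : ℝ) (x : EuclideanSpace ℝ (Fin d)) : ℝ :=
  barenblatt d p q C (t + δ) x

/-- `ϱ_δ(t,x) = |∇ w_δ(t,x)| ^ (p - 2) * w_δ(t,x) ^ ((p - 1) (q - 1))`, where `∇` is the gradient
in `x`. The gradient exists off the null set `{|x| = R_δ(t)}`. Since `0 ^ a = 0` in `ℝ` for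
`a < 0`, the product vanishes outside the support of `w_δ(t,·)`, in accordance with the
convention `0 * ∞ = 0`. -/
def rhoDelta (d : ℕ) (p q C δ : ℝ) (t : ℝ) (x : EuclideanSpace ℝ (Fin d)) : ℝ :=
  ‖gradient (fun y => wDelta d p q C δ t y) x‖ ^ (p - 2) *
    wDelta d p q C δ t x ^ ((p - 1) * (q - 1))

/-! ### Weak and distributional derivatives -/

/-- The classical partial derivative `∂_i φ`. -/
def partialD {d : ℕ} (i : Fin d) (φ : EuclideanSpace ℝ (Fin d) → ℝ) :
    EuclideanSpace ℝ (Fin d) → ℝ :=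
  fun x => fderiv ℝ φ x (EuclideanSpace.single i 1)

/-- Test functions: the elements of `C_c^∞(ℝ^d)`. -/
def IsTestFunction {d : ℕ} (φ : EuclideanSpace ℝ (Fin d) → ℝ) : Prop :=
  ContDiff ℝ ∞ φ ∧ HasCompactSupport φ

/-- `G` is (a version of) the weak gradient of `u` on `ℝ^d`; in particular `u` is weakly
differentiable. -/
def IsWeakGradient {d : ℕ} (u : EuclideanSpace ℝ (Fin d) → ℝ)
    (G : EuclideanSpace ℝ (Fin d) → EuclideanSpace ℝ (Fin d)) : Prop :=
  LocallyIntegrable u ∧ LocallyIntegrable G ∧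
    ∀ φ : EuclideanSpace ℝ (Fin d) → ℝ, IsTestFunction φ →
      ∀ i : Fin d, ∫ x, u x * partialD i φ x = -∫ x, G x i * φ x

/-- The `(i,j)` entry, a finite signed measure, of a measure with values in the `d × d` matrices
(equipped with the Euclidean norm of their entries). -/
def entry {d : ℕ} (D : VectorMeasure (EuclideanSpace ℝ (Fin d)) (EuclideanSpace ℝ (Fin d × Fin d)))
    (i j : Fin d) : SignedMeasure (EuclideanSpace ℝ (Fin d)) :=
  let e : EuclideanSpace ℝ (Fin d × Fin d) →L[ℝ] ℝ := EuclideanSpace.proj (i, j)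
  D.mapRange (e : EuclideanSpace ℝ (Fin d × Fin d) →+ ℝ) e.continuous

/-- The matrix-valued measure `D` is the matrix `(∂_i ∂_j u)_{i,j}` of all second order Schwartz
distributional derivatives of `u`; that is, these are finite signed Borel measures, namely the
entries of `D`. -/
def IsDistribHessian {d : ℕ} (u : EuclideanSpace ℝ (Fin d) → ℝ)
    (D : VectorMeasure (EuclideanSpace ℝ (Fin d)) (EuclideanSpace ℝ (Fin d × Fin d))) : Prop :=
  LocallyIntegrable u ∧
    ∀ φ : EuclideanSpace ℝ (Fin d) → ℝ, IsTestFunction φ →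
      ∀ i j : Fin d, ∫ x, u x * partialD i (partialD j φ) x = ∫ᵛ x, φ x ∂<•(entry D i j)

/-! ### The Hardy-Littlewood maximal function -/

/-- The maximal function `M μ (x) = sup_{r > 0} μ(B_r(x)) / λ(B_r(0))` of a nonnegative measure. -/
def maximalMeasure {d : ℕ} (μ : Measure (EuclideanSpace ℝ (Fin d)))
    (x : EuclideanSpace ℝ (Fin d)) : ℝ≥0∞ :=
  ⨆ (r : ℝ) (_ : 0 < r), μ (Metric.ball x r) / volume (Metric.ball (0 : EuclideanSpace ℝ (Fin d)) r)

/-- The maximal function `M|f|` of a locally integrable vector field: the maximal function of the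
measure `|f(x)| dx`. -/
def maximalFun {d : ℕ} (f : EuclideanSpace ℝ (Fin d) → EuclideanSpace ℝ (Fin d))
    (x : EuclideanSpace ℝ (Fin d)) : ℝ≥0∞ :=
  maximalMeasure (volume.withDensity fun y => ‖f y‖ₑ) x

end Leibenson

end

/-!
The statement is a computation in the self-similar variable `y = (t + δ) ^ (-1 / β) x`, once the
maximal functions of three singular radial measures are known. Put `b = p / (p - 1)`, so that
`1 < b < d`, and let `R` be the radius with `κ R ^ b = C`. The powers of the positive part in
`|∇ w_δ| ^ (p - 2)` and in `w_δ ^ ((p - 1) (q - 1))` add up to one, hence `ϱ_δ(t,·)` is almost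
everywhere a positive function of `t` times the fixed profile
`v(y) = ‖y‖ ^ (2 - b) (C - κ ‖y‖ ^ b)₊` (`Leibenson.rhoDelta_eq`). Weak derivatives and maximal
functions are covariant under dilations, and weak derivatives are unique. Therefore the functions
to be integrated over space and time are `c(t) Φ(y)` with `c` continuous on `[0, T]`, and it remains
to show that the spatial integral of the fixed function `Φ` is finite
(`aemeasurable_and_lintegral_lt_top_of_selfSimilar`). The maximal functions are measurable because
they are lower semicontinuous.

For the Hessian: `v` vanishes on the sphere of radius `R`, where its gradient jumps. By integration
by parts against radial functions (`setIntegral_ball_radial_mul_partialD`) its distributional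
Hessian consists of a density of size `‖y‖ ^ (-b)` in the ball and of a bounded density on the
sphere. Averages of `‖y‖ ^ (-b)` over balls centred at `x` are controlled by `‖x‖ ^ (-b)` as
`b < d`. Balls around `x` that meet the sphere have radius at least `|R - ‖x‖|`, and meet it in a
cap whose surface measure is controlled by `exists_toSphere_cap_le`; so the sphere contributes
`|R - ‖x‖| ^ (-1)`. Multiplication by `w_δ`, a multiple of `(C - κ ‖y‖ ^ b)₊ ^ γ` with `γ > 0`, makes
the latter integrable at the sphere (`lintegral_maximalMeasure_mul_profile_lt_top`).

For the gradient: `v ^ ((1 + γ) / 2)` is of the form `‖y‖ ^ m (C - κ ‖y‖ ^ b)₊ ^ e` with `e > 1 / 2`.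
Its gradient and the maximal function of its gradient are bounded by a multiple of
`‖y‖ ^ (-α) + |R - ‖y‖| ^ (-ε)`, where `α = (1 - m)₊` and `ε = (1 - e)₊ < 1 / 2`, and the maximal
function decays like `‖y‖ ^ (-d)` at infinity. The weight is `‖y‖ ^ (-w)` with
`w = (2 - b) γ = (p - 2) / (q (p - 1) - 1)`. The square of the bound times the weight is integrable
at the sphere since `2 ε < 1`, at infinity since `-d < w`, and at the origin since `w < d` and
`2 (1 - m) + w = b < d`. The two inequalities `-d < w < d` are the additional hypothesis on `q`
(`lintegral_maximalFun_sq_mul_rpow_lt_top`).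
-/

open MeasureTheory Set
open scoped ENNReal ContDiff

/-! ### Polar coordinates and spherical caps -/

section Polar

open Module Filter Topology

variable {E : Type*} [NormedAddCommGroup E] [NormedSpace ℝ E] [FiniteDimensional ℝ E]
  [MeasurableSpace E] [BorelSpace E] [Nontrivial E] (μ : Measure E) [μ.IsAddHaarMeasure]

theorem lintegral_eq_lintegral_polar {f : E → ℝ≥0∞} (hf : Measurable f) :
    ∫⁻ x, f x ∂μ = ∫⁻ r in Ioi (0 : ℝ), ENNReal.ofReal (r ^ (finrank ℝ E - 1)) *
      ∫⁻ θ, f (r • (θ : E)) ∂μ.toSphere := by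
  have hmp := μ.measurePreserving_homeomorphUnitSphereProd
  have h1 : ∫⁻ x, f x ∂μ = ∫⁻ x : ({(0)}ᶜ : Set E), f x ∂(μ.comap (↑)) := by
    rw [lintegral_subtype_comap (measurableSet_singleton _).compl, restrict_compl_singleton]
  have hg : Measurable fun z : Metric.sphere (0 : E) 1 × Ioi (0 : ℝ) => f (z.2.1 • (z.1 : E)) :=
    hf.comp (by fun_prop)
  have h2 := hmp.lintegral_comp hg
  have h3 : ∀ x : ({(0)}ᶜ : Set E), (homeomorphUnitSphereProd E x).2.1 •
      ((homeomorphUnitSphereProd E x).1 : E) = x := by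
    intro x
    have hx : ‖(x : E)‖ ≠ 0 := norm_ne_zero_iff.2 x.2
    simp [smul_smul, hx]
  simp only [h3] at h2
  rw [h1, h2, lintegral_prod_symm' _ hg, Measure.volumeIoiPow,
    lintegral_withDensity_eq_lintegral_mul _ (by fun_prop) (hg.lintegral_prod_left' ),
    ← lintegral_subtype_comap measurableSet_Ioi]
  rfl

theorem integral_eq_integral_polar {f : E → ℝ} (hf : Integrable f μ) :
    ∫ x, f x ∂μ = ∫ r in Ioi (0 : ℝ), r ^ (finrank ℝ E - 1) *
      ∫ θ, f (r • (θ : E)) ∂μ.toSphere := by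
  have hmp := μ.measurePreserving_homeomorphUnitSphereProd
  have hemb := (homeomorphUnitSphereProd E).measurableEmbedding
  have h1 : ∫ x, f x ∂μ = ∫ x : ({(0)}ᶜ : Set E), f x ∂(μ.comap (↑)) := by
    rw [integral_subtype_comap (measurableSet_singleton _).compl, restrict_compl_singleton]
  have h3 : ∀ x : ({(0)}ᶜ : Set E), (homeomorphUnitSphereProd E x).2.1 •
      ((homeomorphUnitSphereProd E x).1 : E) = x := by
    intro x
    have hx : ‖(x : E)‖ ≠ 0 := norm_ne_zero_iff.2 x.2
    simp [smul_smul, hx]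
  have h2 := hmp.integral_comp hemb
    (fun z : Metric.sphere (0 : E) 1 × Ioi (0 : ℝ) => f (z.2.1 • (z.1 : E)))
  have hi : Integrable (fun z : Metric.sphere (0 : E) 1 × Ioi (0 : ℝ) => f (z.2.1 • (z.1 : E)))
      (μ.toSphere.prod (Measure.volumeIoiPow (finrank ℝ E - 1))) := by
    rw [← hmp.integrable_comp_emb hemb]
    simp only [Function.comp_def, h3]
    exact (integrableOn_iff_comap_subtypeVal (measurableSet_singleton (0 : E)).compl).1
      hf.integrableOn
  simp only [h3] at h2
  rw [h1, h2, integral_prod_symm _ hi, Measure.volumeIoiPow,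
    ← integral_subtype_comap measurableSet_Ioi
      (fun r : ℝ => r ^ (finrank ℝ E - 1) * ∫ θ, f (r • (θ : E)) ∂μ.toSphere)]
  simp only [ENNReal.ofReal]
  rw [integral_withDensity_eq_integral_smul (by fun_prop)]
  refine integral_congr_ae (.of_forall fun r => ?_)
  simp only [NNReal.smul_def, smul_eq_mul]
  rw [Real.coe_toNNReal _ (pow_nonneg r.2.out.le _)]

theorem lintegral_radial {f : ℝ → ℝ≥0∞} (hf : Measurable f) :
    ∫⁻ x, f ‖x‖ ∂μ = μ.toSphere univ *
      ∫⁻ r in Ioi (0 : ℝ), ENNReal.ofReal (r ^ (finrank ℝ E - 1)) * f r := by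
  rw [lintegral_eq_lintegral_polar μ (f := fun x => f ‖x‖) (hf.comp measurable_norm),
    ← lintegral_const_mul _ (by fun_prop)]
  refine setLIntegral_congr_fun measurableSet_Ioi fun r hr => ?_
  have : ∀ θ : Metric.sphere (0 : E) 1, ‖r • (θ : E)‖ = r := fun θ => by
    simp [norm_smul, abs_of_pos (mem_Ioi.1 hr)]
  simp only [this, lintegral_const]
  ring

/-- A cap cut out of the sphere of radius `r` by a ball of radius `ρ` has surface measure at most
a constant times `ρ ^ (n - 1)`. The shell spanned by the cap, of relative thickness `ρ / r`,
fits into a ball of twice the radius. -/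
theorem exists_toSphere_cap_le : ∃ K : ℝ, 0 < K ∧ ∀ (x : E) (r ρ : ℝ), 0 < r → 0 < ρ →
    ENNReal.ofReal (r ^ (finrank ℝ E - 1)) * μ.toSphere {θ | r • (θ : E) ∈ Metric.ball x ρ} ≤
      ENNReal.ofReal (K * ρ ^ (finrank ℝ E - 1)) := by
  set n := finrank ℝ E
  have hn : 0 < n := finrank_pos
  set v := μ.real (Metric.ball 0 1)
  set s := μ.toSphere.real univ
  refine ⟨2 ^ n * v + s + 1, by positivity, fun x r ρ hr hρ => ?_⟩
  -- For `r ≤ ρ` the whole sphere is small enough.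
  rcases le_or_gt r ρ with h | h
  · calc _ ≤ ENNReal.ofReal (ρ ^ (n - 1)) * μ.toSphere univ := by
          gcongr
          exact subset_univ _
      _ = ENNReal.ofReal (s * ρ ^ (n - 1)) := by
          rw [mul_comm s, ENNReal.ofReal_mul (by positivity)]
          rw [ofReal_measureReal]
      _ ≤ _ := by
          apply ENNReal.ofReal_le_ofReal
          gcongr
          have : 0 ≤ 2 ^ n * v := by positivity
          linarith
  set A : Set (Metric.sphere (0 : E) 1) := {θ | r • (θ : E) ∈ Metric.ball x ρ}
  have hA : MeasurableSet A := measurableSet_ball.preimage (by fun_prop : Measurable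
    fun θ : Metric.sphere (0 : E) 1 => r • (θ : E))
  set η := ρ / r
  have hη : 0 < η := by positivity
  -- The points `t θ` with `θ ∈ A` and `1 < t < 1 + η` lie in the ball of radius `2 η`.
  have key : ENNReal.ofReal η * μ.toSphere A ≤ μ (Metric.ball (r⁻¹ • x) (2 * η)) := by
    rw [← lintegral_indicator_one measurableSet_ball,
      lintegral_eq_lintegral_polar μ (measurable_one.indicator measurableSet_ball)]
    calc ENNReal.ofReal η * μ.toSphere A = ∫⁻ t in Ioo (1 : ℝ) (1 + η), μ.toSphere A := by
          simp [mul_comm]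
      _ ≤ ∫⁻ t in Ioo (1 : ℝ) (1 + η), ENNReal.ofReal (t ^ (n - 1)) *
          ∫⁻ θ, (Metric.ball (r⁻¹ • x) (2 * η)).indicator 1 (t • (θ : E)) ∂μ.toSphere := by
          refine setLIntegral_mono' measurableSet_Ioo fun t ht => ?_
          rw [← one_mul (μ.toSphere A)]
          gcongr
          · rw [← ENNReal.ofReal_one]
            exact ENNReal.ofReal_le_ofReal (one_le_pow₀ ht.1.le)
          · rw [← lintegral_indicator_one hA]
            refine lintegral_mono fun θ => ?_
            by_cases hθ : θ ∈ A
            · have hmem : t • (θ : E) ∈ Metric.ball (r⁻¹ • x) (2 * η) := by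
                have h1 : ‖r • (θ : E) - x‖ < ρ := by simpa [A, dist_eq_norm] using hθ
                have h2 : ‖(θ : E) - r⁻¹ • x‖ < η := by
                  have : (θ : E) - r⁻¹ • x = r⁻¹ • (r • (θ : E) - x) := by
                    rw [smul_sub, smul_smul, inv_mul_cancel₀ hr.ne', one_smul]
                  rw [this, norm_smul, norm_inv, Real.norm_of_nonneg hr.le, inv_mul_eq_div]
                  exact div_lt_div_of_pos_right h1 hr
                have h3 : ‖t • (θ : E) - θ‖ ≤ η := by
                  have : t • (θ : E) - θ = (t - 1) • (θ : E) := by rw [sub_smul, one_smul]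
                  rw [this, norm_smul, Real.norm_of_nonneg (by linarith [ht.1])]
                  simp only [norm_eq_of_mem_sphere, mul_one]
                  linarith [ht.2]
                rw [Metric.mem_ball, dist_eq_norm]
                calc ‖t • (θ : E) - r⁻¹ • x‖ = ‖(t • (θ : E) - θ) + (θ - r⁻¹ • x)‖ := by
                      congr 1; abel
                  _ ≤ _ := norm_add_le _ _
                  _ < 2 * η := by linarith
              simp [hθ, hmem]
            · simp [hθ]
      _ ≤ _ := lintegral_mono_set fun t ht => mem_Ioi.2 (by linarith [ht.1])
  have hball : μ (Metric.ball (r⁻¹ • x) (2 * η)) = ENNReal.ofReal ((2 * η) ^ n * v) := by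
    rw [μ.addHaar_ball _ (by positivity), ENNReal.ofReal_mul (by positivity)]
    rw [ofReal_measureReal]
  have hAf : μ.toSphere A = ENNReal.ofReal (μ.toSphere.real A) := by simp
  rw [hball, hAf, ← ENNReal.ofReal_mul hη.le, ENNReal.ofReal_le_ofReal_iff (by positivity)] at key
  rw [hAf, ← ENNReal.ofReal_mul (by positivity)]
  apply ENNReal.ofReal_le_ofReal
  have hs : μ.toSphere.real A ≤ 2 ^ n * v * η ^ (n - 1) := by
    have : (2 * η) ^ n * v = η * (2 ^ n * v * η ^ (n - 1)) := by
      rw [mul_pow]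
      nth_rw 2 [← Nat.sub_add_cancel hn]
      rw [pow_succ]; ring
    rw [this] at key
    exact le_of_mul_le_mul_left key hη
  calc r ^ (n - 1) * μ.toSphere.real A ≤ r ^ (n - 1) * (2 ^ n * v * η ^ (n - 1)) := by gcongr
    _ = 2 ^ n * v * ρ ^ (n - 1) := by
      simp only [η, div_pow]
      field_simp
    _ ≤ _ := by
      gcongr
      have : 0 ≤ s := measureReal_nonneg
      linarith

end Polar

/-! ### Averages over balls of radial densities -/

section RadialAverages

open Module Filter Topology

theorem setLIntegral_rpow_Ioo {c r : ℝ} (hc : -1 < c) (hr : 0 ≤ r) :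
    ∫⁻ t in Ioo 0 r, ENNReal.ofReal (t ^ c) = ENNReal.ofReal (r ^ (c + 1) / (c + 1)) := by
  have hint : IntegrableOn (fun t : ℝ => t ^ c) (Ioo 0 r) :=
    ((intervalIntegral.intervalIntegrable_rpow' hc).1).mono_set Ioo_subset_Ioc_self
  rw [← ofReal_integral_eq_lintegral_ofReal hint, ← integral_Ioc_eq_integral_Ioo,
    ← intervalIntegral.integral_of_le hr, integral_rpow (Or.inl hc),
    Real.zero_rpow (by linarith), sub_zero]
  filter_upwards [ae_restrict_mem measurableSet_Ioo] with t ht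
  exact Real.rpow_nonneg ht.1.le _

variable {E : Type*} [NormedAddCommGroup E] [NormedSpace ℝ E] [FiniteDimensional ℝ E]
  [MeasurableSpace E] [BorelSpace E] [Nontrivial E] (μ : Measure E) [μ.IsAddHaarMeasure]

omit [MeasurableSpace E] [BorelSpace E] in
theorem pow_finrank_sub_one_mul_rpow {r e : ℝ} (hr : 0 < r) :
    ENNReal.ofReal (r ^ (finrank ℝ E - 1)) * ENNReal.ofReal (r ^ (-e)) =
      ENNReal.ofReal (r ^ ((finrank ℝ E : ℝ) - 1 - e)) := by
  rw [← ENNReal.ofReal_mul (by positivity), ← Real.rpow_natCast, ← Real.rpow_add hr,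
    Nat.cast_sub (Nat.one_le_iff_ne_zero.2 finrank_pos.ne')]
  norm_num [sub_eq_add_neg]

theorem setLIntegral_ball_zero_norm_rpow {α r : ℝ} (hα : α < finrank ℝ E) (hr : 0 ≤ r) :
    ∫⁻ y in Metric.ball 0 r, ENNReal.ofReal (‖y‖ ^ (-α)) ∂μ =
      μ.toSphere univ * ENNReal.ofReal (r ^ (finrank ℝ E - α) / (finrank ℝ E - α)) := by
  have h : ∫⁻ y in Metric.ball 0 r, ENNReal.ofReal (‖y‖ ^ (-α)) ∂μ =
      ∫⁻ y, (Iio r).indicator (fun t => ENNReal.ofReal (t ^ (-α))) ‖y‖ ∂μ := by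
    rw [← lintegral_indicator measurableSet_ball]
    refine lintegral_congr fun y => ?_
    simp [indicator]
  rw [h, lintegral_radial μ (by measurability)]
  congr 1
  have : ∀ t : ℝ, ENNReal.ofReal (t ^ (finrank ℝ E - 1)) *
      (Iio r).indicator (fun t => ENNReal.ofReal (t ^ (-α))) t =
      (Iio r).indicator (fun t => ENNReal.ofReal (t ^ (finrank ℝ E - 1)) *
        ENNReal.ofReal (t ^ (-α))) t := fun t => by
    by_cases ht : t ∈ Iio r <;> simp [ht]
  simp_rw [this]
  rw [lintegral_indicator measurableSet_Iio, Measure.restrict_restrict measurableSet_Iio,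
    inter_comm, Ioi_inter_Iio]
  rw [setLIntegral_congr_fun measurableSet_Ioo
    (fun t ht => pow_finrank_sub_one_mul_rpow (E := E) (e := α) ht.1),
    setLIntegral_rpow_Ioo (by linarith) hr]
  ring_nf

/-- Averages of `‖y‖ ^ (-α)`, `0 ≤ α < n`, over balls centred at `x` are at most a constant times
`‖x‖ ^ (-α)`: small balls stay away from the origin, and large ones may be recentred there. -/
theorem exists_setLIntegral_ball_norm_rpow_le {α : ℝ} (hα0 : 0 ≤ α) (hα : α < finrank ℝ E) :
    ∃ K : ℝ, 0 < K ∧ ∀ x : E, x ≠ 0 → ∀ ρ : ℝ, 0 < ρ →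
      ∫⁻ y in Metric.ball x ρ, ENNReal.ofReal (‖y‖ ^ (-α)) ∂μ ≤
        ENNReal.ofReal (K * ‖x‖ ^ (-α)) * μ (Metric.ball 0 ρ) := by
  set n := finrank ℝ E
  have hnα : 0 < (n : ℝ) - α := by linarith
  have hv : 0 < μ.real (Metric.ball 0 1) :=
    ENNReal.toReal_pos (Metric.measure_ball_pos μ _ one_pos).ne' measure_ball_lt_top.ne
  set v := μ.real (Metric.ball 0 1)
  set s := μ.toSphere.real univ
  have hs : 0 ≤ s := measureReal_nonneg
  set K1 := s / v * (3 ^ ((n : ℝ) - α) / (n - α) * 2 ^ α)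
  have hK1 : 0 ≤ K1 := by positivity
  refine ⟨2 ^ α + K1, by positivity, fun x hx ρ hρ => ?_⟩
  have hx' : 0 < ‖x‖ := norm_pos_iff.2 hx
  have hxα : 0 ≤ ‖x‖ ^ (-α) := by positivity
  have h2 : (‖x‖ / 2) ^ (-α) = 2 ^ α * ‖x‖ ^ (-α) := by
    rw [Real.div_rpow hx'.le zero_le_two, Real.rpow_neg zero_le_two, div_inv_eq_mul, mul_comm]
  rcases le_or_gt ρ (‖x‖ / 2) with h | h
  · calc _ ≤ ∫⁻ y in Metric.ball x ρ, ENNReal.ofReal ((2 ^ α + K1) * ‖x‖ ^ (-α)) ∂μ := by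
          refine setLIntegral_mono' measurableSet_ball fun y hy => ENNReal.ofReal_le_ofReal ?_
          have hy' : ‖x‖ / 2 ≤ ‖y‖ := by
            have : ‖x‖ - ‖y‖ ≤ ‖x - y‖ := norm_sub_norm_le _ _
            rw [Metric.mem_ball', dist_eq_norm] at hy
            linarith
          calc ‖y‖ ^ (-α) ≤ (‖x‖ / 2) ^ (-α) :=
                Real.rpow_le_rpow_of_nonpos (by positivity) hy' (by linarith)
            _ = 2 ^ α * ‖x‖ ^ (-α) := h2
            _ ≤ _ := by gcongr; linarith
      _ = _ := by
        rw [setLIntegral_const, Measure.addHaar_ball_center]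
  · have hsub : Metric.ball x ρ ⊆ Metric.ball 0 (3 * ρ) := by
      apply Metric.ball_subset_ball'
      rw [dist_zero_right]; linarith
    have hballv : μ (Metric.ball 0 ρ) = ENNReal.ofReal (ρ ^ (n : ℝ) * v) := by
      rw [μ.addHaar_ball _ hρ.le, ENNReal.ofReal_mul (by positivity), ofReal_measureReal,
        Real.rpow_natCast]
    calc _ ≤ ∫⁻ y in Metric.ball 0 (3 * ρ), ENNReal.ofReal (‖y‖ ^ (-α)) ∂μ :=
          lintegral_mono_set hsub
      _ = ENNReal.ofReal (s * ((3 * ρ) ^ ((n : ℝ) - α) / (n - α))) := by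
          rw [setLIntegral_ball_zero_norm_rpow μ hα (by positivity), ENNReal.ofReal_mul hs,
            ofReal_measureReal]
      _ ≤ _ := by
          rw [hballv, ← ENNReal.ofReal_mul (by positivity)]
          apply ENNReal.ofReal_le_ofReal
          have hρα : ρ ^ (-α) ≤ 2 ^ α * ‖x‖ ^ (-α) := by
            rw [← h2]
            exact Real.rpow_le_rpow_of_nonpos (by positivity) h.le (by linarith)
          have e1 : s * ((3 * ρ) ^ ((n : ℝ) - α) / (n - α)) =
              s * (3 ^ ((n : ℝ) - α) / (n - α)) * ρ ^ (n : ℝ) * ρ ^ (-α) := by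
            rw [Real.mul_rpow (by norm_num) hρ.le, sub_eq_add_neg, Real.rpow_add hρ]
            ring
          rw [e1]
          calc _ ≤ s * (3 ^ ((n : ℝ) - α) / (n - α)) * ρ ^ (n : ℝ) * (2 ^ α * ‖x‖ ^ (-α)) := by
                gcongr
            _ = K1 * ‖x‖ ^ (-α) * (ρ ^ (n : ℝ) * v) := by
                simp only [K1]
                field_simp
            _ ≤ _ := by
                gcongr
                have : (0 : ℝ) ≤ 2 ^ α := by positivity
                linarith

theorem measure_ball_zero_eq_ofReal {ρ : ℝ} (hρ : 0 ≤ ρ) : μ (Metric.ball 0 ρ) =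
    ENNReal.ofReal (ρ ^ (finrank ℝ E - 1) * ρ * μ.real (Metric.ball 0 1)) := by
  rw [μ.addHaar_ball _ hρ, ENNReal.ofReal_mul (by positivity), ofReal_measureReal, ← pow_succ,
    Nat.sub_add_cancel finrank_pos]

omit [FiniteDimensional ℝ E] [MeasurableSpace E] [BorelSpace E] [Nontrivial E] in
theorem abs_sub_norm_lt_of_smul_mem_ball {x : E} {r ρ : ℝ} (hr : 0 < r)
    {θ : Metric.sphere (0 : E) 1} (h : r • (θ : E) ∈ Metric.ball x ρ) : |r - ‖x‖| < ρ := by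
  rw [Metric.mem_ball, dist_eq_norm] at h
  have h1 : ‖r • (θ : E)‖ = r := by simp [norm_smul, abs_of_pos hr]
  calc |r - ‖x‖| = |‖r • (θ : E)‖ - ‖x‖| := by rw [h1]
    _ ≤ _ := abs_norm_sub_norm_le _ _
    _ < ρ := h

/-- Averages over balls of a density that blows up at a sphere reduce, by the bound on spherical
caps, to averages over intervals of a power of one real variable. -/
theorem exists_setLIntegral_ball_sub_norm_rpow_le (R : ℝ) {ε : ℝ} (hε0 : 0 ≤ ε) (hε : ε < 1) :
    ∃ K : ℝ, 0 < K ∧ ∀ x : E, ‖x‖ ≠ R → ∀ ρ : ℝ, 0 < ρ →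
      ∫⁻ y in Metric.ball x ρ, ENNReal.ofReal (|R - ‖y‖| ^ (-ε)) ∂μ ≤
        ENNReal.ofReal (K * |R - ‖x‖| ^ (-ε)) * μ (Metric.ball 0 ρ) := by
  obtain ⟨K, hK, hcap⟩ := exists_toSphere_cap_le μ
  obtain ⟨K1, hK1, hone⟩ := exists_setLIntegral_ball_norm_rpow_le (volume : Measure ℝ) hε0
    (by simpa using hε)
  have hv : 0 < μ.real (Metric.ball 0 1) :=
    ENNReal.toReal_pos (Metric.measure_ball_pos μ _ one_pos).ne' measure_ball_lt_top.ne
  set v := μ.real (Metric.ball 0 1)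
  refine ⟨K * K1 * 2 / v, by positivity, fun x hx ρ hρ => ?_⟩
  rw [← lintegral_indicator measurableSet_ball, lintegral_eq_lintegral_polar μ
    ((by fun_prop : Measurable fun y : E => ENNReal.ofReal (|R - ‖y‖| ^ (-ε))).indicator
      measurableSet_ball)]
  calc _ ≤ ∫⁻ r in Ioi 0, (Metric.ball ‖x‖ ρ).indicator (fun r => ENNReal.ofReal
        (K * ρ ^ (finrank ℝ E - 1)) * ENNReal.ofReal (|R - r| ^ (-ε))) r := by
        refine setLIntegral_mono' measurableSet_Ioi fun r hr => ?_
        have hr : 0 < r := hr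
        set A : Set (Metric.sphere (0 : E) 1) := {θ | r • (θ : E) ∈ Metric.ball x ρ}
        have hA : MeasurableSet A := measurableSet_ball.preimage (by fun_prop : Measurable
          fun θ : Metric.sphere (0 : E) 1 => r • (θ : E))
        have e : ∀ θ : Metric.sphere (0 : E) 1, (Metric.ball x ρ).indicator
            (fun y => ENNReal.ofReal (|R - ‖y‖| ^ (-ε))) (r • (θ : E)) =
            A.indicator (fun _ => ENNReal.ofReal (|R - r| ^ (-ε))) θ := fun θ => by
          have h1 : ‖r • (θ : E)‖ = r := by simp [norm_smul, abs_of_pos hr]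
          simp [indicator, A, h1]
        have e' : ∫⁻ θ, (Metric.ball x ρ).indicator
            (fun y => ENNReal.ofReal (|R - ‖y‖| ^ (-ε))) (r • (θ : E)) ∂μ.toSphere =
            ENNReal.ofReal (|R - r| ^ (-ε)) * μ.toSphere A := by
          simp_rw [e]
          rw [lintegral_indicator hA, setLIntegral_const]
        refine (congrArg _ e').trans_le ?_
        by_cases hb : r ∈ Metric.ball ‖x‖ ρ
        · rw [indicator_of_mem hb, mul_left_comm, mul_comm]
          gcongr
          exact hcap x r ρ hr hρ
        · have : A = ∅ := eq_empty_of_forall_notMem fun θ hθ =>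
            hb (by simpa [Real.dist_eq] using abs_sub_norm_lt_of_smul_mem_ball hr hθ)
          simp [this]
    _ ≤ ∫⁻ r, (Metric.ball ‖x‖ ρ).indicator (fun r => ENNReal.ofReal
        (K * ρ ^ (finrank ℝ E - 1)) * ENNReal.ofReal (|R - r| ^ (-ε))) r :=
        setLIntegral_le_lintegral _ _
    _ = ∫⁻ r, (Metric.ball (‖x‖ - R) ρ).indicator (fun r => ENNReal.ofReal
        (K * ρ ^ (finrank ℝ E - 1)) * ENNReal.ofReal (‖r‖ ^ (-ε))) r := by
        rw [← lintegral_sub_right_eq_self (fun r => (Metric.ball (‖x‖ - R) ρ).indicator (fun r =>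
          ENNReal.ofReal (K * ρ ^ (finrank ℝ E - 1)) * ENNReal.ofReal (‖r‖ ^ (-ε))) r) R]
        refine lintegral_congr fun r => ?_
        have : r - R ∈ Metric.ball (‖x‖ - R) ρ ↔ r ∈ Metric.ball ‖x‖ ρ := by
          simp [Real.dist_eq]
        by_cases hr : r ∈ Metric.ball ‖x‖ ρ
        · simp only [indicator_of_mem hr, indicator_of_mem (this.2 hr), Real.norm_eq_abs,
            abs_sub_comm R r]
        · simp only [indicator_of_notMem hr, indicator_of_notMem (mt this.1 hr)]
    _ = ENNReal.ofReal (K * ρ ^ (finrank ℝ E - 1)) *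
        ∫⁻ r in Metric.ball (‖x‖ - R) ρ, ENNReal.ofReal (‖r‖ ^ (-ε)) := by
        rw [lintegral_indicator measurableSet_ball, lintegral_const_mul _ (by fun_prop)]
    _ ≤ ENNReal.ofReal (K * ρ ^ (finrank ℝ E - 1)) *
        (ENNReal.ofReal (K1 * ‖‖x‖ - R‖ ^ (-ε)) * volume (Metric.ball (0 : ℝ) ρ)) := by
        gcongr
        exact hone _ (sub_ne_zero.2 hx) ρ hρ
    _ = _ := by
        rw [measure_ball_zero_eq_ofReal μ hρ.le, Real.volume_ball,
          ← ENNReal.ofReal_mul (by positivity), ← ENNReal.ofReal_mul (by positivity),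
          ← ENNReal.ofReal_mul (by positivity), Real.norm_eq_abs, abs_sub_comm R]
        congr 1
        change _ = K * K1 * 2 / v * _ * (_ * v)
        field_simp

/-- The image on the sphere of radius `R` of the surface measure on the unit sphere, that is, the
surface measure of that sphere divided by `R ^ (n - 1)` if `R > 0`. -/
noncomputable def dilatedSphereMeasure (R : ℝ) : Measure E :=
  μ.toSphere.map fun θ : Metric.sphere (0 : E) 1 => R • (θ : E)

instance (R : ℝ) : IsFiniteMeasure (dilatedSphereMeasure μ R) := by
  unfold dilatedSphereMeasure; infer_instance

/-- A ball around `x` that meets the sphere has radius `ρ > |R - ‖x‖|`, and the cap it cuts out has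
measure of order `ρ ^ (n - 1)`. -/
theorem exists_dilatedSphereMeasure_ball_le {R : ℝ} (hR : 0 < R) :
    ∃ K : ℝ, 0 < K ∧ ∀ x : E, ‖x‖ ≠ R → ∀ ρ : ℝ, 0 < ρ →
      dilatedSphereMeasure μ R (Metric.ball x ρ) ≤
        ENNReal.ofReal (K * |R - ‖x‖| ^ (-1 : ℝ)) * μ (Metric.ball 0 ρ) := by
  obtain ⟨K, hK, hcap⟩ := exists_toSphere_cap_le μ
  have hv : 0 < μ.real (Metric.ball 0 1) :=
    ENNReal.toReal_pos (Metric.measure_ball_pos μ _ one_pos).ne' measure_ball_lt_top.ne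
  set n := finrank ℝ E
  set v := μ.real (Metric.ball 0 1)
  refine ⟨K / (R ^ (n - 1) * v), by positivity, fun x hx ρ hρ => ?_⟩
  have hpos : 0 < |R - ‖x‖| := abs_pos.2 (sub_ne_zero.2 hx.symm)
  rw [dilatedSphereMeasure, Measure.map_apply (by fun_prop) measurableSet_ball]
  change μ.toSphere {θ | R • (θ : E) ∈ Metric.ball x ρ} ≤ _
  rcases le_or_gt ρ |R - ‖x‖| with h | h
  · have : {θ : Metric.sphere (0 : E) 1 | R • (θ : E) ∈ Metric.ball x ρ} = ∅ :=
      eq_empty_of_forall_notMem fun θ hθ =>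
        absurd (abs_sub_norm_lt_of_smul_mem_ball hR hθ) h.not_gt
    rw [this, measure_empty]
    exact bot_le
  · have h1 := hcap x R ρ hR hρ
    have h2 : ENNReal.ofReal (R ^ (n - 1)) ≠ 0 := by simp; positivity
    rw [mul_comm, ← ENNReal.le_div_iff_mul_le (Or.inl h2) (Or.inl ENNReal.ofReal_ne_top),
      ← ENNReal.ofReal_div_of_pos (by positivity)] at h1
    refine h1.trans ?_
    rw [measure_ball_zero_eq_ofReal μ hρ.le, ← ENNReal.ofReal_mul (by positivity)]
    apply ENNReal.ofReal_le_ofReal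
    rw [Real.rpow_neg_one]
    have : 1 ≤ |R - ‖x‖|⁻¹ * ρ := by
      rw [inv_mul_eq_div, one_le_div hpos]; exact h.le
    calc K * ρ ^ (n - 1) / R ^ (n - 1) ≤ K * ρ ^ (n - 1) / R ^ (n - 1) * (|R - ‖x‖|⁻¹ * ρ) :=
          le_mul_of_one_le_right (by positivity) this
      _ = K / (R ^ (n - 1) * v) * |R - ‖x‖|⁻¹ * (ρ ^ (n - 1) * ρ * v) := by
        field_simp

/-- Away from the origin the density is dominated by its first factor, away from the sphere of
radius `R` by its second one. -/
theorem setLIntegral_ball_sub_norm_rpow_mul_norm_rpow_lt_top {R e₁ e₂ : ℝ} (hR : 0 < R)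
    (h₁ : e₁ < 1) (h₂ : e₂ < finrank ℝ E) :
    ∫⁻ x in Metric.ball (0 : E) (2 * R), ENNReal.ofReal (|R - ‖x‖| ^ (-e₁) * ‖x‖ ^ (-e₂)) ∂μ
      < ⊤ := by
  have hbd1 : ∃ K1 : ℝ, ∀ t ∈ Icc 0 (R / 2), |R - t| ^ (-e₁) ≤ K1 := by
    have hc : ContinuousOn (fun t : ℝ => |R - t| ^ (-e₁)) (Icc 0 (R / 2)) := by
      refine ContinuousOn.rpow_const (by fun_prop) fun t ht => Or.inl ?_
      exact (abs_pos.2 (by linarith [ht.2])).ne'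
    exact (isCompact_Icc.bddAbove_image hc).imp fun K hK t ht => hK ⟨t, ht, rfl⟩
  have hbd2 : ∃ K2 : ℝ, ∀ t ∈ Icc (R / 2) (2 * R), t ^ ((finrank ℝ E : ℝ) - 1 - e₂) ≤ K2 := by
    have hc : ContinuousOn (fun t : ℝ => t ^ ((finrank ℝ E : ℝ) - 1 - e₂))
        (Icc (R / 2) (2 * R)) := by
      refine ContinuousOn.rpow_const (by fun_prop) fun t ht => Or.inl ?_
      linarith [ht.1]
    exact (isCompact_Icc.bddAbove_image hc).imp fun K hK t ht => hK ⟨t, ht, rfl⟩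
  obtain ⟨K1, hK1⟩ := hbd1
  obtain ⟨K2, hK2⟩ := hbd2
  have h : ∫⁻ x in Metric.ball (0 : E) (2 * R),
        ENNReal.ofReal (|R - ‖x‖| ^ (-e₁) * ‖x‖ ^ (-e₂)) ∂μ =
      ∫⁻ y, (Iio (2 * R)).indicator
        (fun t => ENNReal.ofReal (|R - t| ^ (-e₁) * t ^ (-e₂))) ‖y‖ ∂μ := by
    rw [← lintegral_indicator measurableSet_ball]
    refine lintegral_congr fun y => ?_
    simp [indicator]
  rw [h, lintegral_radial μ ((by fun_prop : Measurable _).indicator measurableSet_Iio)]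
  refine ENNReal.mul_lt_top (measure_lt_top _ _) ?_
  have hone : ∫⁻ r in Ioo 0 (2 * R), ENNReal.ofReal (|R - r| ^ (-e₁)) < ⊤ := by
    calc _ ≤ ∫⁻ r in Metric.ball R R, ENNReal.ofReal (|R - r| ^ (-e₁)) := by
          refine lintegral_mono_set fun r hr => ?_
          rw [Metric.mem_ball, Real.dist_eq, abs_lt]
          constructor <;> linarith [hr.1, hr.2]
      _ = ∫⁻ r in Metric.ball (0 : ℝ) R, ENNReal.ofReal (‖r‖ ^ (-e₁)) := by
          rw [← lintegral_indicator measurableSet_ball, ← lintegral_indicator measurableSet_ball,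
            ← lintegral_sub_right_eq_self (fun r => (Metric.ball (0 : ℝ) R).indicator
              (fun r => ENNReal.ofReal (‖r‖ ^ (-e₁))) r) R]
          refine lintegral_congr fun r => ?_
          simp [indicator, Real.dist_eq, abs_sub_comm R r]
      _ < ⊤ := by
          rw [setLIntegral_ball_zero_norm_rpow _ (by simpa using h₁) hR.le]
          exact ENNReal.mul_lt_top (measure_lt_top _ _) ENNReal.ofReal_lt_top
  calc _ ≤ ∫⁻ r in Ioo 0 (2 * R), (ENNReal.ofReal K1 *
        ENNReal.ofReal (r ^ ((finrank ℝ E : ℝ) - 1 - e₂)) +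
        ENNReal.ofReal K2 * ENNReal.ofReal (|R - r| ^ (-e₁))) := by
        rw [← Ioi_inter_Iio, inter_comm, ← Measure.restrict_restrict measurableSet_Iio,
          ← lintegral_indicator measurableSet_Iio]
        refine setLIntegral_mono' measurableSet_Ioi fun r hr => ?_
        have hr : 0 < r := hr
        by_cases hr2 : r ∈ Iio (2 * R)
        · rw [indicator_of_mem hr2, indicator_of_mem hr2,
            ENNReal.ofReal_mul (by positivity), mul_left_comm, pow_finrank_sub_one_mul_rpow hr]
          rcases le_or_gt r (R / 2) with h | h
          · refine le_trans ?_ le_self_add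
            gcongr
            exact hK1 r ⟨hr.le, h⟩
          · refine le_trans ?_ le_add_self
            rw [mul_comm]
            gcongr
            exact hK2 r ⟨h.le, (mem_Iio.1 hr2).le⟩
        · simp [indicator_of_notMem hr2]
    _ < ⊤ := by
        rw [lintegral_add_left (by fun_prop), lintegral_const_mul _ (by fun_prop),
          lintegral_const_mul _ (by fun_prop), setLIntegral_rpow_Ioo (by linarith) (by positivity)]
        exact ENNReal.add_lt_top.2 ⟨ENNReal.mul_lt_top ENNReal.ofReal_lt_top ENNReal.ofReal_lt_top,
          ENNReal.mul_lt_top ENNReal.ofReal_lt_top hone⟩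

theorem setLIntegral_compl_ball_norm_rpow_lt_top {R e : ℝ} (hR : 0 < R)
    (he : finrank ℝ E < e) :
    ∫⁻ x in (Metric.ball (0 : E) R)ᶜ, ENNReal.ofReal (‖x‖ ^ (-e)) ∂μ < ⊤ := by
  have h : ∫⁻ x in (Metric.ball (0 : E) R)ᶜ, ENNReal.ofReal (‖x‖ ^ (-e)) ∂μ =
      ∫⁻ y, (Ici R).indicator (fun t => ENNReal.ofReal (t ^ (-e))) ‖y‖ ∂μ := by
    rw [← lintegral_indicator measurableSet_ball.compl]
    refine lintegral_congr fun y => ?_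
    simp [indicator]
  rw [h, lintegral_radial μ ((by fun_prop : Measurable _).indicator measurableSet_Ici)]
  refine ENNReal.mul_lt_top (measure_lt_top _ _) ?_
  have hint := (integrableOn_Ioi_rpow_of_lt (show (finrank ℝ E : ℝ) - 1 - e < -1 by linarith)
    (show 0 < R / 2 by positivity))
  calc _ ≤ ∫⁻ r in Ioi (R / 2), ENNReal.ofReal (r ^ ((finrank ℝ E : ℝ) - 1 - e)) := by
        rw [← lintegral_indicator measurableSet_Ioi, ← lintegral_indicator measurableSet_Ioi]
        refine lintegral_mono fun r => ?_
        by_cases hr : R ≤ r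
        · have hr0 : 0 < r := by linarith
          have hr1 : R / 2 < r := by linarith
          simp only [indicator, mem_Ioi, hr0, hr1, mem_Ici, hr, if_true]
          rw [pow_finrank_sub_one_mul_rpow hr0]
        · simp [indicator, hr]
    _ < ⊤ := hint.lintegral_lt_top

end RadialAverages

/-! ### The maximal function: semicontinuity and scaling -/

section Maximal

open Module Filter Topology Leibenson

variable {d : ℕ}

theorem maximalMeasure_le {μ : Measure (EuclideanSpace ℝ (Fin d))}
    {x : EuclideanSpace ℝ (Fin d)} {c : ℝ≥0∞}
    (h : ∀ ρ : ℝ, 0 < ρ → μ (Metric.ball x ρ) ≤ c * volume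
      (Metric.ball (0 : EuclideanSpace ℝ (Fin d)) ρ)) : maximalMeasure μ x ≤ c :=
  iSup₂_le fun ρ hρ => ENNReal.div_le_of_le_mul (h ρ hρ)

/-- An open ball is the increasing union of concentric smaller balls, and these stay inside it when
the centre moves a little. -/
theorem lowerSemicontinuous_measure_ball {X : Type*} [PseudoMetricSpace X] [MeasurableSpace X]
    (μ : Measure X) (r : ℝ) : LowerSemicontinuous fun x => μ (Metric.ball x r) := by
  intro x c hc
  have hU : Metric.ball x r = ⋃ n : ℕ, Metric.ball x (r - 1 / (n + 1)) := by
    ext y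
    simp only [Metric.mem_ball, mem_iUnion]
    refine ⟨fun h => ?_, fun ⟨n, hn⟩ => hn.trans ?_⟩
    · obtain ⟨n, hn⟩ := exists_nat_one_div_lt (sub_pos.2 h)
      exact ⟨n, by linarith⟩
    · have : (0 : ℝ) < 1 / (n + 1) := by positivity
      linarith
  have hmono : Monotone fun n : ℕ => Metric.ball x (r - 1 / ((n : ℝ) + 1)) := fun m n hmn => by
    apply Metric.ball_subset_ball
    have : (1 : ℝ) / (n + 1) ≤ 1 / (m + 1) := one_div_le_one_div_of_le (by positivity)
      (by exact_mod_cast Nat.succ_le_succ hmn)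
    linarith
  change c < μ (Metric.ball x r) at hc
  rw [hU, hmono.measure_iUnion, lt_iSup_iff] at hc
  obtain ⟨n, hn⟩ := hc
  have hpos : (0 : ℝ) < 1 / (n + 1) := by positivity
  filter_upwards [Metric.ball_mem_nhds x hpos] with y hy
  refine hn.trans_le (measure_mono (Metric.ball_subset_ball' ?_))
  rw [dist_comm]
  linarith [Metric.mem_ball.1 hy]

theorem measurable_maximalMeasure (μ : Measure (EuclideanSpace ℝ (Fin d))) :
    Measurable (maximalMeasure μ) := by
  refine LowerSemicontinuous.measurable (lowerSemicontinuous_biSup fun r hr => ?_)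
  refine Continuous.comp_lowerSemicontinuous (g := fun a : ℝ≥0∞ => a / volume (Metric.ball
    (0 : EuclideanSpace ℝ (Fin d)) r)) (ENNReal.continuous_div_const _
      (Metric.measure_ball_pos _ _ hr).ne') (lowerSemicontinuous_measure_ball μ r)
      fun a b hab => ENNReal.div_le_div_right hab _

theorem maximalMeasure_smul (c : ℝ≥0∞) (μ : Measure (EuclideanSpace ℝ (Fin d)))
    (x : EuclideanSpace ℝ (Fin d)) : maximalMeasure (c • μ) x = c * maximalMeasure μ x := by
  simp only [maximalMeasure, ENNReal.mul_iSup, Measure.smul_apply, smul_eq_mul, mul_div_assoc]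

theorem preimage_inv_smul_ball {l : ℝ} (hl : 0 < l) (x : EuclideanSpace ℝ (Fin d)) (r : ℝ) :
    (fun y => l⁻¹ • y) ⁻¹' Metric.ball x r = Metric.ball (l • x) (l * r) := by
  ext y
  have : l⁻¹ • y - x = l⁻¹ • (y - l • x) := by
    rw [smul_sub, smul_smul, inv_mul_cancel₀ hl.ne', one_smul]
  rw [mem_preimage, Metric.mem_ball, Metric.mem_ball, dist_eq_norm, dist_eq_norm, this, norm_smul,
    norm_inv, Real.norm_of_nonneg hl.le, inv_mul_lt_iff₀ hl]

/-- The factor `l ^ d` is the ratio of the volumes of the balls of radius `l r` and `r`. -/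
theorem maximalMeasure_map_inv_smul {l : ℝ} (hl : 0 < l)
    (μ : Measure (EuclideanSpace ℝ (Fin d))) (x : EuclideanSpace ℝ (Fin d)) :
    maximalMeasure (μ.map fun y => l⁻¹ • y) x =
      ENNReal.ofReal (l ^ d) * maximalMeasure μ (l • x) := by
  have hld : ENNReal.ofReal (l ^ d) ≠ 0 := by simp; positivity
  have key : ∀ r : ℝ, (μ.map fun y => l⁻¹ • y) (Metric.ball x r) /
      volume (Metric.ball (0 : EuclideanSpace ℝ (Fin d)) r) = ENNReal.ofReal (l ^ d) *
        (μ (Metric.ball (l • x) (l * r)) /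
          volume (Metric.ball (0 : EuclideanSpace ℝ (Fin d)) (l * r))) := fun r => by
    rw [Measure.map_apply (by fun_prop) measurableSet_ball, preimage_inv_smul_ball hl,
      Measure.addHaar_ball_mul_of_pos volume _ hl, finrank_euclideanSpace_fin,
      ← mul_div_assoc, ENNReal.mul_div_mul_left _ _ hld ENNReal.ofReal_ne_top]
  simp only [maximalMeasure, key, ENNReal.mul_iSup]
  refine le_antisymm (iSup₂_le fun r hr => ?_) (iSup₂_le fun r hr => ?_)
  · exact le_iSup₂_of_le (l * r) (by positivity) le_rfl
  · refine le_iSup₂_of_le (l⁻¹ * r) (by positivity) ?_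
    rw [mul_inv_cancel_left₀ hl.ne']

/-- The change of variables `y = l x`; no measurability of `f` is needed as dilations are measurable
equivalences. -/
theorem lintegral_comp_smul_of_pos {l : ℝ} (hl : 0 < l) (f : EuclideanSpace ℝ (Fin d) → ℝ≥0∞) :
    ∫⁻ x, f (l • x) = ENNReal.ofReal ((l ^ d)⁻¹) * ∫⁻ x, f x := by
  have h := lintegral_map_equiv (μ := volume) f
    (Homeomorph.smulOfNeZero (α := EuclideanSpace ℝ (Fin d)) l hl.ne').toMeasurableEquiv
  have h2 : Measure.map ((Homeomorph.smulOfNeZero (α := EuclideanSpace ℝ (Fin d)) l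
      hl.ne').toMeasurableEquiv) volume = ENNReal.ofReal ((l ^ d)⁻¹) • volume := by
    have := Measure.map_addHaar_smul (volume : Measure (EuclideanSpace ℝ (Fin d))) hl.ne'
    rw [abs_of_pos (by positivity), finrank_euclideanSpace_fin] at this
    exact this
  rw [h2, lintegral_smul_measure, smul_eq_mul] at h
  exact h.symm

theorem maximalFun_congr_ae {f g : EuclideanSpace ℝ (Fin d) → EuclideanSpace ℝ (Fin d)}
    (h : f =ᵐ[volume] g) : maximalFun f = maximalFun g := by
  unfold maximalFun
  rw [withDensity_congr_ae (g := fun y => ‖g y‖ₑ) (h.mono fun x hx => congrArg _ hx)]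

theorem maximalFun_smul_comp_smul (c : ℝ) {l : ℝ} (hl : 0 < l)
    (G : EuclideanSpace ℝ (Fin d) → EuclideanSpace ℝ (Fin d)) (x : EuclideanSpace ℝ (Fin d)) :
    maximalFun (fun x => c • G (l • x)) x = ‖c‖ₑ * maximalFun G (l • x) := by
  have key : volume.withDensity (fun y => ‖c • G (l • y)‖ₑ) = (‖c‖ₑ * ENNReal.ofReal ((l ^ d)⁻¹)) •
      (volume.withDensity fun y => ‖G y‖ₑ).map fun y => l⁻¹ • y := by
    ext s hs
    have hpre : MeasurableSet ((fun y : EuclideanSpace ℝ (Fin d) => l⁻¹ • y) ⁻¹' s) :=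
      hs.preimage (by fun_prop)
    rw [withDensity_apply _ hs, Measure.smul_apply, Measure.map_apply (by fun_prop) hs,
      withDensity_apply _ hpre, ← lintegral_indicator hs, ← lintegral_indicator hpre, smul_eq_mul,
      mul_assoc, ← lintegral_comp_smul_of_pos hl,
      ← lintegral_const_mul' _ _ (by simp)]
    refine lintegral_congr fun y => ?_
    by_cases hy : y ∈ s
    · simp [indicator, hy, enorm_smul, smul_smul, hl.ne']
    · simp [indicator, hy, smul_smul, hl.ne']
  rw [maximalFun, key, maximalMeasure_smul, maximalMeasure_map_inv_smul hl, maximalFun, mul_assoc,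
    ← mul_assoc (ENNReal.ofReal _), ← ENNReal.ofReal_mul (by positivity),
    inv_mul_cancel₀ (by positivity), ENNReal.ofReal_one, one_mul]

end Maximal

/-! ### Uniqueness and scaling of weak derivatives -/

section WeakDerivatives

open Module Filter Topology Leibenson

variable {d : ℕ}

local notation "𝔼" => EuclideanSpace ℝ (Fin d)

theorem Leibenson.IsTestFunction.integrable {φ : 𝔼 → ℝ} (hφ : IsTestFunction φ) (μ : Measure 𝔼)
    [IsFiniteMeasureOnCompacts μ] : Integrable φ μ :=
  hφ.1.continuous.integrable_of_hasCompactSupport hφ.2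

/-- Finite measures are determined by their integrals against test functions: a bounded open set is
the support of a smooth `f ≥ 0`, and its indicator is the limit of smooth truncations of `n f`. -/
theorem measure_ext_of_integral_testFunction {μ ν : Measure 𝔼} [IsFiniteMeasure μ]
    [IsFiniteMeasure ν] (h : ∀ φ : 𝔼 → ℝ, IsTestFunction φ → ∫ x, φ x ∂μ = ∫ x, φ x ∂ν) :
    μ = ν := by
  have hU : ∀ U : Set 𝔼, IsOpen U → Bornology.IsBounded U → μ U = ν U := by
    intro U hU hUb
    obtain ⟨f, hfs, hf, hf0⟩ := hU.exists_contDiff_support_eq (n := (⊤ : ℕ∞))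
    set g : ℕ → 𝔼 → ℝ := fun n x => Real.smoothTransition (n * f x)
    have hg : ∀ n, IsTestFunction (g n) := fun n => by
      refine ⟨Real.smoothTransition.contDiff.comp (contDiff_const.mul hf), ?_⟩
      refine HasCompactSupport.intro (K := closure U) hUb.isCompact_closure fun x hx => ?_
      have : f x = 0 := by
        by_contra h0
        exact hx (subset_closure (hfs ▸ h0))
      simp [g, this]
    have hlim : ∀ (κ : Measure 𝔼) [IsFiniteMeasure κ],
        Tendsto (fun n => ∫ x, g n x ∂κ) atTop (𝓝 (κ.real U)) := fun κ _ => by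
      rw [← integral_indicator_one hU.measurableSet]
      refine tendsto_integral_of_dominated_convergence (fun _ => 1)
        (fun n => ((hg n).integrable κ).aestronglyMeasurable) (integrable_const _)
        (fun n => .of_forall fun x => ?_) (.of_forall fun x => ?_)
      · rw [Real.norm_of_nonneg (Real.smoothTransition.nonneg _)]
        exact Real.smoothTransition.le_one _
      · by_cases hx : x ∈ U
        · have hfx : 0 < f x := lt_of_le_of_ne (hf0 ⟨x, rfl⟩).1
            (Ne.symm (by rw [← hfs] at hx; exact hx))
          obtain ⟨N, hN⟩ := exists_nat_ge (1 / f x)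
          refine tendsto_const_nhds.congr' ?_
          filter_upwards [eventually_ge_atTop N] with n hn
          have hn' : (N : ℝ) ≤ n := by exact_mod_cast hn
          rw [indicator_of_mem hx, Pi.one_apply]
          refine (Real.smoothTransition.one_of_one_le ?_).symm
          rw [div_le_iff₀ hfx] at hN
          nlinarith
        · have : f x = 0 := by
            by_contra h0
            exact hx (hfs ▸ h0)
          simp [g, this, hx]
    have h1 := tendsto_nhds_unique (hlim μ) ((hlim ν).congr fun n => (h _ (hg n)).symm)
    exact (measureReal_eq_measureReal_iff).1 h1
  have hopen : ∀ U : Set 𝔼, IsOpen U → μ U = ν U := by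
    intro U hUo
    have e : U = ⋃ n : ℕ, U ∩ Metric.ball 0 n := by
      rw [← inter_iUnion, Metric.iUnion_ball_nat, inter_univ]
    have hm : Monotone fun n : ℕ => U ∩ Metric.ball (0 : 𝔼) n := fun m n hmn =>
      inter_subset_inter_right _ (Metric.ball_subset_ball (by exact_mod_cast hmn))
    rw [e, hm.measure_iUnion, hm.measure_iUnion]
    exact iSup_congr fun n => hU _ (hUo.inter Metric.isOpen_ball)
      (Metric.isBounded_ball.subset inter_subset_right)
  exact ext_of_generate_finite {s : Set 𝔼 | IsOpen s}
    (BorelSpace.measurable_eq (α := 𝔼)) isPiSystem_isOpen (fun s hs => hopen s hs)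
    (hopen _ isOpen_univ)

theorem signedMeasure_integral_sub {μ ν : Measure 𝔼} [IsFiniteMeasure μ] [IsFiniteMeasure ν]
    {φ : 𝔼 → ℝ} (hφ : IsTestFunction φ) :
    ∫ᵛ x, φ x ∂<•(μ.toSignedMeasure - ν.toSignedMeasure) = ∫ x, φ x ∂μ - ∫ x, φ x ∂ν := by
  rw [VectorMeasure.integral_sub_vectorMeasure, VectorMeasure.integral_toSignedMeasure,
    VectorMeasure.integral_toSignedMeasure]
  · simpa [VectorMeasure.Integrable] using hφ.integrable μ
  · simpa [VectorMeasure.Integrable] using hφ.integrable ν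

/-- Reduces to positive measures by moving the negative parts of the Jordan decompositions to the
other side. -/
theorem signedMeasure_ext_of_integral_testFunction {s t : SignedMeasure 𝔼}
    (h : ∀ φ : 𝔼 → ℝ, IsTestFunction φ → ∫ᵛ x, φ x ∂<•s = ∫ᵛ x, φ x ∂<•t) : s = t := by
  have hs := s.toSignedMeasure_toJordanDecomposition
  have ht := t.toSignedMeasure_toJordanDecomposition
  rw [JordanDecomposition.toSignedMeasure] at hs ht
  have key : s.toJordanDecomposition.posPart + t.toJordanDecomposition.negPart =
      t.toJordanDecomposition.posPart + s.toJordanDecomposition.negPart := by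
    refine measure_ext_of_integral_testFunction fun φ hφ => ?_
    have h1 := h φ hφ
    rw [← hs, ← ht, signedMeasure_integral_sub hφ, signedMeasure_integral_sub hφ] at h1
    rw [integral_add_measure (hφ.integrable _) (hφ.integrable _),
      integral_add_measure (hφ.integrable _) (hφ.integrable _)]
    linarith
  rw [← hs, ← ht, sub_eq_sub_iff_add_eq_add, ← Measure.toSignedMeasure_add,
    ← Measure.toSignedMeasure_add]
  simp only [key]

theorem entry_apply
    (D : VectorMeasure 𝔼 (EuclideanSpace ℝ (Fin d × Fin d))) (i j : Fin d) (s : Set 𝔼) :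
    entry D i j s = D s (i, j) := rfl

theorem Leibenson.IsDistribHessian.unique {u : 𝔼 → ℝ}
    {D D' : VectorMeasure 𝔼 (EuclideanSpace ℝ (Fin d × Fin d))}
    (h : IsDistribHessian u D) (h' : IsDistribHessian u D') : D = D' := by
  ext s hs ⟨i, j⟩
  rw [← entry_apply, ← entry_apply]
  congr 1
  exact signedMeasure_ext_of_integral_testFunction fun φ hφ =>
    (h.2 φ hφ i j).symm.trans (h'.2 φ hφ i j)

theorem Leibenson.IsDistribHessian.congr_ae {u v : 𝔼 → ℝ}
    {D : VectorMeasure 𝔼 (EuclideanSpace ℝ (Fin d × Fin d))}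
    (h : IsDistribHessian u D) (huv : u =ᵐ[volume] v) : IsDistribHessian v D := by
  refine ⟨h.1.congr huv, fun φ hφ i j => ?_⟩
  rw [← h.2 φ hφ i j]
  exact integral_congr_ae (huv.mono fun x hx => by simp only [hx])

theorem Leibenson.IsWeakGradient.congr_ae {u v : 𝔼 → ℝ} {G : 𝔼 → 𝔼}
    (h : IsWeakGradient u G) (huv : u =ᵐ[volume] v) : IsWeakGradient v G := by
  refine ⟨h.1.congr huv, h.2.1, fun φ hφ i => ?_⟩
  rw [← h.2.2 φ hφ i]
  exact integral_congr_ae (huv.mono fun x hx => by simp only [hx])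

theorem Leibenson.IsWeakGradient.unique_ae {u : 𝔼 → ℝ} {G G' : 𝔼 → 𝔼}
    (h : IsWeakGradient u G) (h' : IsWeakGradient u G') : G =ᵐ[volume] G' := by
  have hcoord : ∀ {F : 𝔼 → 𝔼}, LocallyIntegrable F → ∀ i, LocallyIntegrable fun x => F x i :=
    fun {F} hF i x => by
      obtain ⟨s, hs, hint⟩ := hF x
      exact ⟨s, hs, (EuclideanSpace.proj (𝕜 := ℝ) i).integrable_comp hint⟩
  have hi : ∀ i : Fin d, ∀ᵐ x : 𝔼, G x i = G' x i := fun i => by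
    refine ae_eq_of_integral_contDiff_smul_eq (hcoord h.2.1 i) (hcoord h'.2.1 i) fun g hg hgc => ?_
    have e1 := h.2.2 g ⟨hg, hgc⟩ i
    have e2 := h'.2.2 g ⟨hg, hgc⟩ i
    simp only [smul_eq_mul, mul_comm (g _)]
    linarith
  filter_upwards [ae_all_iff.2 hi] with x hx
  ext i
  exact hx i

theorem Leibenson.IsTestFunction.comp_smul {φ : 𝔼 → ℝ} (hφ : IsTestFunction φ) {l : ℝ}
    (hl : l ≠ 0) : IsTestFunction fun x => φ (l • x) :=
  ⟨hφ.1.comp (contDiff_const_smul l), hφ.2.comp_homeomorph (Homeomorph.smulOfNeZero l hl)⟩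

theorem partialD_comp_smul {φ : 𝔼 → ℝ} (hφ : Differentiable ℝ φ) (l : ℝ) (i : Fin d) :
    partialD i (fun x => φ (l • x)) = fun x => l * partialD i φ (l • x) := by
  funext x
  have h1 : HasFDerivAt (fun x : 𝔼 => l • x) (l • ContinuousLinearMap.id ℝ 𝔼) x :=
    (hasFDerivAt_id x).const_smul l
  have h2 := (hφ (l • x)).hasFDerivAt.comp x h1
  rw [partialD, partialD, HasFDerivAt.fderiv (f := fun x => φ (l • x)) h2]
  simp

theorem Leibenson.IsTestFunction.partialD {φ : 𝔼 → ℝ} (hφ : IsTestFunction φ) (i : Fin d) :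
    IsTestFunction (partialD i φ) :=
  ⟨(hφ.1.fderiv_right (m := ∞) (by simp)).clm_apply contDiff_const,
    hφ.2.fderiv_apply (𝕜 := ℝ) _⟩

theorem Leibenson.IsTestFunction.differentiable {φ : 𝔼 → ℝ} (hφ : IsTestFunction φ) :
    Differentiable ℝ φ := hφ.1.differentiable (by simp)

theorem Leibenson.IsWeakGradient.comp_smul {u : 𝔼 → ℝ} {G : 𝔼 → 𝔼} (h : IsWeakGradient u G)
    (hu : Integrable u) (hG : Integrable G) (A : ℝ) {l : ℝ} (hl : 0 < l) :
    IsWeakGradient (fun x => A * u (l • x)) (fun x => (A * l) • G (l • x)) := by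
  refine ⟨((hu.comp_smul hl.ne').const_mul A).locallyIntegrable,
    ((hG.comp_smul hl.ne').smul (A * l)).locallyIntegrable, fun φ hφ i => ?_⟩
  have hφ' := hφ.comp_smul (inv_ne_zero hl.ne')
  have e1 : ∫ x, A * u (l • x) * partialD i φ x =
      A * ((l ^ d)⁻¹ * (l * ∫ x, u x * partialD i (fun y => φ (l⁻¹ • y)) x)) := by
    have := Measure.integral_comp_smul_of_nonneg (volume : Measure 𝔼)
      (fun y => u y * partialD i φ (l⁻¹ • y)) l (hR := hl.le)
    simp only [inv_smul_smul₀ hl.ne', finrank_euclideanSpace_fin, smul_eq_mul] at this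
    simp only [mul_assoc, integral_const_mul, this, partialD_comp_smul hφ.differentiable,
      mul_left_comm (u _)]
    field_simp
  have e2 : ∫ x, ((A * l) • G (l • x)) i * φ x =
      A * ((l ^ d)⁻¹ * (l * ∫ x, G x i * φ (l⁻¹ • x))) := by
    have := Measure.integral_comp_smul_of_nonneg (volume : Measure 𝔼)
      (fun y => G y i * φ (l⁻¹ • y)) l (hR := hl.le)
    simp only [inv_smul_smul₀ hl.ne', finrank_euclideanSpace_fin, smul_eq_mul] at this
    simp only [PiLp.smul_apply, smul_eq_mul, mul_assoc, integral_const_mul, this]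
    ring
  rw [e1, e2, h.2.2 _ hφ' i]
  ring

/-- Scaling of the Hessian: two derivatives give `l ^ 2`, the change of variables gives
`(l ^ d)⁻¹`. -/
theorem Leibenson.IsDistribHessian.comp_smul {u : 𝔼 → ℝ}
    {D : VectorMeasure 𝔼 (EuclideanSpace ℝ (Fin d × Fin d))} (h : IsDistribHessian u D)
    (hu : Integrable u) (A : ℝ) {l : ℝ} (hl : 0 < l) :
    IsDistribHessian (fun x => A * u (l • x))
      ((A * ((l ^ d)⁻¹ * l ^ 2)) • D.map fun y => l⁻¹ • y) := by
  refine ⟨((hu.comp_smul hl.ne').const_mul A).locallyIntegrable, fun φ hφ i j => ?_⟩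
  have hφ' := hφ.comp_smul (inv_ne_zero hl.ne')
  have hm : Measurable fun y : 𝔼 => l⁻¹ • y := by fun_prop
  have hemb : MeasurableEmbedding fun y : 𝔼 => l⁻¹ • y :=
    (Homeomorph.smulOfNeZero (α := 𝔼) l⁻¹ (inv_ne_zero hl.ne')).measurableEmbedding
  have hent : entry ((A * ((l ^ d)⁻¹ * l ^ 2)) • D.map fun y => l⁻¹ • y) i j =
      (A * ((l ^ d)⁻¹ * l ^ 2)) • (entry D i j).map fun y => l⁻¹ • y := by
    ext s hs
    rw [entry_apply, smul_apply, smul_apply,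
      VectorMeasure.map_apply _ hm hs, VectorMeasure.map_apply _ hm hs, entry_apply]
    rfl
  have e1 : ∫ x, A * u (l • x) * Leibenson.partialD i (Leibenson.partialD j φ) x =
      A * ((l ^ d)⁻¹ * (l ^ 2 * ∫ x, u x *
        Leibenson.partialD i (Leibenson.partialD j fun y => φ (l⁻¹ • y)) x)) := by
    have := Measure.integral_comp_smul_of_nonneg (volume : Measure 𝔼)
      (fun y => u y * Leibenson.partialD i (Leibenson.partialD j φ) (l⁻¹ • y)) l (hR := hl.le)
    simp only [inv_smul_smul₀ hl.ne', finrank_euclideanSpace_fin, smul_eq_mul] at this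
    have e3 : Leibenson.partialD i (Leibenson.partialD j fun y => φ (l⁻¹ • y)) =
        fun y => l⁻¹ * (l⁻¹ * Leibenson.partialD i (Leibenson.partialD j φ) (l⁻¹ • y)) := by
      rw [partialD_comp_smul hφ.differentiable]
      have hd : Differentiable ℝ fun y => Leibenson.partialD j φ (l⁻¹ • y) :=
        ((hφ.partialD j).comp_smul (inv_ne_zero hl.ne')).differentiable
      funext y
      rw [Leibenson.partialD, fderiv_const_mul (hd y)]
      change l⁻¹ * Leibenson.partialD i (fun y => Leibenson.partialD j φ (l⁻¹ • y)) y = _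
      rw [partialD_comp_smul (hφ.partialD j).differentiable]
    simp only [mul_assoc, integral_const_mul, this, e3, mul_left_comm (u _)]
    field_simp
  rw [e1, h.2 _ hφ' i j, hent, VectorMeasure.integral_smul_vectorMeasure,
    hemb.integral_map_vectorMeasure, smul_eq_mul]
  ring

theorem integral_withDensityᵥ {μ : Measure 𝔼} {f : 𝔼 → ℝ} (hf : Integrable f μ)
    {φ : 𝔼 → ℝ} (hφ : IsTestFunction φ) :
    ∫ᵛ x, φ x ∂<•(μ.withDensityᵥ f) = ∫ x, φ x * f x ∂μ := by
  have h1 := isFiniteMeasure_withDensity_ofReal hf.2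
  have h2 := isFiniteMeasure_withDensity_ofReal hf.neg.2
  obtain ⟨c, hc⟩ := hφ.2.exists_bound_of_continuous hφ.1.continuous
  have e : ∀ g : 𝔼 → ℝ, Integrable g μ →
      ∫ x, φ x ∂(μ.withDensity fun x => ENNReal.ofReal (g x)) = ∫ x, φ x * max (g x) 0 ∂μ :=
    fun g hg => by
      rw [integral_withDensity_eq_integral_toReal_smul₀ hg.1.aemeasurable.ennreal_ofReal
        (.of_forall fun _ => ENNReal.ofReal_lt_top)]
      simp only [ENNReal.toReal_ofReal', smul_eq_mul, mul_comm]
  have hi : ∀ g : 𝔼 → ℝ, Integrable g μ → Integrable (fun x => φ x * max (g x) 0) μ :=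
    fun g hg => hg.pos_part.bdd_mul hφ.1.continuous.aestronglyMeasurable (c := c)
      (.of_forall hc)
  rw [withDensityᵥ_eq_withDensity_pos_part_sub_withDensity_neg_part hf,
    signedMeasure_integral_sub hφ, e _ hf, e (fun x => -f x) hf.neg,
    ← integral_sub (hi _ hf) (hi (fun x => -f x) hf.neg)]
  refine integral_congr_ae (.of_forall fun x => ?_)
  simp only [← mul_sub]
  rcases le_total 0 (f x) with h | h
  · simp [h]
  · simp [h]

theorem entry_withDensityᵥ {μ : Measure 𝔼} {F : 𝔼 → EuclideanSpace ℝ (Fin d × Fin d)}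
    (hF : Integrable F μ) (i j : Fin d) :
    entry (μ.withDensityᵥ F) i j = μ.withDensityᵥ fun x => F x (i, j) := by
  have hij : Integrable (fun x => F x (i, j)) μ :=
    (EuclideanSpace.proj (𝕜 := ℝ) (i, j)).integrable_comp hF
  ext s hs
  rw [entry_apply, withDensityᵥ_apply hF hs, withDensityᵥ_apply hij hs]
  exact ((EuclideanSpace.proj (𝕜 := ℝ) (i, j)).integral_comp_comm hF.integrableOn).symm

theorem entry_add (D D' : VectorMeasure 𝔼 (EuclideanSpace ℝ (Fin d × Fin d))) (i j : Fin d) :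
    entry (D + D') i j = entry D i j + entry D' i j := rfl

end WeakDerivatives

/-! ### Integration by parts against radial functions -/

section RadialIntegrationByParts

open Module Filter Topology Leibenson

variable {d : ℕ}

local notation "𝔼" => EuclideanSpace ℝ (Fin d)
local notation "σ" => Measure.toSphere (volume : Measure (EuclideanSpace ℝ (Fin d)))

/-- The flux of the vector field `ψ e_i` through the sphere of radius `r` centred at the origin. -/
noncomputable def sphericalFlux (ψ : 𝔼 → ℝ) (i : Fin d) (r : ℝ) : ℝ :=
  r ^ (d - 1) * ∫ θ, (θ : 𝔼) i * ψ (r • (θ : 𝔼)) ∂σ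

theorem continuous_integral_sphere {F : ℝ → Metric.sphere (0 : 𝔼) 1 → ℝ}
    (hF : Continuous (Function.uncurry F)) : Continuous fun r => ∫ θ, F r θ ∂σ := by
  simpa using continuous_parametric_integral_of_continuous (μ := σ) hF isCompact_univ

theorem abs_coord_le_norm (x : 𝔼) (i : Fin d) : |x i| ≤ ‖x‖ := by
  simpa using PiLp.norm_apply_le x i

theorem norm_smul_sphere {r : ℝ} (hr : 0 ≤ r) (θ : Metric.sphere (0 : 𝔼) 1) :
    ‖r • (θ : 𝔼)‖ = r := by
  simp [norm_smul, abs_of_nonneg hr]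

theorem hasDerivAt_integral_sphere {ψ : 𝔼 → ℝ} (hψ : IsTestFunction ψ) (i : Fin d) (r : ℝ) :
    HasDerivAt (fun r => ∫ θ, (θ : 𝔼) i * ψ (r • (θ : 𝔼)) ∂σ)
      (∫ θ, (θ : 𝔼) i * fderiv ℝ ψ (r • (θ : 𝔼)) θ ∂σ) r := by
  have hd : Continuous (fderiv ℝ ψ) := hψ.1.continuous_fderiv (by simp)
  obtain ⟨c, hc⟩ := (hψ.2.fderiv (𝕜 := ℝ)).exists_bound_of_continuous hd
  have hc' : Continuous ψ := hψ.1.continuous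
  have hcont : ∀ r : ℝ, Continuous fun θ : Metric.sphere (0 : 𝔼) 1 =>
      (θ : 𝔼) i * ψ (r • (θ : 𝔼)) := fun r => by fun_prop
  have hcont' : Continuous fun θ : Metric.sphere (0 : 𝔼) 1 =>
      (θ : 𝔼) i * fderiv ℝ ψ (r • (θ : 𝔼)) θ := by fun_prop
  refine (hasDerivAt_integral_of_dominated_loc_of_deriv_le (bound := fun _ => c)
    (F' := fun r (θ : Metric.sphere (0 : 𝔼) 1) => (θ : 𝔼) i * fderiv ℝ ψ (r • (θ : 𝔼)) θ)
    Filter.univ_mem (.of_forall fun r => (hcont r).aestronglyMeasurable)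
    ((hcont r).integrable_of_hasCompactSupport (HasCompactSupport.of_compactSpace _))
    hcont'.aestronglyMeasurable (.of_forall fun θ r _ => ?_) (integrable_const _)
    (.of_forall fun θ r _ => ?_)).2
  · have h1 : |(θ : 𝔼) i| ≤ 1 := by simpa using abs_coord_le_norm (θ : 𝔼) i
    have h2 : ‖fderiv ℝ ψ (r • (θ : 𝔼)) θ‖ ≤ c := by
      simpa using (fderiv ℝ ψ (r • (θ : 𝔼))).le_of_opNorm_le (hc _) (θ : 𝔼)
    rw [norm_mul, Real.norm_eq_abs]
    calc _ ≤ 1 * c := mul_le_mul h1 h2 (norm_nonneg _) zero_le_one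
      _ = c := one_mul c
  · have h1 : HasDerivAt (fun r : ℝ => r • (θ : 𝔼)) (θ : 𝔼) r := by
      simpa using (hasDerivAt_id r).smul_const (θ : 𝔼)
    exact ((hψ.differentiable _).hasFDerivAt.comp_hasDerivAt r h1).const_mul _

theorem hasFDerivAt_norm_of_ne_zero {x : 𝔼} (hx : x ≠ 0) :
    HasFDerivAt (fun x : 𝔼 => ‖x‖) (‖x‖⁻¹ • innerSL ℝ x) x := by
  have hx' : ‖x‖ ≠ 0 := norm_ne_zero_iff.2 hx
  have h2 := (hasStrictFDerivAt_norm_sq x).hasFDerivAt.sqrt (by positivity : ‖x‖ ^ 2 ≠ 0)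
  have h3 : (fun y : 𝔼 => √(‖y‖ ^ 2)) = fun y => ‖y‖ := by
    funext y; exact Real.sqrt_sq (norm_nonneg y)
  rw [h3, Real.sqrt_sq (norm_nonneg x)] at h2
  refine h2.congr_fderiv ?_
  ext y
  simp only [smul_apply, smul_eq_mul, nsmul_eq_mul]
  field_simp
  simp

/-- Integration by parts on the whole space against a function of `‖x‖` that is smooth because it
vanishes near the origin. -/
theorem integral_comp_norm_mul_partialD {g : ℝ → ℝ} (hg : ContDiff ℝ ∞ g)
    (hg0 : tsupport g ⊆ Ioi 0) {ψ : 𝔼 → ℝ} (hψ : IsTestFunction ψ)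
    (i : Fin d) : Integrable (fun x => g ‖x‖ * partialD i ψ x) ∧
      Integrable (fun x => deriv g ‖x‖ * (x i / ‖x‖) * ψ x) ∧
      ∫ x, g ‖x‖ * partialD i ψ x = -∫ x, deriv g ‖x‖ * (x i / ‖x‖) * ψ x := by
  have h0 : g =ᶠ[𝓝 0] 0 := notMem_tsupport_iff_eventuallyEq.1 fun h => lt_irrefl (0 : ℝ) (hg0 h)
  have h0' : (fun x : 𝔼 => g ‖x‖) =ᶠ[𝓝 0] 0 := by
    have : Tendsto (fun x : 𝔼 => ‖x‖) (𝓝 0) (𝓝 0) := by simpa using continuous_norm.tendsto (0 : 𝔼)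
    exact this.eventually h0
  have hG : ContDiff ℝ ∞ fun x : 𝔼 => g ‖x‖ := by
    rw [contDiff_iff_contDiffAt]
    intro x
    by_cases hx : x = 0
    · subst hx
      exact contDiffAt_const.congr_of_eventuallyEq h0'
    · exact hg.contDiffAt.comp x (contDiffAt_norm ℝ hx)
  have hfd : ∀ x : 𝔼, fderiv ℝ (fun x : 𝔼 => g ‖x‖) x (EuclideanSpace.single i 1) =
      deriv g ‖x‖ * (x i / ‖x‖) := fun x => by
    by_cases hx : x = 0
    · subst hx
      rw [h0'.fderiv_eq]
      simp
    · have hgd : HasDerivAt g (deriv g ‖x‖) ‖x‖ := (hg.differentiable (by simp) _).hasDerivAt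
      rw [HasFDerivAt.fderiv (f := fun x : 𝔼 => g ‖x‖)
        (hgd.comp_hasFDerivAt x (hasFDerivAt_norm_of_ne_zero hx))]
      simp [EuclideanSpace.inner_single_right, div_eq_inv_mul]
  have hψd := hψ.partialD i
  have i1 : Integrable fun x : 𝔼 => g ‖x‖ * partialD i ψ x :=
    (hG.continuous.mul hψd.1.continuous).integrable_of_hasCompactSupport hψd.2.mul_left
  have hGd : Continuous fun x : 𝔼 => deriv g ‖x‖ * (x i / ‖x‖) := by
    simp_rw [← hfd]
    exact (hG.continuous_fderiv (by simp)).clm_apply continuous_const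
  have i2 : Integrable fun x : 𝔼 => deriv g ‖x‖ * (x i / ‖x‖) * ψ x :=
    (hGd.mul hψ.1.continuous).integrable_of_hasCompactSupport hψ.2.mul_left
  refine ⟨i1, i2, ?_⟩
  simp_rw [← hfd]
  exact integral_mul_fderiv_eq_neg_fderiv_mul_of_integrable (by simpa only [hfd] using i2) i1
    ((hG.continuous.mul hψ.1.continuous).integrable_of_hasCompactSupport hψ.2.mul_left)
    (fun x _ => hG.differentiable (by simp) x) (fun x _ => hψ.differentiable x)

variable [Nontrivial (EuclideanSpace ℝ (Fin d))]

/-- The divergence theorem for balls, in differential form: the derivative of the flux through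
spheres is the integral of `∂_i ψ` over spheres. Both sides have the same integrals against test
functions on `(0, ∞)`, by integration by parts on the whole space and on the line. -/
theorem exists_hasDerivAt_sphericalFlux {ψ : 𝔼 → ℝ} (hψ : IsTestFunction ψ) (i : Fin d) :
    ∃ Q : ℝ → ℝ, Continuous Q ∧ (∀ r, HasDerivAt (sphericalFlux ψ i) (Q r) r) ∧
      ∀ᵐ r : ℝ, r ∈ Ioi 0 →
        Q r = r ^ (d - 1) * ∫ θ, partialD i ψ (r • (θ : 𝔼)) ∂σ := by
  have hd : Continuous (fderiv ℝ ψ) := hψ.1.continuous_fderiv (by simp)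
  have hc : Continuous ψ := hψ.1.continuous
  have hpd : Continuous (partialD i ψ) := (hψ.partialD i).1.continuous
  have c1 : Continuous fun r : ℝ => ∫ θ, (θ : 𝔼) i * ψ (r • (θ : 𝔼)) ∂σ :=
    continuous_integral_sphere (by unfold Function.uncurry; fun_prop)
  have c2 : Continuous fun r : ℝ => ∫ θ, (θ : 𝔼) i * fderiv ℝ ψ (r • (θ : 𝔼)) θ ∂σ :=
    continuous_integral_sphere (by unfold Function.uncurry; fun_prop)
  have c3 : Continuous fun r : ℝ => ∫ θ, partialD i ψ (r • (θ : 𝔼)) ∂σ :=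
    continuous_integral_sphere (by unfold Function.uncurry; fun_prop)
  set Q : ℝ → ℝ := fun r => ((d - 1 : ℕ) * r ^ (d - 1 - 1)) *
      (∫ θ, (θ : 𝔼) i * ψ (r • (θ : 𝔼)) ∂σ) +
      r ^ (d - 1) * ∫ θ, (θ : 𝔼) i * fderiv ℝ ψ (r • (θ : 𝔼)) θ ∂σ
  have hQc : Continuous Q := by fun_prop
  have hQ : ∀ r, HasDerivAt (sphericalFlux ψ i) (Q r) r := fun r =>
    (hasDerivAt_pow (d - 1) r).mul (hasDerivAt_integral_sphere hψ i r)
  have hfc : Continuous (sphericalFlux ψ i) := by unfold sphericalFlux; fun_prop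
  refine ⟨Q, hQc, hQ, ?_⟩
  set P : ℝ → ℝ := fun r => r ^ (d - 1) * ∫ θ, partialD i ψ (r • (θ : 𝔼)) ∂σ
  have hPc : Continuous P := by fun_prop
  have key : ∀ᵐ r : ℝ, r ∈ Ioi (0 : ℝ) → Q r - P r = 0 := by
    refine isOpen_Ioi.ae_eq_zero_of_integral_contDiff_smul_eq_zero
      ((hQc.sub hPc).locallyIntegrable.locallyIntegrableOn _) fun g hg hgc hg0 => ?_
    -- Integrate `g(‖x‖) ∂_i ψ` over the whole space, before and after integration by parts.
    obtain ⟨i1, i2, e⟩ := integral_comp_norm_mul_partialD hg hg0 hψ i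
    have hgd : Continuous (deriv g) := hg.continuous_deriv (by simp)
    have hz : ∀ r ∉ Ioi (0 : ℝ), g r = 0 := fun r hr => image_eq_zero_of_notMem_tsupport
      fun h => hr (hg0 h)
    have hz' : ∀ r ∉ Ioi (0 : ℝ), deriv g r = 0 := fun r hr => by
      have : r ∉ tsupport (deriv g) := fun h => hr (hg0 (tsupport_deriv_subset h))
      exact image_eq_zero_of_notMem_tsupport this
    have e1 : ∫ x : 𝔼, g ‖x‖ * partialD i ψ x = ∫ r, g r * P r := by
      rw [integral_eq_integral_polar _ i1, ← setIntegral_eq_integral_of_forall_compl_eq_zero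
        (s := Ioi 0) (f := fun r => g r * P r) fun r hr => by rw [hz r hr, zero_mul]]
      refine setIntegral_congr_fun measurableSet_Ioi fun r hr => ?_
      simp only [norm_smul_sphere (le_of_lt hr), integral_const_mul, finrank_euclideanSpace_fin, P]
      ring
    have e2 : ∫ x : 𝔼, deriv g ‖x‖ * (x i / ‖x‖) * ψ x =
        ∫ r, deriv g r * sphericalFlux ψ i r := by
      rw [integral_eq_integral_polar _ i2, ← setIntegral_eq_integral_of_forall_compl_eq_zero
        (s := Ioi 0) (f := fun r => deriv g r * sphericalFlux ψ i r)
        fun r hr => by rw [hz' r hr, zero_mul]]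
      refine setIntegral_congr_fun measurableSet_Ioi fun r hr => ?_
      have hr0 : r ≠ 0 := (mem_Ioi.1 hr).ne'
      have : ∀ θ : Metric.sphere (0 : 𝔼) 1, (r • (θ : 𝔼)) i / r = (θ : 𝔼) i := fun θ => by
        simp [hr0]
      simp only [norm_smul_sphere (le_of_lt hr), mul_assoc, integral_const_mul,
        finrank_euclideanSpace_fin, sphericalFlux, this]
      ring
    have e3 : ∫ r, g r * Q r = -∫ r, deriv g r * sphericalFlux ψ i r :=
      integral_mul_deriv_eq_deriv_mul_of_integrable
        (fun r _ => (hg.differentiable (by simp) r).hasDerivAt) (fun r _ => hQ r)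
        ((hg.continuous.mul hQc).integrable_of_hasCompactSupport hgc.mul_right)
        ((hgd.mul hfc).integrable_of_hasCompactSupport hgc.deriv.mul_right)
        ((hg.continuous.mul hfc).integrable_of_hasCompactSupport hgc.mul_right)
    simp only [smul_eq_mul, mul_sub]
    have hi : ∀ F : ℝ → ℝ, Continuous F → Integrable fun r => g r * F r := fun F hF =>
      (hg.continuous.mul hF).integrable_of_hasCompactSupport hgc.mul_right
    rw [integral_sub (hi Q hQc) (hi P hPc), e3, ← e1, e, e2]
    ring
  filter_upwards [key] with r hr h
  exact sub_eq_zero.1 (hr h)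

omit [Nontrivial (EuclideanSpace ℝ (Fin d))] in
theorem abs_sphericalFlux_le {ψ : 𝔼 → ℝ} {k : ℕ} {c : ℝ} (hψc : ∀ x, |ψ x| ≤ c * ‖x‖ ^ k)
    (i : Fin d) {r : ℝ} (hr : 0 ≤ r) :
    |sphericalFlux ψ i r| ≤ c * (σ).real univ * r ^ (d - 1 + k) := by
  rw [sphericalFlux, abs_mul, abs_of_nonneg (by positivity)]
  have : ‖∫ θ, (θ : 𝔼) i * ψ (r • (θ : 𝔼)) ∂σ‖ ≤ c * r ^ k * (σ).real univ := by
    refine norm_integral_le_of_norm_le_const (.of_forall fun θ => ?_)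
    rw [norm_mul]
    have h1 : ‖(θ : 𝔼) i‖ ≤ 1 := by simpa using abs_coord_le_norm (θ : 𝔼) i
    have h2 := hψc (r • (θ : 𝔼))
    rw [norm_smul_sphere hr] at h2
    calc _ ≤ 1 * (c * r ^ k) := mul_le_mul h1 h2 (abs_nonneg _) zero_le_one
      _ = _ := one_mul _
  calc _ ≤ r ^ (d - 1) * (c * r ^ k * (σ).real univ) := by gcongr; exact this
    _ = _ := by rw [pow_add]; ring

theorem setIntegral_ball_eq_polar {f : 𝔼 → ℝ} {R : ℝ} (hf : IntegrableOn f (Metric.ball 0 R)) :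
    ∫ x in Metric.ball 0 R, f x =
      ∫ r in Ioo 0 R, r ^ (d - 1) * ∫ θ, f (r • (θ : 𝔼)) ∂σ := by
  rw [← integral_indicator measurableSet_ball,
    integral_eq_integral_polar _ (hf.integrable_indicator measurableSet_ball),
    finrank_euclideanSpace_fin, ← Ioi_inter_Iio, ← setIntegral_indicator measurableSet_Iio]
  refine setIntegral_congr_fun measurableSet_Ioi fun r hr => ?_
  by_cases hrR : r < R
  · have : ∀ θ : Metric.sphere (0 : 𝔼) 1, (Metric.ball 0 R).indicator f (r • (θ : 𝔼)) =
        f (r • (θ : 𝔼)) := fun θ => indicator_of_mem (by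
          rw [mem_ball_zero_iff, norm_smul_sphere (le_of_lt hr)]; exact hrR) _
    simp only [this, indicator_of_mem (mem_Iio.2 hrR)]
  · have : ∀ θ : Metric.sphere (0 : 𝔼) 1, (Metric.ball 0 R).indicator f (r • (θ : 𝔼)) = 0 :=
        fun θ => indicator_of_notMem (by
          rw [mem_ball_zero_iff, norm_smul_sphere (le_of_lt hr)]; exact hrR) _
    rw [indicator_of_notMem (by exact hrR)]
    simp only [this, integral_zero, mul_zero]

/-- Integration by parts on a ball for a radial function `g ‖x‖` that may be singular at the
origin. The vanishing of `ψ` to order `k` at the origin compensates for the singularity of `g`. -/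
theorem setIntegral_ball_radial_mul_partialD {g g' : ℝ → ℝ} {R gR c : ℝ} {k : ℕ} (hR : 0 < R)
    (hg : ∀ r ∈ Ioo 0 R, HasDerivAt g (g' r) r) (hgR : Tendsto g (𝓝[<] R) (𝓝 gR))
    (hg0 : Tendsto (fun r => r ^ (d - 1 + k) * g r) (𝓝[>] 0) (𝓝 0))
    (hgi : IntegrableOn (fun x : 𝔼 => g ‖x‖) (Metric.ball 0 R))
    (hg'i : IntegrableOn (fun x : 𝔼 => ‖x‖ ^ k * g' ‖x‖) (Metric.ball 0 R))
    {ψ : 𝔼 → ℝ} (hψ : IsTestFunction ψ) (hψc : ∀ x, |ψ x| ≤ c * ‖x‖ ^ k) (i : Fin d) :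
    ∫ x in Metric.ball 0 R, g ‖x‖ * partialD i ψ x =
      gR * sphericalFlux ψ i R - ∫ x in Metric.ball 0 R, g' ‖x‖ * (x i / ‖x‖) * ψ x := by
  obtain ⟨Q, hQc, hQ, hQe⟩ := exists_hasDerivAt_sphericalFlux hψ i
  have hfc : Continuous (sphericalFlux ψ i) :=
    continuous_iff_continuousAt.2 fun r => (hQ r).continuousAt
  obtain ⟨c1, hc1⟩ := (hψ.partialD i).2.exists_bound_of_continuous (hψ.partialD i).1.continuous
  have i1 : IntegrableOn (fun x : 𝔼 => g ‖x‖ * partialD i ψ x) (Metric.ball 0 R) :=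
    Integrable.mul_bdd (c := c1) hgi (hψ.partialD i).1.continuous.aestronglyMeasurable
      (.of_forall hc1)
  have hne : ∀ᵐ x : 𝔼 ∂(volume.restrict (Metric.ball 0 R)), x ≠ 0 :=
    ae_restrict_of_ae (Measure.ae_ne _ 0)
  have i2 : IntegrableOn (fun x : 𝔼 => g' ‖x‖ * (x i / ‖x‖) * ψ x) (Metric.ball 0 R) := by
    have : IntegrableOn (fun x : 𝔼 => (‖x‖ ^ k * g' ‖x‖) * (x i / ‖x‖ * (ψ x / ‖x‖ ^ k)))
        (Metric.ball 0 R) := by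
      refine Integrable.mul_bdd (c := c) hg'i ?_ ?_
      · have := hψ.1.continuous
        exact (by fun_prop : Measurable fun x : 𝔼 =>
          x i / ‖x‖ * (ψ x / ‖x‖ ^ k)).aestronglyMeasurable
      · filter_upwards [hne] with x hx
        have hx' : 0 < ‖x‖ := norm_pos_iff.2 hx
        rw [norm_mul, norm_div, norm_div, norm_norm, Real.norm_eq_abs, Real.norm_eq_abs,
          Real.norm_of_nonneg (by positivity : 0 ≤ ‖x‖ ^ k)]
        have h1 : |x i| / ‖x‖ ≤ 1 := (div_le_one hx').2 (abs_coord_le_norm x i)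
        have h2 : |ψ x| / ‖x‖ ^ k ≤ c := (div_le_iff₀ (by positivity)).2 (hψc x)
        calc _ ≤ 1 * c := mul_le_mul h1 h2 (by positivity) zero_le_one
          _ = c := one_mul c
    refine this.congr ?_
    filter_upwards [hne] with x hx
    have hx' : ‖x‖ ≠ 0 := norm_ne_zero_iff.2 hx
    field_simp
  have r1 : IntegrableOn (fun r => r ^ (d - 1) * g r) (Ioo 0 R) := by
    simpa using (integrableOn_fun_norm_addHaar (volume : Measure 𝔼) (f := g)).1 hgi
  have r2 : IntegrableOn (fun r => r ^ (d - 1) * (r ^ k * g' r)) (Ioo 0 R) := by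
    simpa using (integrableOn_fun_norm_addHaar (volume : Measure 𝔼)
      (f := fun r => r ^ k * g' r)).1 hg'i
  have hpos : ∀ᵐ r : ℝ ∂(volume.restrict (Ioo 0 R)), r ∈ Ioo 0 R :=
    ae_restrict_mem measurableSet_Ioo
  have hQe' := ae_restrict_of_ae (s := Ioo 0 R) hQe
  have j1 : IntegrableOn (fun r => g' r * sphericalFlux ψ i r) (Ioo 0 R) := by
    have : IntegrableOn (fun r => (r ^ (d - 1) * (r ^ k * g' r)) *
        (sphericalFlux ψ i r / r ^ (d - 1 + k))) (Ioo 0 R) := by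
      refine Integrable.mul_bdd (c := c * (σ).real univ) r2 ?_ ?_
      · exact (by fun_prop : Measurable fun r =>
          sphericalFlux ψ i r / r ^ (d - 1 + k)).aestronglyMeasurable
      · filter_upwards [hpos] with r hr
        have hr0 := hr.1
        rw [norm_div, Real.norm_eq_abs, Real.norm_of_nonneg (by positivity),
          div_le_iff₀ (by positivity)]
        exact abs_sphericalFlux_le hψc i hr0.le
    refine this.congr ?_
    filter_upwards [hpos] with r hr
    have hr0 := hr.1.ne'
    rw [pow_add]
    field_simp
  have j2 : IntegrableOn (fun r => g r * Q r) (Ioo 0 R) := by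
    have : IntegrableOn (fun r => (r ^ (d - 1) * g r) *
        ∫ θ, partialD i ψ (r • (θ : 𝔼)) ∂σ) (Ioo 0 R) := by
      refine Integrable.mul_bdd (c := c1 * (σ).real univ) r1 ?_ (.of_forall fun r => ?_)
      · have := (hψ.partialD i).1.continuous
        exact (continuous_integral_sphere
          (by unfold Function.uncurry; fun_prop)).aestronglyMeasurable
      · exact norm_integral_le_of_norm_le_const (.of_forall fun θ => hc1 _)
    refine this.congr ?_
    filter_upwards [hpos, hQe'] with r hr hq
    rw [hq hr.1]
    ring
  -- The fundamental theorem of calculus for `g` times the flux, on `(0, R)`.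
  have hFTC := intervalIntegral.integral_eq_sub_of_hasDerivAt_of_tendsto (a := 0) (b := R) hR
    (f := fun r => g r * sphericalFlux ψ i r)
    (f' := fun r => g' r * sphericalFlux ψ i r + g r * Q r) (fa := 0)
    (fb := gR * sphericalFlux ψ i R) (fun r hr => (hg r hr).mul (hQ r))
    ((intervalIntegrable_iff_integrableOn_Ioo_of_le hR.le).2 (j1.add j2)) ?_
    (hgR.mul (hfc.continuousAt.tendsto.mono_left nhdsWithin_le_nhds))
  · rw [intervalIntegral.integral_of_le hR.le, integral_Ioc_eq_integral_Ioo,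
      integral_add j1 j2, sub_zero] at hFTC
    have e1 : ∫ x in Metric.ball 0 R, g ‖x‖ * partialD i ψ x = ∫ r in Ioo 0 R, g r * Q r := by
      rw [setIntegral_ball_eq_polar i1]
      refine integral_congr_ae ?_
      filter_upwards [hpos, hQe'] with r hr hq
      simp only [norm_smul_sphere hr.1.le, integral_const_mul]
      rw [hq hr.1]
      ring
    have e2 : ∫ x in Metric.ball 0 R, g' ‖x‖ * (x i / ‖x‖) * ψ x =
        ∫ r in Ioo 0 R, g' r * sphericalFlux ψ i r := by
      rw [setIntegral_ball_eq_polar i2]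
      refine setIntegral_congr_fun measurableSet_Ioo fun r hr => ?_
      have hr0 : r ≠ 0 := hr.1.ne'
      have : ∀ θ : Metric.sphere (0 : 𝔼) 1, (r • (θ : 𝔼)) i / r = (θ : 𝔼) i := fun θ => by
        simp [hr0]
      simp only [norm_smul_sphere hr.1.le, mul_assoc, integral_const_mul, sphericalFlux, this]
      ring
    rw [e1, e2]
    linarith
  · have hb : Tendsto (fun r => c * (σ).real univ * |r ^ (d - 1 + k) * g r|) (𝓝[>] 0) (𝓝 0) := by
      simpa using (hg0.abs.const_mul (c * (σ).real univ))
    refine squeeze_zero_norm' ?_ hb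
    filter_upwards [self_mem_nhdsWithin] with r hr
    have hr0 : 0 < r := hr
    rw [norm_mul, abs_mul, Real.norm_eq_abs, Real.norm_eq_abs,
      abs_of_nonneg (by positivity : 0 ≤ r ^ (d - 1 + k))]
    calc _ ≤ |g r| * (c * (σ).real univ * r ^ (d - 1 + k)) := by
          gcongr
          exact abs_sphericalFlux_le hψc i hr0.le
      _ = _ := by ring

end RadialIntegrationByParts

/-! ### Weak derivatives of radial functions on a ball -/

section Profile

open Module Filter Topology Leibenson

variable {d : ℕ}

local notation "𝔼" => EuclideanSpace ℝ (Fin d)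
local notation "σ" => Measure.toSphere (volume : Measure (EuclideanSpace ℝ (Fin d)))

theorem norm_le_card_mul_of_abs_le {ι : Type*} [Fintype ι] {v : EuclideanSpace ℝ ι} {M : ℝ}
    (hM : 0 ≤ M) (h : ∀ k, |v k| ≤ M) : ‖v‖ ≤ Fintype.card ι * M := by
  rw [EuclideanSpace.norm_eq, Real.sqrt_le_left (by positivity)]
  calc ∑ k, ‖v k‖ ^ 2 ≤ ∑ _k : ι, M ^ 2 := by
        refine Finset.sum_le_sum fun k _ => ?_
        gcongr
        exact h k
    _ = Fintype.card ι * M ^ 2 := by simp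
    _ ≤ (Fintype.card ι : ℝ) ^ 2 * M ^ 2 := by
        gcongr
        exact_mod_cast Nat.le_self_pow two_ne_zero _
    _ = _ := by ring

theorem tendsto_pow_mul_rpow_zero {n : ℕ} {s : ℝ} (h : 0 < n + s) :
    Tendsto (fun r : ℝ => r ^ n * r ^ s) (𝓝[>] 0) (𝓝 0) := by
  have h1 : Tendsto (fun r : ℝ => r ^ ((n : ℝ) + s)) (𝓝[>] 0) (𝓝 0) := by
    have := (Real.continuousAt_rpow_const 0 ((n : ℝ) + s) (Or.inr h.le)).tendsto
    rw [Real.zero_rpow h.ne'] at this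
    exact this.mono_left nhdsWithin_le_nhds
  refine h1.congr' ?_
  filter_upwards [self_mem_nhdsWithin] with r hr
  rw [Real.rpow_add hr, Real.rpow_natCast]

theorem integral_entry_withDensityᵥ_add {H N : 𝔼 → EuclideanSpace ℝ (Fin d × Fin d)}
    {μ ν : Measure 𝔼} (hH : Integrable H μ) (hN : Integrable N ν) {φ : 𝔼 → ℝ}
    (hφ : IsTestFunction φ) (i j : Fin d) :
    ∫ᵛ x, φ x ∂<•(entry (μ.withDensityᵥ H + ν.withDensityᵥ N) i j) =
      ∫ x, φ x * H x (i, j) ∂μ + ∫ x, φ x * N x (i, j) ∂ν := by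
  have hi : ∀ {κ : Measure 𝔼} {F : 𝔼 → EuclideanSpace ℝ (Fin d × Fin d)}, Integrable F κ →
      Integrable (fun x => F x (i, j)) κ := fun hF => hF.eval_piLp (i, j)
  obtain ⟨c, hc⟩ := hφ.2.exists_bound_of_continuous hφ.1.continuous
  have hv : ∀ {κ : Measure 𝔼} {f : 𝔼 → ℝ}, Integrable f κ → (κ.withDensityᵥ f).Integrable φ :=
    fun {κ f} hf => by
      rw [VectorMeasure.Integrable, Measure.variation_withDensityᵥ hf]
      have : IsFiniteMeasure (κ.withDensity fun x => ‖f x‖ₑ) := ⟨by simpa using! hf.2⟩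
      exact hφ.integrable _
  rw [entry_add, entry_withDensityᵥ hH, entry_withDensityᵥ hN,
    VectorMeasure.integral_add_vectorMeasure (hv (hi hH)) (hv (hi hN)),
    integral_withDensityᵥ (hi hH) hφ, integral_withDensityᵥ (hi hN) hφ]

/-- The matrix of second derivatives of a radial function `u ‖x‖` at `x ≠ 0`, written in terms of
the radial functions `h r = u' r / r` and `h'`. -/
noncomputable def radialHessian (h h' : ℝ → ℝ) (x : 𝔼) : EuclideanSpace ℝ (Fin d × Fin d) :=
  WithLp.toLp 2 fun k => h' ‖x‖ * (x k.2 / ‖x‖) * x k.1 + (if k.1 = k.2 then 1 else 0) * h ‖x‖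

/-- The multiple `s x ⊗ x` of a rank one matrix. -/
noncomputable def rankOneMatrix (s : ℝ) (x : 𝔼) : EuclideanSpace ℝ (Fin d × Fin d) :=
  WithLp.toLp 2 fun k => s * (x k.1 * x k.2)

theorem abs_coord_div_norm_le_one (x : 𝔼) (i : Fin d) : |x i / ‖x‖| ≤ 1 := by
  rw [abs_div, abs_norm]
  exact div_le_one_of_le₀ (abs_coord_le_norm x i) (norm_nonneg x)

theorem abs_radialHessian_le (h h' : ℝ → ℝ) (x : 𝔼) (k : Fin d × Fin d) :
    |radialHessian h h' x k| ≤ ‖x‖ * |h' ‖x‖| + |h ‖x‖| := by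
  change |h' ‖x‖ * (x k.2 / ‖x‖) * x k.1 + (if k.1 = k.2 then 1 else 0) * h ‖x‖| ≤ _
  refine (abs_add_le _ _).trans (add_le_add ?_ ?_)
  · rw [abs_mul, abs_mul]
    calc _ ≤ |h' ‖x‖| * 1 * ‖x‖ := by
          gcongr
          · exact abs_coord_div_norm_le_one x _
          · exact abs_coord_le_norm x _
      _ = _ := by ring
  · rw [abs_mul]
    split_ifs <;> simp

theorem integrableOn_radialHessian {h h' : ℝ → ℝ} {R : ℝ}
    (hh : IntegrableOn (fun x : 𝔼 => h ‖x‖) (Metric.ball 0 R))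
    (hh' : IntegrableOn (fun x : 𝔼 => ‖x‖ ^ 1 * h' ‖x‖) (Metric.ball 0 R)) :
    IntegrableOn (fun x : 𝔼 => radialHessian h h' x) (Metric.ball 0 R) := by
  refine Integrable.of_eval_piLp fun k => ?_
  change IntegrableOn (fun x : 𝔼 => h' ‖x‖ * (x k.2 / ‖x‖) * x k.1 +
    (if k.1 = k.2 then 1 else 0) * h ‖x‖) (Metric.ball 0 R)
  refine Integrable.add ?_ (hh.const_mul _)
  have : IntegrableOn (fun x : 𝔼 => (‖x‖ ^ 1 * h' ‖x‖) * (x k.2 / ‖x‖ * (x k.1 / ‖x‖)))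
      (Metric.ball 0 R) := by
    refine Integrable.mul_bdd (c := 1) hh' (by fun_prop : Measurable fun x : 𝔼 =>
      x k.2 / ‖x‖ * (x k.1 / ‖x‖)).aestronglyMeasurable (.of_forall fun x => ?_)
    rw [Real.norm_eq_abs, abs_mul]
    exact mul_le_one₀ (abs_coord_div_norm_le_one x _) (abs_nonneg _)
      (abs_coord_div_norm_le_one x _)
  refine this.congr (.of_forall fun x => ?_)
  by_cases hx : ‖x‖ = 0
  · simp [norm_eq_zero.1 hx]
  · simp only [pow_one]
    field_simp

theorem integrable_rankOneMatrix (s R : ℝ) :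
    Integrable (rankOneMatrix (d := d) s) (dilatedSphereMeasure volume R) := by
  have hc : Continuous (rankOneMatrix (d := d) s) := by
    unfold rankOneMatrix; fun_prop
  rw [dilatedSphereMeasure, integrable_map_measure hc.aestronglyMeasurable (by fun_prop)]
  exact (hc.comp (by fun_prop)).integrable_of_hasCompactSupport
    (HasCompactSupport.of_compactSpace _)

/-- The boundary term of the integration by parts as an integral against a measure on the sphere: the
factor `R ^ (d - 1)` compensates for the normalization of `dilatedSphereMeasure`, and `x j / R` is a
component of the normal. -/
theorem sphericalFlux_coord_mul {φ : 𝔼 → ℝ} {R : ℝ} (hR : 0 < R) (i j : Fin d) (s : ℝ)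
    (hφ : Continuous φ) :
    ∫ x, φ x * rankOneMatrix (s * R ^ (d - 1) / R) x (i, j) ∂(dilatedSphereMeasure volume R) =
      s * sphericalFlux (fun x => x i * φ x) j R := by
  have hc : Continuous fun x : 𝔼 => φ x * rankOneMatrix (s * R ^ (d - 1) / R) x (i, j) := by
    change Continuous fun x : 𝔼 => φ x * (s * R ^ (d - 1) / R * (x i * x j))
    fun_prop
  rw [dilatedSphereMeasure, integral_map (by fun_prop) hc.aestronglyMeasurable, sphericalFlux,
    ← mul_assoc, ← integral_const_mul]
  refine integral_congr_ae (.of_forall fun θ => ?_)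
  change φ (R • (θ : 𝔼)) * (s * R ^ (d - 1) / R * ((R • (θ : 𝔼)) i * (R • (θ : 𝔼)) j)) =
    s * R ^ (d - 1) * ((θ : 𝔼) j * ((R • (θ : 𝔼)) i * φ (R • (θ : 𝔼))))
  simp only [PiLp.smul_apply, smul_eq_mul]
  field_simp

theorem partialD_coord_mul {φ : 𝔼 → ℝ} (hφ : Differentiable ℝ φ) (i j : Fin d) (x : 𝔼) :
    partialD j (fun y => y i * φ y) x = (if i = j then 1 else 0) * φ x + x i * partialD j φ x := by
  have h1 : HasFDerivAt (fun y : 𝔼 => y i) (EuclideanSpace.proj (𝕜 := ℝ) i) x :=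
    (EuclideanSpace.proj (𝕜 := ℝ) i : 𝔼 →L[ℝ] ℝ).hasFDerivAt
  rw [partialD, HasFDerivAt.fderiv (f := fun y : 𝔼 => y i * φ y) (h1.mul (hφ x).hasFDerivAt)]
  simp [partialD]
  ring

theorem Leibenson.IsTestFunction.coord_mul {φ : 𝔼 → ℝ} (hφ : IsTestFunction φ) (i : Fin d) :
    IsTestFunction fun x => x i * φ x :=
  ⟨(EuclideanSpace.proj (𝕜 := ℝ) i : 𝔼 →L[ℝ] ℝ).contDiff.mul hφ.1, hφ.2.mul_left⟩

variable [Nontrivial (EuclideanSpace ℝ (Fin d))]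

theorem integrableOn_ball_norm_rpow {R s : ℝ} (hR : 0 < R) (hs : -(d : ℝ) < s) :
    IntegrableOn (fun x : 𝔼 => ‖x‖ ^ s) (Metric.ball 0 R) := by
  refine ⟨(by fun_prop : Measurable fun x : 𝔼 => ‖x‖ ^ s).aestronglyMeasurable, ?_⟩
  have := setLIntegral_ball_zero_norm_rpow (volume : Measure 𝔼) (α := -s) (r := R)
    (by simpa using neg_lt.1 hs) hR.le
  rw [neg_neg] at this
  rw [hasFiniteIntegral_iff_ofReal (.of_forall fun x => by positivity), this]
  exact ENNReal.mul_lt_top (measure_lt_top _ _) ENNReal.ofReal_lt_top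

theorem integrableOn_ball_sub_norm_rpow {R e : ℝ} (hR : 0 < R) (he : e < 1) :
    IntegrableOn (fun x : 𝔼 => |R - ‖x‖| ^ (-e)) (Metric.ball 0 R) := by
  refine ⟨(by fun_prop : Measurable fun x : 𝔼 => |R - ‖x‖| ^ (-e)).aestronglyMeasurable, ?_⟩
  have := setLIntegral_ball_sub_norm_rpow_mul_norm_rpow_lt_top (volume : Measure 𝔼)
    (e₂ := 0) hR he (by exact_mod_cast finrank_pos)
  rw [hasFiniteIntegral_iff_ofReal (.of_forall fun x => by positivity)]
  refine lt_of_le_of_lt (lintegral_mono_set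
    (Metric.ball_subset_ball (by linarith : R ≤ 2 * R))) ?_
  simpa using this

/-- The distributional Hessian of a radial function supported in a ball, vanishing on its boundary
but possibly with a jump of the radial derivative there: the pointwise Hessian in the ball and a multiple of
the surface measure with rank one density. -/
theorem isDistribHessian_of_radial {u h h' : ℝ → ℝ} {R : ℝ} (hR : 0 < R)
    (hu : ∀ r ∈ Ioo 0 R, HasDerivAt u (r * h r) r) (hh : ∀ r ∈ Ioo 0 R, HasDerivAt h (h' r) r)
    (huR : Tendsto u (𝓝[<] R) (𝓝 0)) (hhR : Tendsto h (𝓝[<] R) (𝓝 (h R)))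
    (hu0 : Tendsto (fun r => r ^ (d - 1 + 0) * u r) (𝓝[>] 0) (𝓝 0))
    (hh0 : Tendsto (fun r => r ^ (d - 1 + 1) * h r) (𝓝[>] 0) (𝓝 0))
    (hui : IntegrableOn (fun x : 𝔼 => u ‖x‖) (Metric.ball 0 R))
    (hhi : IntegrableOn (fun x : 𝔼 => h ‖x‖) (Metric.ball 0 R))
    (hh'i : IntegrableOn (fun x : 𝔼 => ‖x‖ ^ 1 * h' ‖x‖) (Metric.ball 0 R)) :
    IsDistribHessian ((Metric.ball (0 : 𝔼) R).indicator fun x => u ‖x‖)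
      ((volume.restrict (Metric.ball 0 R)).withDensityᵥ (radialHessian h h') +
        (dilatedSphereMeasure volume R).withDensityᵥ (rankOneMatrix (-h R * R ^ (d - 1) / R))) := by
  refine ⟨(hui.integrable_indicator measurableSet_ball).locallyIntegrable, fun φ hφ i j => ?_⟩
  have hN := integrable_rankOneMatrix (d := d) (-h R * R ^ (d - 1) / R) R
  rw [integral_entry_withDensityᵥ_add (integrableOn_radialHessian hhi hh'i) hN hφ,
    sphericalFlux_coord_mul hR i j _ hφ.1.continuous]
  obtain ⟨c0, hc0⟩ := (hφ.partialD j).2.exists_bound_of_continuous (hφ.partialD j).1.continuous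
  obtain ⟨c1, hc1⟩ := hφ.2.exists_bound_of_continuous hφ.1.continuous
  have hψ := hφ.coord_mul i
  have hrhi : IntegrableOn (fun x : 𝔼 => ‖x‖ ^ 0 * (‖x‖ * h ‖x‖)) (Metric.ball 0 R) := by
    have : IntegrableOn (fun x : 𝔼 => ‖x‖ * h ‖x‖) (Metric.ball 0 R) := by
      refine Integrable.bdd_mul (c := R) hhi continuous_norm.aestronglyMeasurable ?_
      filter_upwards [ae_restrict_mem measurableSet_ball] with x hx
      rw [norm_norm]
      exact (mem_ball_zero_iff.1 hx).le
    simpa using this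
  -- The first integration by parts has no boundary term since `u` vanishes at `R`; the second one
  -- applies to `h` and the function `x i * φ x`, which vanishes at the origin.
  have e1 := setIntegral_ball_radial_mul_partialD hR hu huR hu0 hui hrhi (hφ.partialD j)
    (c := c0) (k := 0) (fun x => by simpa using hc0 x) i
  have e2 := setIntegral_ball_radial_mul_partialD hR hh hhR hh0 hhi hh'i hψ (c := c1) (k := 1)
    (fun x => by
      rw [abs_mul, pow_one, mul_comm c1]
      exact mul_le_mul (abs_coord_le_norm x i) (hc1 x) (abs_nonneg _) (norm_nonneg _)) j
  have i1 : IntegrableOn (fun x : 𝔼 => h ‖x‖ * ((if i = j then 1 else 0) * φ x))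
      (Metric.ball 0 R) := by
    refine Integrable.mul_bdd (c := c1) hhi (hφ.1.continuous.const_mul _).aestronglyMeasurable
      (.of_forall fun x => ?_)
    rw [norm_mul]
    have : (0 : ℝ) ≤ c1 := (norm_nonneg _).trans (hc1 0)
    split_ifs
    · simpa using hc1 x
    · simpa using this
  have i2 : IntegrableOn (fun x : 𝔼 => h ‖x‖ * (x i * partialD j φ x)) (Metric.ball 0 R) := by
    have hψ2 := (hφ.partialD j).coord_mul i
    obtain ⟨c2, hc2⟩ := hψ2.2.exists_bound_of_continuous hψ2.1.continuous
    exact Integrable.mul_bdd (c := c2) hhi hψ2.1.continuous.aestronglyMeasurable (.of_forall hc2)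
  have i3 : IntegrableOn (fun x : 𝔼 => φ x * radialHessian h h' x (i, j)) (Metric.ball 0 R) :=
    Integrable.bdd_mul (c := c1) ((integrableOn_radialHessian hhi hh'i).eval_piLp (i, j))
      hφ.1.continuous.aestronglyMeasurable (.of_forall hc1)
  have e3 : ∫ x in Metric.ball 0 R, h ‖x‖ * partialD j (fun y => y i * φ y) x =
      (∫ x in Metric.ball 0 R, h ‖x‖ * ((if i = j then 1 else 0) * φ x)) +
        ∫ x in Metric.ball 0 R, h ‖x‖ * (x i * partialD j φ x) := by
    rw [← integral_add i1 i2]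
    simp only [partialD_coord_mul hφ.differentiable, mul_add]
  have e4 : ∫ x in Metric.ball 0 R, ‖x‖ * h ‖x‖ * (x i / ‖x‖) * partialD j φ x =
      ∫ x in Metric.ball 0 R, h ‖x‖ * (x i * partialD j φ x) := by
    refine integral_congr_ae (.of_forall fun x => ?_)
    by_cases hx : ‖x‖ = 0
    · simp [norm_eq_zero.1 hx]
    · field_simp
  have e5 : ∫ x in Metric.ball 0 R, h' ‖x‖ * (x j / ‖x‖) * (x i * φ x) =
      (∫ x in Metric.ball 0 R, φ x * radialHessian h h' x (i, j)) -
        ∫ x in Metric.ball 0 R, h ‖x‖ * ((if i = j then 1 else 0) * φ x) := by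
    rw [← integral_sub i3 i1]
    refine integral_congr_ae (.of_forall fun x => ?_)
    change _ = φ x * (h' ‖x‖ * (x j / ‖x‖) * x i + (if i = j then 1 else 0) * h ‖x‖) - _
    ring
  have e6 : ∫ x, (Metric.ball (0 : 𝔼) R).indicator (fun x => u ‖x‖) x *
      partialD i (partialD j φ) x =
      ∫ x in Metric.ball 0 R, u ‖x‖ * partialD i (partialD j φ) x := by
    rw [← integral_indicator measurableSet_ball]
    refine integral_congr_ae (.of_forall fun x => ?_)
    by_cases hx : x ∈ Metric.ball (0 : 𝔼) R <;> simp only [indicator, hx, if_true, if_false, zero_mul]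
  rw [e6, e1, e4]
  rw [e3, e5] at e2
  linarith

/-- The weak gradient of a radial function supported in a ball and vanishing on its boundary. -/
theorem isWeakGradient_of_radial {g g' : ℝ → ℝ} {R : ℝ} (hR : 0 < R)
    (hg : ∀ r ∈ Ioo 0 R, HasDerivAt g (g' r) r) (hgR : Tendsto g (𝓝[<] R) (𝓝 0))
    (hg0 : Tendsto (fun r => r ^ (d - 1 + 0) * g r) (𝓝[>] 0) (𝓝 0))
    (hgi : IntegrableOn (fun x : 𝔼 => g ‖x‖) (Metric.ball 0 R))
    (hg'i : IntegrableOn (fun x : 𝔼 => ‖x‖ ^ 0 * g' ‖x‖) (Metric.ball 0 R)) :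
    Integrable ((Metric.ball (0 : 𝔼) R).indicator fun x => (g' ‖x‖ / ‖x‖) • x) ∧
    IsWeakGradient ((Metric.ball (0 : 𝔼) R).indicator fun x => g ‖x‖)
      ((Metric.ball (0 : 𝔼) R).indicator fun x => (g' ‖x‖ / ‖x‖) • x) := by
  have hGi : IntegrableOn (fun x : 𝔼 => (g' ‖x‖ / ‖x‖) • x) (Metric.ball 0 R) := by
    refine Integrable.of_eval_piLp fun i => ?_
    have : IntegrableOn (fun x : 𝔼 => (‖x‖ ^ 0 * g' ‖x‖) * (x i / ‖x‖)) (Metric.ball 0 R) :=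
      Integrable.mul_bdd (c := 1) hg'i (by fun_prop : Measurable fun x : 𝔼 =>
        x i / ‖x‖).aestronglyMeasurable (.of_forall fun x => abs_coord_div_norm_le_one x i)
    refine this.congr (.of_forall fun x => ?_)
    simp only [pow_zero, one_mul, PiLp.smul_apply, smul_eq_mul]
    ring
  have hGi' := hGi.integrable_indicator measurableSet_ball
  refine ⟨hGi', (hgi.integrable_indicator measurableSet_ball).locallyIntegrable,
    hGi'.locallyIntegrable, fun φ hφ i => ?_⟩
  obtain ⟨c, hc⟩ := hφ.2.exists_bound_of_continuous hφ.1.continuous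
  have e1 := setIntegral_ball_radial_mul_partialD hR hg hgR hg0 hgi hg'i hφ
    (c := c) (k := 0) (fun x => by simpa using hc x) i
  have e2 : ∫ x, (Metric.ball (0 : 𝔼) R).indicator (fun x => g ‖x‖) x * partialD i φ x =
      ∫ x in Metric.ball 0 R, g ‖x‖ * partialD i φ x := by
    rw [← integral_indicator measurableSet_ball]
    refine integral_congr_ae (.of_forall fun x => ?_)
    by_cases hx : x ∈ Metric.ball (0 : 𝔼) R <;> simp only [indicator, hx, if_true, if_false, zero_mul]
  have e3 : ∫ x, (Metric.ball (0 : 𝔼) R).indicator (fun x => (g' ‖x‖ / ‖x‖) • x) x i * φ x =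
      ∫ x in Metric.ball 0 R, g' ‖x‖ * (x i / ‖x‖) * φ x := by
    rw [← integral_indicator measurableSet_ball]
    refine integral_congr_ae (.of_forall fun x => ?_)
    by_cases hx : x ∈ Metric.ball (0 : 𝔼) R
    · simp only [indicator, hx, if_true, PiLp.smul_apply, smul_eq_mul]
      ring
    · simp only [indicator, hx, if_false, PiLp.zero_apply, zero_mul]
  rw [e2, e3, e1]
  ring

end Profile

/-! ### The Hessian of the profile `‖x‖ ^ (2 - b) (C - κ ‖x‖ ^ b)₊` -/

section ProfileHessian

open Module Filter Topology Leibenson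

variable {d : ℕ}

local notation "𝔼" => EuclideanSpace ℝ (Fin d)

theorem rpow_le_mul_rpow_neg {r R s α : ℝ} (hr : 0 < r) (hrR : r ≤ R) (h : 0 ≤ s + α) :
    r ^ s ≤ R ^ (s + α) * r ^ (-α) := by
  calc r ^ s = r ^ (s + α) * r ^ (-α) := by rw [← Real.rpow_add hr]; ring_nf
    _ ≤ _ := by gcongr

theorem max_sub_eq_zero_of_le {b C κ R r : ℝ} (hb : 0 < b) (hκ : 0 < κ) (hR : 0 < R)
    (hCR : κ * R ^ b = C) (h : R ≤ r) : max (C - κ * r ^ b) 0 = 0 := by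
  refine max_eq_right ?_
  have : R ^ b ≤ r ^ b := Real.rpow_le_rpow hR.le h hb.le
  nlinarith

theorem sub_pos_of_lt_radius {b C κ R r : ℝ} (hb : 0 < b) (hκ : 0 < κ)
    (hCR : κ * R ^ b = C) (h0 : 0 ≤ r) (h : r < R) : 0 < C - κ * r ^ b := by
  have : r ^ b < R ^ b := Real.rpow_lt_rpow h0 h hb
  nlinarith

/-- Lower bound at the free boundary, from convexity of `r ^ b`. -/
theorem mul_sub_le_sub_mul_rpow {b C κ R r : ℝ} (hb : 1 ≤ b) (hκ : 0 < κ) (hR : 0 < R)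
    (hCR : κ * R ^ b = C) (h0 : 0 ≤ r) (h : r ≤ R) : C / R * (R - r) ≤ C - κ * r ^ b := by
  have h1 : (r / R) ^ b ≤ r / R := by
    have := Real.rpow_le_rpow_of_exponent_ge' (div_nonneg h0 hR.le) ((div_le_one hR).2 h)
      zero_le_one hb
    rwa [Real.rpow_one] at this
  have h2 : r ^ b = (r / R) ^ b * R ^ b := by
    rw [← Real.mul_rpow (by positivity) hR.le, div_mul_cancel₀ _ hR.ne']
  have hC : 0 ≤ C := by rw [← hCR]; positivity
  have h3 : κ * r ^ b = C * (r / R) ^ b := by rw [h2, ← hCR]; ring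
  rw [h3]
  calc C / R * (R - r) = C - C * (r / R) := by field_simp
    _ ≤ _ := by gcongr

/-- Upper bound at the free boundary, from Bernoulli's inequality. -/
theorem sub_mul_rpow_le_mul_sub {b C κ R r : ℝ} (hb : 1 ≤ b) (hκ : 0 < κ) (hR : 0 < R)
    (hCR : κ * R ^ b = C) (h0 : 0 ≤ r) : C - κ * r ^ b ≤ C * b / R * (R - r) := by
  have h1 : 1 + b * (r / R - 1) ≤ (r / R) ^ b := by
    have := one_add_mul_self_le_rpow_one_add (s := r / R - 1)
      (by linarith [div_nonneg h0 hR.le]) hb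
    simpa using this
  have h2 : r ^ b = (r / R) ^ b * R ^ b := by
    rw [← Real.mul_rpow (by positivity) hR.le, div_mul_cancel₀ _ hR.ne']
  have hC : 0 ≤ C := by rw [← hCR]; positivity
  have h3 : κ * r ^ b = C * (r / R) ^ b := by rw [h2, ← hCR]; ring
  rw [h3]
  calc C - C * (r / R) ^ b ≤ C - C * (1 + b * (r / R - 1)) := by gcongr
    _ = _ := by field_simp; ring

variable [Nontrivial (EuclideanSpace ℝ (Fin d))]

theorem ae_ne_zero_and_norm_ne (R : ℝ) (hR : R ≠ 0) : ∀ᵐ x : 𝔼, x ≠ 0 ∧ ‖x‖ ≠ R := by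
  have h := Measure.addHaar_sphere_of_ne_zero (volume : Measure 𝔼) 0 hR
  have h' : ∀ᵐ x : 𝔼, x ∉ Metric.sphere (0 : 𝔼) R := compl_mem_ae_iff.2 h
  filter_upwards [Measure.ae_ne (volume : Measure 𝔼) 0, h'] with x hx hx'
  exact ⟨hx, by simpa using hx'⟩

/-- The maximal function of a measure that consists of a density bounded by a multiple of
`‖x‖ ^ (-b)` and a bounded density on a sphere. -/
theorem exists_maximalMeasure_variation_le {F : Type*} [NormedAddCommGroup F] [NormedSpace ℝ F]
    [CompleteSpace F] {H N : 𝔼 → F} {R K₁ K₂ b : ℝ} (hR : 0 < R) (hK₁ : 0 ≤ K₁) (hb0 : 0 ≤ b)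
    (hbd : b < d) (hH : IntegrableOn H (Metric.ball 0 R))
    (hN : Integrable N (dilatedSphereMeasure volume R))
    (hHb : ∀ x ∈ Metric.ball (0 : 𝔼) R, x ≠ 0 → ‖H x‖ ≤ K₁ * ‖x‖ ^ (-b))
    (hNb : ∀ x : 𝔼, ‖x‖ = R → ‖N x‖ ≤ K₂) :
    ∃ K : ℝ, 0 < K ∧ ∀ x : 𝔼, x ≠ 0 → ‖x‖ ≠ R →
      maximalMeasure ((volume.restrict (Metric.ball 0 R)).withDensityᵥ H +
        (dilatedSphereMeasure volume R).withDensityᵥ N).variation x ≤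
          ENNReal.ofReal (K * (‖x‖ ^ (-b) + |R - ‖x‖| ^ (-1 : ℝ))) := by
  obtain ⟨c1, hc1, h1⟩ := exists_setLIntegral_ball_norm_rpow_le (volume : Measure 𝔼) hb0
    (by simpa using hbd)
  obtain ⟨c2, hc2, h2⟩ := exists_dilatedSphereMeasure_ball_le (volume : Measure 𝔼) hR
  refine ⟨K₁ * c1 + |K₂| * c2 + 1, by positivity, fun x hx hxR => maximalMeasure_le fun ρ hρ => ?_⟩
  have e1 : (volume.restrict (Metric.ball (0 : 𝔼) R)).withDensity (fun y => ‖H y‖ₑ)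
      (Metric.ball x ρ) ≤ ENNReal.ofReal (K₁ * (c1 * ‖x‖ ^ (-b))) *
        volume (Metric.ball (0 : 𝔼) ρ) := by
    rw [withDensity_apply _ measurableSet_ball]
    calc _ ≤ ∫⁻ y in Metric.ball x ρ, ENNReal.ofReal (K₁ * ‖y‖ ^ (-b))
          ∂(volume.restrict (Metric.ball 0 R)) := by
          refine lintegral_mono_ae (ae_restrict_of_ae ?_)
          filter_upwards [ae_restrict_mem measurableSet_ball,
            ae_restrict_of_ae (Measure.ae_ne (volume : Measure 𝔼) 0)] with y hy hy0
          rw [← ofReal_norm]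
          exact ENNReal.ofReal_le_ofReal (hHb y hy hy0)
      _ ≤ ∫⁻ y in Metric.ball x ρ, ENNReal.ofReal (K₁ * ‖y‖ ^ (-b)) :=
          lintegral_mono' (Measure.restrict_mono subset_rfl Measure.restrict_le_self) le_rfl
      _ = ENNReal.ofReal K₁ * ∫⁻ y in Metric.ball x ρ, ENNReal.ofReal (‖y‖ ^ (-b)) := by
          simp_rw [ENNReal.ofReal_mul hK₁]
          rw [lintegral_const_mul _ (by fun_prop)]
      _ ≤ _ := by
          rw [ENNReal.ofReal_mul hK₁, mul_assoc]
          gcongr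
          exact h1 x hx ρ hρ
  have e2 : (dilatedSphereMeasure (volume : Measure 𝔼) R).withDensity (fun y => ‖N y‖ₑ)
      (Metric.ball x ρ) ≤ ENNReal.ofReal (|K₂| * (c2 * |R - ‖x‖| ^ (-1 : ℝ))) *
        volume (Metric.ball (0 : 𝔼) ρ) := by
    rw [withDensity_apply _ measurableSet_ball]
    have hae : ∀ᵐ y ∂(dilatedSphereMeasure (volume : Measure 𝔼) R), ‖y‖ = R := by
      rw [dilatedSphereMeasure, ae_map_iff (by fun_prop)
        (measurableSet_eq_fun measurable_norm measurable_const)]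
      exact .of_forall fun θ => norm_smul_sphere hR.le θ
    calc _ ≤ ∫⁻ y in Metric.ball x ρ, ENNReal.ofReal |K₂| ∂(dilatedSphereMeasure volume R) := by
          refine lintegral_mono_ae (ae_restrict_of_ae ?_)
          filter_upwards [hae] with y hy
          rw [← ofReal_norm]
          exact ENNReal.ofReal_le_ofReal ((hNb y hy).trans (le_abs_self _))
      _ = ENNReal.ofReal |K₂| * dilatedSphereMeasure volume R (Metric.ball x ρ) := by
          rw [setLIntegral_const]
      _ ≤ _ := by
          rw [ENNReal.ofReal_mul (abs_nonneg _), mul_assoc]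
          gcongr
          exact h2 x hxR ρ hρ
  refine (VectorMeasure.variation_add_le _).trans ?_
  rw [Measure.add_apply, Measure.variation_withDensityᵥ hH, Measure.variation_withDensityᵥ hN]
  refine (add_le_add e1 e2).trans ?_
  rw [← add_mul, ← ENNReal.ofReal_add (by positivity) (by positivity)]
  gcongr
  have p1 : 0 ≤ ‖x‖ ^ (-b) := by positivity
  have p2 : 0 ≤ |R - ‖x‖| ^ (-1 : ℝ) := by positivity
  have q1 : 0 ≤ K₁ * c1 := by positivity
  have q2 : 0 ≤ |K₂| * c2 := by positivity
  nlinarith [mul_nonneg q1 p2, mul_nonneg q2 p1]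

/-- The profile `‖x‖ ^ (2 - b) (C - κ ‖x‖ ^ b)₊` has a matrix-valued measure as its Hessian. The
maximal function of the variation has singularities `‖x‖ ^ (-b)` at the origin and
`|R - ‖x‖| ^ (-1)` at the free boundary, the latter due to the jump of the gradient. -/
theorem exists_isDistribHessian_profile {b C κ R : ℝ} (hb : 1 < b) (hbd : b < d) (hC : 0 < C)
    (hκ : 0 < κ) (hR : 0 < R) (hCR : κ * R ^ b = C) :
    ∃ D, IsDistribHessian (fun x : 𝔼 => ‖x‖ ^ (2 - b) * max (C - κ * ‖x‖ ^ b) 0) D ∧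
      Integrable (fun x : 𝔼 => ‖x‖ ^ (2 - b) * max (C - κ * ‖x‖ ^ b) 0) ∧
      ∃ K : ℝ, 0 < K ∧ ∀ x : 𝔼, x ≠ 0 → ‖x‖ ≠ R → maximalMeasure D.variation x ≤
        ENNReal.ofReal (K * (‖x‖ ^ (-b) + |R - ‖x‖| ^ (-1 : ℝ))) := by
  -- The profile is `u ‖x‖` in the ball, where `u' r = r * h r`.
  set u : ℝ → ℝ := fun r => C * r ^ (2 - b) - κ * r ^ (2 : ℝ) with hu_def
  set h : ℝ → ℝ := fun r => C * (2 - b) * r ^ (-b) - 2 * κ with hh_def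
  set h' : ℝ → ℝ := fun r => C * (2 - b) * (-b * r ^ (-b - 1)) with hh'_def
  have hd1 : 1 ≤ d := by
    have : (0 : ℝ) < d := by linarith
    exact_mod_cast this
  have hdc : ((d - 1 : ℕ) : ℝ) = d - 1 := by push_cast [Nat.cast_sub hd1]; ring
  have hu : ∀ r ∈ Ioo 0 R, HasDerivAt u (r * h r) r := fun r hr => by
    have hr0 : r ≠ 0 := hr.1.ne'
    have e := ((Real.hasDerivAt_rpow_const (p := 2 - b) (Or.inl hr0)).const_mul C).sub
      ((Real.hasDerivAt_rpow_const (p := 2) (Or.inl hr0)).const_mul κ)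
    refine e.congr_deriv ?_
    have e1 : r ^ (2 - b - 1) = r * r ^ (-b) := by
      rw [show 2 - b - 1 = 1 + -b by ring, Real.rpow_add hr.1, Real.rpow_one]
    have e2 : r ^ ((2 : ℝ) - 1) = r := by norm_num
    rw [e1, e2]
    simp only [h]
    ring
  have hh : ∀ r ∈ Ioo 0 R, HasDerivAt h (h' r) r := fun r hr =>
    ((Real.hasDerivAt_rpow_const (p := -b) (Or.inl hr.1.ne')).const_mul (C * (2 - b))).sub_const _
  have huR : Tendsto u (𝓝[<] R) (𝓝 0) := by
    have hc : ContinuousAt u R :=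
      ((Real.continuousAt_rpow_const R (2 - b) (Or.inl hR.ne')).const_mul C).sub
        ((Real.continuousAt_rpow_const R 2 (Or.inl hR.ne')).const_mul κ)
    have : u R = 0 := by
      have e : R ^ (2 : ℝ) = R ^ (2 - b) * R ^ b := by rw [← Real.rpow_add hR]; ring_nf
      simp only [u, e, ← hCR]
      ring
    rw [← this]
    exact hc.tendsto.mono_left nhdsWithin_le_nhds
  have hhR : Tendsto h (𝓝[<] R) (𝓝 (h R)) := by
    have hc : ContinuousAt h R :=
      ((Real.continuousAt_rpow_const R (-b) (Or.inl hR.ne')).const_mul (C * (2 - b))).sub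
        continuousAt_const
    exact hc.tendsto.mono_left nhdsWithin_le_nhds
  have hu0 : Tendsto (fun r => r ^ (d - 1 + 0) * u r) (𝓝[>] 0) (𝓝 0) := by
    have t1 := (tendsto_pow_mul_rpow_zero (n := d - 1) (s := 2 - b)
      (by rw [hdc]; linarith)).const_mul C
    have t2 := (tendsto_pow_mul_rpow_zero (n := d - 1) (s := 2)
      (by rw [hdc]; linarith)).const_mul κ
    have := t1.sub t2
    simp only [mul_zero, sub_zero] at this
    refine this.congr fun r => ?_
    simp only [u, add_zero]
    ring
  have hh0 : Tendsto (fun r => r ^ (d - 1 + 1) * h r) (𝓝[>] 0) (𝓝 0) := by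
    have hn : ((d - 1 + 1 : ℕ) : ℝ) = d := by rw [Nat.sub_add_cancel hd1]
    have t1 := (tendsto_pow_mul_rpow_zero (n := d - 1 + 1) (s := -b)
      (by rw [hn]; linarith)).const_mul (C * (2 - b))
    have t2 := (tendsto_pow_mul_rpow_zero (n := d - 1 + 1) (s := 0)
      (by rw [hn]; linarith)).const_mul (2 * κ)
    have := t1.sub t2
    simp only [mul_zero, sub_zero, Real.rpow_zero] at this
    refine this.congr fun r => ?_
    simp only [h]
    ring
  have hui : IntegrableOn (fun x : 𝔼 => u ‖x‖) (Metric.ball 0 R) :=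
    ((integrableOn_ball_norm_rpow hR (by linarith)).const_mul C).sub
      ((integrableOn_ball_norm_rpow hR (by linarith)).const_mul κ)
  have hhi : IntegrableOn (fun x : 𝔼 => h ‖x‖) (Metric.ball 0 R) :=
    ((integrableOn_ball_norm_rpow hR (by linarith)).const_mul (C * (2 - b))).sub
      (integrableOn_const measure_ball_lt_top.ne)
  have hrb : ∀ x : 𝔼, x ≠ 0 → ‖x‖ * h' ‖x‖ = C * (2 - b) * (-b) * ‖x‖ ^ (-b) := fun x hx => by
    have hx' : 0 < ‖x‖ := norm_pos_iff.2 hx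
    have : ‖x‖ ^ (-b) = ‖x‖ * ‖x‖ ^ (-b - 1) := by
      nth_rw 2 [← Real.rpow_one ‖x‖]
      rw [← Real.rpow_add hx']
      ring_nf
    simp only [h', this]
    ring
  have hne : ∀ᵐ x : 𝔼 ∂(volume.restrict (Metric.ball 0 R)), x ≠ 0 :=
    ae_restrict_of_ae (Measure.ae_ne _ 0)
  have hh'i : IntegrableOn (fun x : 𝔼 => ‖x‖ ^ 1 * h' ‖x‖) (Metric.ball 0 R) := by
    have : IntegrableOn (fun x : 𝔼 => C * (2 - b) * (-b) * ‖x‖ ^ (-b)) (Metric.ball 0 R) :=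
      (integrableOn_ball_norm_rpow hR (by linarith)).const_mul _
    refine this.congr ?_
    filter_upwards [hne] with x hx
    rw [pow_one, hrb x hx]
  have hprof : (Metric.ball (0 : 𝔼) R).indicator (fun x => u ‖x‖) =ᵐ[volume]
      fun x : 𝔼 => ‖x‖ ^ (2 - b) * max (C - κ * ‖x‖ ^ b) 0 := by
    filter_upwards [Measure.ae_ne (volume : Measure 𝔼) 0] with x hx
    have hx' : 0 < ‖x‖ := norm_pos_iff.2 hx
    by_cases hxR : ‖x‖ < R
    · rw [indicator_of_mem (mem_ball_zero_iff.2 hxR),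
        max_eq_left (sub_pos_of_lt_radius (by linarith) hκ hCR hx'.le hxR).le]
      have e : ‖x‖ ^ (2 : ℝ) = ‖x‖ ^ (2 - b) * ‖x‖ ^ b := by rw [← Real.rpow_add hx']; ring_nf
      simp only [u, e]
      ring
    · rw [indicator_of_notMem (by rwa [mem_ball_zero_iff]),
        max_sub_eq_zero_of_le (by linarith) hκ hR hCR (not_lt.1 hxR), mul_zero]
  have hN : Integrable (rankOneMatrix (d := d) (-h R * R ^ (d - 1) / R))
      (dilatedSphereMeasure volume R) := integrable_rankOneMatrix _ _
  have hD := isDistribHessian_of_radial hR hu hh huR hhR hu0 hh0 hui hhi hh'i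
  refine ⟨_, hD.congr_ae hprof, (hui.integrable_indicator measurableSet_ball).congr hprof,
    exists_maximalMeasure_variation_le (b := b) (K₁ := Fintype.card (Fin d × Fin d) *
      (C * |2 - b| * b + C * |2 - b| + 2 * C)) (K₂ := Fintype.card (Fin d × Fin d) *
      (|-h R * R ^ (d - 1) / R| * R ^ 2)) hR (by positivity) (by linarith) hbd
      (integrableOn_radialHessian hhi hh'i) hN ?_ ?_⟩
  · intro x hx hx0
    have hx' : 0 < ‖x‖ := norm_pos_iff.2 hx0
    have hxb : 0 ≤ ‖x‖ ^ (-b) := by positivity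
    rw [mul_assoc]
    refine norm_le_card_mul_of_abs_le (by positivity) fun k => (abs_radialHessian_le h h' x k).trans ?_
    have a1 : ‖x‖ * |h' ‖x‖| = C * |2 - b| * b * ‖x‖ ^ (-b) := by
      rw [← abs_of_pos hx', ← abs_mul, abs_of_pos hx', hrb x hx0, abs_mul, abs_mul, abs_mul,
        abs_of_pos hC, abs_neg, abs_of_pos (by linarith : 0 < b), abs_of_nonneg hxb]
    have a2 : κ ≤ C * ‖x‖ ^ (-b) := by
      rw [← hCR, Real.rpow_neg hx'.le, mul_assoc]
      refine le_mul_of_one_le_right hκ.le ?_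
      rw [← div_eq_mul_inv, one_le_div (by positivity)]
      exact Real.rpow_le_rpow hx'.le (mem_ball_zero_iff.1 hx).le (by linarith)
    have a3 : |h ‖x‖| ≤ C * |2 - b| * ‖x‖ ^ (-b) + 2 * (C * ‖x‖ ^ (-b)) := by
      refine (abs_sub _ _).trans (add_le_add ?_ ?_)
      · rw [abs_mul, abs_mul, abs_of_pos hC, abs_of_nonneg hxb]
      · rw [abs_of_pos (by positivity)]
        linarith
    rw [a1]
    linarith
  · intro x hx
    refine norm_le_card_mul_of_abs_le (by positivity) fun k => ?_
    change |-h R * R ^ (d - 1) / R * (x k.1 * x k.2)| ≤ _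
    rw [abs_mul, abs_mul (x k.1), pow_two]
    gcongr
    · exact (abs_coord_le_norm x _).trans hx.le
    · exact (abs_coord_le_norm x _).trans hx.le

/-- The weight vanishes like `(R - ‖x‖) ^ γ` at the free boundary, which compensates for the
singularity of order one of the maximal function. -/
theorem lintegral_maximalMeasure_mul_profile_lt_top {μ : Measure 𝔼} {b C κ R K γ : ℝ} (hb : 1 < b)
    (hbd : b < d) (hC : 0 < C) (hκ : 0 < κ) (hR : 0 < R) (hCR : κ * R ^ b = C) (hγ : 0 < γ)
    (hK : 0 < K) (hμ : ∀ x : 𝔼, x ≠ 0 → ‖x‖ ≠ R → maximalMeasure μ x ≤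
      ENNReal.ofReal (K * (‖x‖ ^ (-b) + |R - ‖x‖| ^ (-1 : ℝ)))) :
    ∫⁻ x, maximalMeasure μ x * ENNReal.ofReal (max (C - κ * ‖x‖ ^ b) 0 ^ γ) < ⊤ := by
  have i1 : IntegrableOn (fun x : 𝔼 => ‖x‖ ^ (-b)) (Metric.ball 0 R) :=
    integrableOn_ball_norm_rpow hR (by linarith)
  have i2 : IntegrableOn (fun x : 𝔼 => |R - ‖x‖| ^ (-(1 - γ))) (Metric.ball 0 R) :=
    integrableOn_ball_sub_norm_rpow hR (by linarith)
  have i3 := (i1.const_mul (K * C ^ γ)).add (i2.const_mul (K * (C * b / R) ^ γ))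
  refine lt_of_le_of_lt ?_ i3.lintegral_lt_top
  rw [← lintegral_indicator measurableSet_ball]
  refine lintegral_mono_ae ?_
  filter_upwards [ae_ne_zero_and_norm_ne (d := d) R hR.ne'] with x ⟨hx, hxR⟩
  have hx' : 0 < ‖x‖ := norm_pos_iff.2 hx
  rcases lt_or_gt_of_ne hxR with hlt | hgt
  · rw [indicator_of_mem (mem_ball_zero_iff.2 hlt)]
    have hF := sub_pos_of_lt_radius (by linarith) hκ hCR hx'.le hlt
    rw [max_eq_left hF.le]
    calc _ ≤ ENNReal.ofReal (K * (‖x‖ ^ (-b) + |R - ‖x‖| ^ (-1 : ℝ))) *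
          ENNReal.ofReal ((C - κ * ‖x‖ ^ b) ^ γ) := by
          gcongr
          exact hμ x hx hxR
      _ = ENNReal.ofReal (K * (‖x‖ ^ (-b) + |R - ‖x‖| ^ (-1 : ℝ)) * (C - κ * ‖x‖ ^ b) ^ γ) := by
          exact (ENNReal.ofReal_mul (by positivity)).symm
      _ ≤ _ := by
          apply ENNReal.ofReal_le_ofReal
          have hpos : 0 < R - ‖x‖ := sub_pos.2 hlt
          have b1 : (C - κ * ‖x‖ ^ b) ^ γ ≤ C ^ γ := by
            gcongr
            have : 0 ≤ κ * ‖x‖ ^ b := by positivity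
            linarith
          have b2 : |R - ‖x‖| ^ (-1 : ℝ) * (C - κ * ‖x‖ ^ b) ^ γ ≤
              (C * b / R) ^ γ * |R - ‖x‖| ^ (-(1 - γ)) := by
            rw [abs_of_pos hpos]
            calc _ ≤ (R - ‖x‖) ^ (-1 : ℝ) * (C * b / R * (R - ‖x‖)) ^ γ := by
                  gcongr
                  exact sub_mul_rpow_le_mul_sub hb.le hκ hR hCR hx'.le
              _ = (C * b / R) ^ γ * ((R - ‖x‖) ^ (-1 : ℝ) * (R - ‖x‖) ^ γ) := by
                  rw [Real.mul_rpow (by positivity) hpos.le]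
                  ring
              _ = _ := by
                  rw [← Real.rpow_add hpos]
                  ring_nf
          have p1 : 0 ≤ ‖x‖ ^ (-b) := by positivity
          calc _ = K * (‖x‖ ^ (-b) * (C - κ * ‖x‖ ^ b) ^ γ +
                |R - ‖x‖| ^ (-1 : ℝ) * (C - κ * ‖x‖ ^ b) ^ γ) := by ring
            _ ≤ K * (‖x‖ ^ (-b) * C ^ γ + (C * b / R) ^ γ * |R - ‖x‖| ^ (-(1 - γ))) := by
                gcongr
            _ = _ := by simp only [Pi.add_apply]; ring
  · rw [max_sub_eq_zero_of_le (by linarith) hκ hR hCR hgt.le, Real.zero_rpow hγ.ne']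
    simp

end ProfileHessian

/-! ### The gradient of the profile `‖x‖ ^ m (C - κ ‖x‖ ^ b)₊ ^ e` -/

section ProfileGradient

open Module Filter Topology Leibenson

variable {d : ℕ}

local notation "𝔼" => EuclideanSpace ℝ (Fin d)

/-- A product of two singularities at different points is dominated by their sum. -/
theorem rpow_neg_mul_sub_rpow_neg_le {α ε R r : ℝ} (hα : 0 ≤ α) (hε : 0 ≤ ε) (h0 : 0 < r)
    (hr : r < R) : r ^ (-α) * (R - r) ^ (-ε) ≤
      (R / 2) ^ (-ε) * r ^ (-α) + (R / 2) ^ (-α) * (R - r) ^ (-ε) := by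
  have hR : 0 < R / 2 := by linarith
  have hs : 0 < R - r := by linarith
  have p1 : 0 ≤ r ^ (-α) := by positivity
  have p2 : 0 ≤ (R - r) ^ (-ε) := by positivity
  rcases le_total r (R / 2) with h | h
  · have : (R - r) ^ (-ε) ≤ (R / 2) ^ (-ε) :=
      Real.rpow_le_rpow_of_nonpos hR (by linarith) (by linarith)
    have p3 : 0 ≤ (R / 2) ^ (-α) := by positivity
    nlinarith [mul_nonneg p3 p2]
  · have : r ^ (-α) ≤ (R / 2) ^ (-α) :=
      Real.rpow_le_rpow_of_nonpos hR h (by linarith)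
    have p3 : 0 ≤ (R / 2) ^ (-ε) := by positivity
    nlinarith [mul_nonneg p3 p1]

/-- The derivative of `r ^ m (C - κ r ^ b) ^ e` is singular at most of order `1 - m` at the origin and
of order `1 - e` at the free boundary. -/
theorem exists_abs_deriv_profile_le {b C κ R m e α ε : ℝ} (hb : 1 < b) (hC : 0 < C) (hκ : 0 < κ)
    (hR : 0 < R) (hCR : κ * R ^ b = C) (he : 0 < e) (hα : 0 ≤ α) (hε : 0 ≤ ε) (hm : 0 ≤ m - 1 + α)
    (hεe : 0 ≤ e - 1 + ε) : ∃ K : ℝ, 0 < K ∧ ∀ r ∈ Ioo 0 R,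
      |m * r ^ (m - 1) * (C - κ * r ^ b) ^ e +
        r ^ m * (-(κ * (b * r ^ (b - 1))) * e * (C - κ * r ^ b) ^ (e - 1))| ≤
      K * (r ^ (-α) + |R - r| ^ (-ε)) := by
  set K₁ := |m| * R ^ (m - 1 + α) * C ^ e
  set K₂ := κ * b * e * R ^ (m + b - 1 + α) * (C ^ (e - 1 + ε) * (C / R) ^ (-ε))
  have hK₁ : 0 ≤ K₁ := by positivity
  have hK₂ : 0 < K₂ := by positivity
  refine ⟨K₁ + K₂ * ((R / 2) ^ (-ε) + (R / 2) ^ (-α)), by positivity, fun r hr => ?_⟩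
  have hs : 0 < R - r := sub_pos.2 hr.2
  have hF : 0 < C - κ * r ^ b := sub_pos_of_lt_radius (by linarith) hκ hCR hr.1.le hr.2
  have hFC : C - κ * r ^ b ≤ C := by
    have : 0 ≤ κ * r ^ b := by have := hr.1; positivity
    linarith
  have hr0 := hr.1
  rw [abs_of_pos hs]
  have t1 : |m * r ^ (m - 1) * (C - κ * r ^ b) ^ e| ≤ K₁ * r ^ (-α) := by
    rw [abs_mul, abs_mul, abs_of_pos (by positivity : 0 < r ^ (m - 1)),
      abs_of_pos (by positivity : 0 < (C - κ * r ^ b) ^ e)]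
    calc _ ≤ |m| * (R ^ (m - 1 + α) * r ^ (-α)) * C ^ e := by
          gcongr
          exact rpow_le_mul_rpow_neg hr0 hr.2.le hm
      _ = _ := by simp only [K₁]; ring
  have t2 : |r ^ m * (-(κ * (b * r ^ (b - 1))) * e * (C - κ * r ^ b) ^ (e - 1))| ≤
      K₂ * (r ^ (-α) * (R - r) ^ (-ε)) := by
    have e1 : (C - κ * r ^ b) ^ (e - 1) ≤
        C ^ (e - 1 + ε) * ((C / R) ^ (-ε) * (R - r) ^ (-ε)) := by
      calc _ = (C - κ * r ^ b) ^ (e - 1 + ε) * (C - κ * r ^ b) ^ (-ε) := by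
            rw [← Real.rpow_add hF]; ring_nf
        _ ≤ C ^ (e - 1 + ε) * (C / R * (R - r)) ^ (-ε) := by
            gcongr ?_ * ?_
            · exact Real.rpow_le_rpow hF.le hFC hεe
            · exact Real.rpow_le_rpow_of_nonpos (by positivity)
                (mul_sub_le_sub_mul_rpow hb.le hκ hR hCR hr0.le hr.2.le) (by linarith)
        _ = _ := by rw [Real.mul_rpow (by positivity) hs.le]
    have e2 : r ^ m * r ^ (b - 1) ≤ R ^ (m + b - 1 + α) * r ^ (-α) := by
      rw [← Real.rpow_add hr0, show m + (b - 1) = m + b - 1 by ring]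
      exact rpow_le_mul_rpow_neg hr0 hr.2.le (by linarith)
    have e3 : |r ^ m * (-(κ * (b * r ^ (b - 1))) * e * (C - κ * r ^ b) ^ (e - 1))| =
        κ * b * e * (r ^ m * r ^ (b - 1)) * (C - κ * r ^ b) ^ (e - 1) := by
      rw [show r ^ m * (-(κ * (b * r ^ (b - 1))) * e * (C - κ * r ^ b) ^ (e - 1)) =
        -(κ * b * e * (r ^ m * r ^ (b - 1)) * (C - κ * r ^ b) ^ (e - 1)) by ring, abs_neg,
        abs_of_nonneg (by positivity)]
    rw [e3]
    calc _ ≤ κ * b * e * (R ^ (m + b - 1 + α) * r ^ (-α)) *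
          (C ^ (e - 1 + ε) * ((C / R) ^ (-ε) * (R - r) ^ (-ε))) := by gcongr
      _ = _ := by simp only [K₂]; ring
  have t3 := mul_le_mul_of_nonneg_left (rpow_neg_mul_sub_rpow_neg_le hα hε hr0 hr.2) hK₂.le
  refine ((abs_add_le _ _).trans (add_le_add t1 (t2.trans t3))).trans ?_
  have p1 : 0 ≤ r ^ (-α) := by positivity
  have p2 : 0 ≤ (R - r) ^ (-ε) := by positivity
  have p3 : 0 ≤ K₂ * (R / 2) ^ (-ε) := by positivity
  have p4 : 0 ≤ K₂ * (R / 2) ^ (-α) := by positivity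
  nlinarith [mul_nonneg hK₁ p2, mul_nonneg p3 p2, mul_nonneg p4 p1]

variable [Nontrivial (EuclideanSpace ℝ (Fin d))]

theorem exists_maximalFun_le {G : 𝔼 → 𝔼} {R K₀ α ε : ℝ} (hα : 0 ≤ α) (hαd : α < d)
    (hε : 0 ≤ ε) (hε1 : ε < 1) (hK₀ : 0 < K₀)
    (hG : ∀ x : 𝔼, x ≠ 0 → ‖G x‖ ≤ K₀ * (‖x‖ ^ (-α) + |R - ‖x‖| ^ (-ε))) :
    ∃ K : ℝ, 0 < K ∧ ∀ x : 𝔼, x ≠ 0 → ‖x‖ ≠ R →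
      maximalFun G x ≤ ENNReal.ofReal (K * (‖x‖ ^ (-α) + |R - ‖x‖| ^ (-ε))) := by
  obtain ⟨c1, hc1, h1⟩ := exists_setLIntegral_ball_norm_rpow_le (volume : Measure 𝔼) hα
    (by simpa using hαd)
  obtain ⟨c2, hc2, h2⟩ := exists_setLIntegral_ball_sub_norm_rpow_le (volume : Measure 𝔼) R hε hε1
  refine ⟨K₀ * (c1 + c2), by positivity, fun x hx hxR => maximalMeasure_le fun ρ hρ => ?_⟩
  rw [withDensity_apply _ measurableSet_ball]
  calc _ ≤ ∫⁻ y in Metric.ball x ρ, (ENNReal.ofReal K₀ * ENNReal.ofReal (‖y‖ ^ (-α)) +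
        ENNReal.ofReal K₀ * ENNReal.ofReal (|R - ‖y‖| ^ (-ε))) := by
        refine lintegral_mono_ae (ae_restrict_of_ae ?_)
        filter_upwards [Measure.ae_ne (volume : Measure 𝔼) 0] with y hy
        rw [← ofReal_norm, ← mul_add, ← ENNReal.ofReal_add (by positivity) (by positivity),
          ← ENNReal.ofReal_mul hK₀.le]
        exact ENNReal.ofReal_le_ofReal (hG y hy)
    _ = ENNReal.ofReal K₀ * (∫⁻ y in Metric.ball x ρ, ENNReal.ofReal (‖y‖ ^ (-α))) +
        ENNReal.ofReal K₀ * ∫⁻ y in Metric.ball x ρ, ENNReal.ofReal (|R - ‖y‖| ^ (-ε)) := by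
        rw [lintegral_add_left (by fun_prop), lintegral_const_mul _ (by fun_prop),
          lintegral_const_mul _ (by fun_prop)]
    _ ≤ ENNReal.ofReal K₀ * (ENNReal.ofReal (c1 * ‖x‖ ^ (-α)) * volume (Metric.ball (0 : 𝔼) ρ)) +
        ENNReal.ofReal K₀ *
          (ENNReal.ofReal (c2 * |R - ‖x‖| ^ (-ε)) * volume (Metric.ball (0 : 𝔼) ρ)) := by
        gcongr
        · exact h1 x hx ρ hρ
        · exact h2 x hxR ρ hρ
    _ = ENNReal.ofReal (K₀ * (c1 * ‖x‖ ^ (-α) + c2 * |R - ‖x‖| ^ (-ε))) *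
        volume (Metric.ball (0 : 𝔼) ρ) := by
        rw [ENNReal.ofReal_mul hK₀.le, ENNReal.ofReal_add (by positivity) (by positivity)]
        ring
    _ ≤ _ := by
        rw [mul_assoc K₀]
        gcongr ENNReal.ofReal (K₀ * ?_) * _
        have p1 : 0 ≤ ‖x‖ ^ (-α) := by positivity
        have p2 : 0 ≤ |R - ‖x‖| ^ (-ε) := by positivity
        nlinarith [mul_nonneg hc1.le p2, mul_nonneg hc2.le p1]

/-- The maximal function of an integrable function with bounded support decays like `‖x‖ ^ (-d)`:
small balls around `x` miss the support. -/
theorem exists_maximalFun_le_of_two_mul_le_norm {G : 𝔼 → 𝔼} {R : ℝ} (hR : 0 < R)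
    (hG : Integrable G) (hGs : ∀ x, R ≤ ‖x‖ → G x = 0) :
    ∃ K : ℝ, 0 < K ∧ ∀ x : 𝔼, 2 * R ≤ ‖x‖ →
      maximalFun G x ≤ ENNReal.ofReal (K * ‖x‖ ^ (-(d : ℝ))) := by
  have hv : 0 < (volume : Measure 𝔼).real (Metric.ball 0 1) :=
    ENNReal.toReal_pos (Metric.measure_ball_pos _ _ one_pos).ne' measure_ball_lt_top.ne
  obtain ⟨I, hI, hGI⟩ : ∃ I : ℝ, 0 ≤ I ∧ ∫⁻ y, ‖G y‖ₑ = ENNReal.ofReal I :=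
    ⟨_, ENNReal.toReal_nonneg, (ENNReal.ofReal_toReal hG.2.ne).symm⟩
  have hvol : ∀ ρ : ℝ, 0 ≤ ρ → volume (Metric.ball (0 : 𝔼) ρ) = ENNReal.ofReal
      (ρ ^ (d - 1) * ρ * (volume : Measure 𝔼).real (Metric.ball 0 1)) := fun ρ hρ => by
    rw [measure_ball_zero_eq_ofReal _ hρ, finrank_euclideanSpace_fin]
  generalize (volume : Measure 𝔼).real (Metric.ball 0 1) = v at hv hvol
  have hd1 : 0 < d := by
    have := finrank_pos (R := ℝ) (M := 𝔼)
    simpa using this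
  refine ⟨2 ^ d * (I + 1) / v, by positivity, fun x hx => maximalMeasure_le fun ρ hρ => ?_⟩
  have hx0 : 0 < ‖x‖ := by linarith
  rw [withDensity_apply _ measurableSet_ball]
  rcases le_total ρ (‖x‖ / 2) with h | h
  · have : ∫⁻ y in Metric.ball x ρ, ‖G y‖ₑ = 0 := by
      refine (setLIntegral_congr_fun (g := fun _ => 0) measurableSet_ball fun y hy => ?_).trans
        lintegral_zero
      rw [mem_ball_iff_norm'] at hy
      have hy' : R ≤ ‖y‖ := by
        have := norm_sub_norm_le x y
        linarith
      simp [hGs y hy']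
    rw [this]
    exact zero_le
  · calc _ ≤ ∫⁻ y, ‖G y‖ₑ := setLIntegral_le_lintegral _ _
      _ = ENNReal.ofReal I := by
          rw [hGI]
      _ ≤ ENNReal.ofReal (2 ^ d * (I + 1) / v * ‖x‖ ^ (-(d : ℝ)) * ((‖x‖ / 2) ^ d * v)) := by
          apply ENNReal.ofReal_le_ofReal
          have : 2 ^ d * (I + 1) / v * ‖x‖ ^ (-(d : ℝ)) * ((‖x‖ / 2) ^ d * v) = I + 1 := by
            rw [Real.rpow_neg hx0.le, Real.rpow_natCast, div_pow]
            field_simp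
          linarith
      _ ≤ _ := by
          have hc : 0 ≤ 2 ^ d * (I + 1) / v * ‖x‖ ^ (-(d : ℝ)) := by positivity
          rw [hvol ρ hρ.le, ← pow_succ, Nat.sub_add_cancel hd1, ← ENNReal.ofReal_mul hc]
          exact ENNReal.ofReal_le_ofReal (mul_le_mul_of_nonneg_left
            (mul_le_mul_of_nonneg_right (pow_le_pow_left₀ (by positivity) h d) hv.le) hc)

/-- The two bounds for the maximal function give the weighted `L²` bound: `2 α + w < d` is what is
needed at the origin, `ε < 1 / 2` at the free boundary and `-d < w` at infinity. -/
theorem lintegral_maximalFun_sq_mul_rpow_lt_top {G : 𝔼 → 𝔼} {R K K' α ε w : ℝ} (hR : 0 < R)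
    (hε : 2 * ε < 1) (hw : -(d : ℝ) < w) (hw' : w < d) (hαw : 2 * α + w < d) (hK : 0 < K)
    (hK' : 0 < K')
    (h1 : ∀ x : 𝔼, x ≠ 0 → ‖x‖ ≠ R →
      maximalFun G x ≤ ENNReal.ofReal (K * (‖x‖ ^ (-α) + |R - ‖x‖| ^ (-ε))))
    (h2 : ∀ x : 𝔼, 2 * R ≤ ‖x‖ → maximalFun G x ≤ ENNReal.ofReal (K' * ‖x‖ ^ (-(d : ℝ)))) :
    ∫⁻ x, maximalFun G x ^ 2 * ENNReal.ofReal (‖x‖ ^ (-w)) < ⊤ := by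
  rw [← lintegral_add_compl _ (measurableSet_ball (x := (0 : 𝔼)) (ε := 2 * R))]
  refine ENNReal.add_lt_top.2 ⟨?_, ?_⟩
  · have i1 := setLIntegral_ball_sub_norm_rpow_mul_norm_rpow_lt_top (volume : Measure 𝔼)
      (e₁ := 0) (e₂ := 2 * α + w) hR one_pos (by simpa using hαw)
    have i2 := setLIntegral_ball_sub_norm_rpow_mul_norm_rpow_lt_top (volume : Measure 𝔼)
      (e₁ := 2 * ε) (e₂ := w) hR hε (by simpa using hw')
    refine lt_of_le_of_lt ?_ (ENNReal.mul_lt_top (ENNReal.ofReal_lt_top (r := 2 * K ^ 2))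
      (ENNReal.add_lt_top.2 ⟨i1, i2⟩))
    rw [← lintegral_add_left (by fun_prop), ← lintegral_const_mul _ (by fun_prop)]
    refine lintegral_mono_ae (ae_restrict_of_ae ?_)
    filter_upwards [ae_ne_zero_and_norm_ne (d := d) R hR.ne'] with x ⟨hx, hxR⟩
    have hx' : 0 < ‖x‖ := norm_pos_iff.2 hx
    have hxR' : 0 < |R - ‖x‖| := abs_pos.2 (sub_ne_zero.2 hxR.symm)
    calc _ ≤ ENNReal.ofReal (K * (‖x‖ ^ (-α) + |R - ‖x‖| ^ (-ε))) ^ 2 *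
          ENNReal.ofReal (‖x‖ ^ (-w)) := by
          gcongr
          exact h1 x hx hxR
      _ = ENNReal.ofReal ((K * (‖x‖ ^ (-α) + |R - ‖x‖| ^ (-ε))) ^ 2 * ‖x‖ ^ (-w)) := by
          rw [← ENNReal.ofReal_pow (by positivity), ← ENNReal.ofReal_mul (by positivity)]
      _ ≤ ENNReal.ofReal (2 * K ^ 2 * (|R - ‖x‖| ^ (-(0 : ℝ)) * ‖x‖ ^ (-(2 * α + w)) +
          |R - ‖x‖| ^ (-(2 * ε)) * ‖x‖ ^ (-w))) := by
          apply ENNReal.ofReal_le_ofReal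
          have e1 : ‖x‖ ^ (-(2 * α + w)) = (‖x‖ ^ (-α)) ^ 2 * ‖x‖ ^ (-w) := by
            rw [← Real.rpow_natCast, ← Real.rpow_mul hx'.le, ← Real.rpow_add hx']
            push_cast
            ring_nf
          have e2 : |R - ‖x‖| ^ (-(2 * ε)) = (|R - ‖x‖| ^ (-ε)) ^ 2 := by
            rw [← Real.rpow_natCast, ← Real.rpow_mul hxR'.le]
            push_cast
            ring_nf
          rw [e1, e2, neg_zero, Real.rpow_zero, one_mul, ← add_mul, mul_pow, ← mul_assoc]
          have := add_sq_le (a := ‖x‖ ^ (-α)) (b := |R - ‖x‖| ^ (-ε))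
          have hp : 0 ≤ K ^ 2 := by positivity
          exact mul_le_mul_of_nonneg_right (by nlinarith [mul_le_mul_of_nonneg_left this hp])
            (by positivity)
      _ = _ := by
          rw [ENNReal.ofReal_mul (by positivity),
            ENNReal.ofReal_add (by positivity) (by positivity)]
  · have i3 := setLIntegral_compl_ball_norm_rpow_lt_top (volume : Measure 𝔼)
      (R := 2 * R) (e := 2 * d + w) (by positivity) (by simp only [finrank_euclideanSpace_fin]; linarith)
    refine lt_of_le_of_lt ?_ (ENNReal.mul_lt_top (ENNReal.ofReal_lt_top (r := K' ^ 2)) i3)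
    rw [← lintegral_const_mul _ (by fun_prop)]
    refine setLIntegral_mono' measurableSet_ball.compl fun x hx => ?_
    have hx2 : 2 * R ≤ ‖x‖ := by simpa using hx
    have hx' : 0 < ‖x‖ := by linarith
    calc _ ≤ ENNReal.ofReal (K' * ‖x‖ ^ (-(d : ℝ))) ^ 2 * ENNReal.ofReal (‖x‖ ^ (-w)) := by
          gcongr
          exact h2 x hx2
      _ = ENNReal.ofReal ((K' * ‖x‖ ^ (-(d : ℝ))) ^ 2 * ‖x‖ ^ (-w)) := by
          rw [← ENNReal.ofReal_pow (by positivity), ← ENNReal.ofReal_mul (by positivity)]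
      _ = ENNReal.ofReal (K' ^ 2 * ‖x‖ ^ (-(2 * d + w))) := by
          congr 1
          rw [mul_pow, mul_assoc, ← Real.rpow_natCast (‖x‖ ^ (-(d : ℝ))), ← Real.rpow_mul hx'.le,
            ← Real.rpow_add hx']
          push_cast
          ring_nf
      _ = _ := ENNReal.ofReal_mul (by positivity)

/-- The weak gradient of `‖x‖ ^ m (C - κ ‖x‖ ^ b)₊ ^ e` and the weighted `L²` bound for its maximal
function. -/
theorem exists_isWeakGradient_profile {b C κ R m e w : ℝ} (hb : 1 < b) (hC : 0 < C)
    (hκ : 0 < κ) (hR : 0 < R) (hCR : κ * R ^ b = C) (he : 1 / 2 < e) (hw : -(d : ℝ) < w)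
    (hw' : w < d) (hm : 2 * (1 - m) + w < d) :
    ∃ G : 𝔼 → 𝔼, Integrable G ∧
      IsWeakGradient (fun x : 𝔼 => ‖x‖ ^ m * max (C - κ * ‖x‖ ^ b) 0 ^ e) G ∧
      Integrable (fun x : 𝔼 => ‖x‖ ^ m * max (C - κ * ‖x‖ ^ b) 0 ^ e) ∧
      ∫⁻ x, maximalFun G x ^ 2 * ENNReal.ofReal (‖x‖ ^ (-w)) < ⊤ := by
  set α := max (1 - m) 0
  set ε := max (1 - e) 0
  have hα0 : 0 ≤ α := le_max_right _ _
  have hε0 : 0 ≤ ε := le_max_right _ _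
  have hα1 : 1 - m ≤ α := le_max_left _ _
  have hε1 : 1 - e ≤ ε := le_max_left _ _
  have hε : 2 * ε < 1 := by
    rcases max_cases (1 - e) 0 with h | h <;> simp only [ε, h.1] <;> linarith
  have hαw : 2 * α + w < d := by
    rcases max_cases (1 - m) 0 with h | h <;> simp only [α, h.1] <;> linarith
  have hαd : α < d := by linarith
  have hd1 : 1 ≤ d := by
    have : (0 : ℝ) < d := by linarith
    exact_mod_cast this
  have hdc : ((d - 1 : ℕ) : ℝ) = d - 1 := by push_cast [Nat.cast_sub hd1]; ring
  set g : ℝ → ℝ := fun r => r ^ m * (C - κ * r ^ b) ^ e with hg_def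
  set g' : ℝ → ℝ := fun r => m * r ^ (m - 1) * (C - κ * r ^ b) ^ e +
    r ^ m * (-(κ * (b * r ^ (b - 1))) * e * (C - κ * r ^ b) ^ (e - 1)) with hg'_def
  obtain ⟨K₀, hK₀, hbd⟩ := exists_abs_deriv_profile_le (m := m) (e := e) hb hC hκ hR hCR
    (by linarith) hα0 hε0 (by linarith) (by linarith)
  have hg : ∀ r ∈ Ioo 0 R, HasDerivAt g (g' r) r := fun r hr => by
    have hF := sub_pos_of_lt_radius (by linarith) hκ hCR hr.1.le hr.2
    exact (Real.hasDerivAt_rpow_const (Or.inl hr.1.ne')).mul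
      ((((Real.hasDerivAt_rpow_const (p := b) (Or.inl hr.1.ne')).const_mul κ).const_sub
        C).rpow_const (Or.inl hF.ne'))
  have hFc : Continuous fun r : ℝ => (C - κ * r ^ b) ^ e :=
    (continuous_const.sub ((Real.continuous_rpow_const (by linarith)).const_mul κ)).rpow_const
      fun _ => Or.inr (by linarith)
  have hgR : Tendsto g (𝓝[<] R) (𝓝 0) := by
    have hc : ContinuousAt g R :=
      (Real.continuousAt_rpow_const R m (Or.inl hR.ne')).mul hFc.continuousAt
    have : g R = 0 := by
      simp only [g, hCR, sub_self]
      rw [Real.zero_rpow (by linarith), mul_zero]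
    rw [← this]
    exact hc.tendsto.mono_left nhdsWithin_le_nhds
  have hg0 : Tendsto (fun r => r ^ (d - 1 + 0) * g r) (𝓝[>] 0) (𝓝 0) := by
    have t1 := (tendsto_pow_mul_rpow_zero (n := d - 1) (s := m) (by rw [hdc]; linarith)).mul
      (hFc.continuousAt.tendsto.mono_left (nhdsWithin_le_nhds (a := (0 : ℝ)) (s := Ioi 0)))
    rw [zero_mul] at t1
    refine t1.congr fun r => ?_
    simp only [g, add_zero]
    ring
  have hgi : IntegrableOn (fun x : 𝔼 => g ‖x‖) (Metric.ball 0 R) := by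
    have i := (integrableOn_ball_norm_rpow (d := d) (s := m) hR (by linarith)).const_mul (C ^ e)
    refine i.mono' (by fun_prop : Measurable fun x : 𝔼 => g ‖x‖).aestronglyMeasurable ?_
    filter_upwards [ae_restrict_mem measurableSet_ball] with x hx
    have hF := sub_pos_of_lt_radius (by linarith) hκ hCR (norm_nonneg x) (mem_ball_zero_iff.1 hx)
    have : 0 ≤ κ * ‖x‖ ^ b := by positivity
    calc ‖g ‖x‖‖ = (C - κ * ‖x‖ ^ b) ^ e * ‖x‖ ^ m := by
          rw [Real.norm_of_nonneg (by positivity), mul_comm]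
      _ ≤ _ := by
          gcongr
          linarith
  have hg'i : IntegrableOn (fun x : 𝔼 => ‖x‖ ^ 0 * g' ‖x‖) (Metric.ball 0 R) := by
    have i := ((integrableOn_ball_norm_rpow (d := d) (s := -α) hR (by linarith)).add
      (integrableOn_ball_sub_norm_rpow (d := d) (e := ε) hR (by linarith))).const_mul K₀
    refine i.mono' (by fun_prop : Measurable fun x : 𝔼 => ‖x‖ ^ 0 * g' ‖x‖).aestronglyMeasurable ?_
    filter_upwards [ae_restrict_mem measurableSet_ball,
      ae_restrict_of_ae (Measure.ae_ne (volume : Measure 𝔼) 0)] with x hx hx0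
    rw [pow_zero, one_mul, Real.norm_eq_abs]
    exact hbd ‖x‖ ⟨norm_pos_iff.2 hx0, mem_ball_zero_iff.1 hx⟩
  obtain ⟨hGi, hGw⟩ := isWeakGradient_of_radial hR hg hgR hg0 hgi hg'i
  have hprof : (Metric.ball (0 : 𝔼) R).indicator (fun x => g ‖x‖) =
      fun x : 𝔼 => ‖x‖ ^ m * max (C - κ * ‖x‖ ^ b) 0 ^ e := by
    funext x
    by_cases hxR : ‖x‖ < R
    · rw [indicator_of_mem (mem_ball_zero_iff.2 hxR),
        max_eq_left (sub_pos_of_lt_radius (by linarith) hκ hCR (norm_nonneg x) hxR).le]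
    · rw [indicator_of_notMem (by rwa [mem_ball_zero_iff]),
        max_sub_eq_zero_of_le (by linarith) hκ hR hCR (not_lt.1 hxR),
        Real.zero_rpow (by linarith), mul_zero]
  have hGb : ∀ x : 𝔼, x ≠ 0 →
      ‖(Metric.ball (0 : 𝔼) R).indicator (fun x => (g' ‖x‖ / ‖x‖) • x) x‖ ≤
        K₀ * (‖x‖ ^ (-α) + |R - ‖x‖| ^ (-ε)) := fun x hx => by
    by_cases hxR : ‖x‖ < R
    · have hx' : 0 < ‖x‖ := norm_pos_iff.2 hx
      rw [indicator_of_mem (mem_ball_zero_iff.2 hxR), norm_smul, norm_div, norm_norm,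
        div_mul_cancel₀ _ hx'.ne']
      exact hbd ‖x‖ ⟨hx', hxR⟩
    · rw [indicator_of_notMem (by rwa [mem_ball_zero_iff]), norm_zero]
      positivity
  obtain ⟨K, hK, h1⟩ := exists_maximalFun_le (R := R) hα0 hαd hε0 (by linarith) hK₀ hGb
  obtain ⟨K', hK', h2⟩ := exists_maximalFun_le_of_two_mul_le_norm hR hGi fun x hx =>
    indicator_of_notMem (by rw [mem_ball_zero_iff]; exact not_lt.2 hx) _
  rw [hprof] at hGw
  exact ⟨_, hGi, hGw, hprof ▸ hgi.integrable_indicator measurableSet_ball,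
    lintegral_maximalFun_sq_mul_rpow_lt_top hR hε hw hw' hαw hK hK' h1 h2⟩

end ProfileGradient

/-! ### Self-similarity of the coefficient -/

section SelfSimilar

open Module Filter Topology Leibenson

variable {d : ℕ}

local notation "𝔼" => EuclideanSpace ℝ (Fin d)

/-- The dilation factor `(t + δ) ^ (-1 / β)` of the self-similar variable. -/
noncomputable def Leibenson.dilation (d : ℕ) (p q δ t : ℝ) : ℝ := (t + δ) ^ (-(1 / beta d p q))

/-- The amplitude `(t + δ) ^ (-d / β)` of the Barenblatt solution. -/
noncomputable def Leibenson.amplitude (d : ℕ) (p q δ t : ℝ) : ℝ :=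
  (t + δ) ^ (-((d : ℝ) / beta d p q))

/-- The factor, depending on time only, by which `ϱ_δ(t,·)` differs from the dilated profile. -/
noncomputable def Leibenson.rhoAmplitude (d : ℕ) (p q δ t : ℝ) : ℝ :=
  (amplitude d p q δ t * dilation d p q δ t * (gam p q * kappa d p q * (p / (p - 1)))) ^ (p - 2) *
    amplitude d p q δ t ^ ((p - 1) * (q - 1))

section Positivity

variable {p q δ t : ℝ}

theorem Leibenson.dilation_pos (h : 0 < t + δ) : 0 < dilation d p q δ t := Real.rpow_pos_of_pos h _

theorem Leibenson.amplitude_pos (h : 0 < t + δ) : 0 < amplitude d p q δ t :=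
  Real.rpow_pos_of_pos h _

theorem Leibenson.gam_pos (hp : 1 < p) (hpq : 1 < q * (p - 1)) : 0 < gam p q :=
  div_pos (by linarith) (by linarith)

theorem Leibenson.kappa_pos (hp : 1 < p) (hq : 0 < q) (hpq : 1 < q * (p - 1)) :
    0 < kappa d p q := by
  have h1 : 0 < q * (p - 1) - 1 := by linarith
  have h2 : 0 < beta d p q := by unfold beta; positivity
  unfold kappa
  positivity

theorem Leibenson.rhoAmplitude_base_pos (hp : 1 < p) (hq : 0 < q) (hpq : 1 < q * (p - 1))
    (h : 0 < t + δ) : 0 < amplitude d p q δ t * dilation d p q δ t *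
      (gam p q * kappa d p q * (p / (p - 1))) := by
  have h1 : 0 < p / (p - 1) := div_pos (by linarith) (by linarith)
  have h2 := gam_pos hp hpq
  have h3 := kappa_pos (d := d) hp hq hpq
  have h4 := dilation_pos (d := d) (p := p) (q := q) h
  have h5 := amplitude_pos (d := d) (p := p) (q := q) h
  positivity

theorem Leibenson.rhoAmplitude_pos (hp : 1 < p) (hq : 0 < q) (hpq : 1 < q * (p - 1))
    (h : 0 < t + δ) : 0 < rhoAmplitude d p q δ t :=
  mul_pos (Real.rpow_pos_of_pos (rhoAmplitude_base_pos hp hq hpq h) _)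
    (Real.rpow_pos_of_pos (amplitude_pos h) _)

end Positivity

section Regularity

variable {p q δ : ℝ}

theorem Leibenson.continuousOn_dilation (hδ : 0 < δ) :
    ContinuousOn (dilation d p q δ) (Ici 0) :=
  ContinuousOn.rpow_const (by fun_prop) fun t ht => Or.inl (add_pos_of_nonneg_of_pos ht hδ).ne'

theorem Leibenson.continuousOn_amplitude (hδ : 0 < δ) :
    ContinuousOn (amplitude d p q δ) (Ici 0) :=
  ContinuousOn.rpow_const (by fun_prop) fun t ht => Or.inl (add_pos_of_nonneg_of_pos ht hδ).ne'

theorem Leibenson.continuousOn_rhoAmplitude (hp : 1 < p) (hq : 0 < q) (hpq : 1 < q * (p - 1))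
    (hδ : 0 < δ) : ContinuousOn (rhoAmplitude d p q δ) (Ici 0) :=
  ((((continuousOn_amplitude hδ).mul (continuousOn_dilation hδ)).mul
    continuousOn_const).rpow_const fun _ ht => Or.inl
      (rhoAmplitude_base_pos hp hq hpq (add_pos_of_nonneg_of_pos ht hδ)).ne').mul
    ((continuousOn_amplitude hδ).rpow_const fun _ ht => Or.inl
      (amplitude_pos (add_pos_of_nonneg_of_pos ht hδ)).ne')

theorem Leibenson.measurable_dilation : Measurable (dilation d p q δ) := by
  unfold dilation
  fun_prop

theorem Leibenson.measurable_amplitude : Measurable (amplitude d p q δ) := by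
  unfold amplitude
  fun_prop

theorem Leibenson.measurable_rhoAmplitude : Measurable (rhoAmplitude d p q δ) := by
  have h1 := measurable_dilation (d := d) (p := p) (q := q) (δ := δ)
  have h2 := measurable_amplitude (d := d) (p := p) (q := q) (δ := δ)
  unfold rhoAmplitude
  fun_prop

end Regularity

theorem norm_gradient_comp_norm {W : ℝ → ℝ} {W' : ℝ} {x : 𝔼} (hx : x ≠ 0)
    (hW : HasDerivAt W W' ‖x‖) : ‖gradient (fun y : 𝔼 => W ‖y‖) x‖ = |W'| := by
  have h := hW.comp_hasFDerivAt x (hasFDerivAt_norm_of_ne_zero hx)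
  rw [gradient, LinearIsometryEquiv.norm_map, HasFDerivAt.fderiv (f := fun y : 𝔼 => W ‖y‖) h,
    norm_smul, norm_smul, innerSL_apply_norm, norm_inv, norm_norm,
    inv_mul_cancel₀ (norm_ne_zero_iff.2 hx), mul_one, Real.norm_eq_abs]

theorem Leibenson.wDelta_eq {p q C δ t : ℝ} (h : 0 < t + δ) (x : 𝔼) :
    wDelta d p q C δ t x = amplitude d p q δ t *
      max (C - kappa d p q * ‖dilation d p q δ t • x‖ ^ (p / (p - 1))) 0 ^ gam p q := by
  rw [norm_smul, Real.norm_of_nonneg (dilation_pos h).le]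
  rfl

/-- In the self-similar variable `ϱ_δ` is the profile `‖y‖ ^ (2 - b) (C - κ ‖y‖ ^ b)₊` with
`b = p / (p - 1)`: the powers of the positive part in `|∇ w_δ| ^ (p - 2)` and
`w_δ ^ ((p - 1) (q - 1))` add up to `1`. -/
theorem Leibenson.rhoDelta_eq {p q C δ t R : ℝ} (hp : 1 < p) (hq : 0 < q)
    (hpq : 1 < q * (p - 1)) (h : 0 < t + δ) (hR : 0 < R)
    (hCR : kappa d p q * R ^ (p / (p - 1)) = C) {x : 𝔼} (hx : x ≠ 0)
    (hxR : ‖dilation d p q δ t • x‖ ≠ R) :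
    rhoDelta d p q C δ t x = rhoAmplitude d p q δ t *
      (‖dilation d p q δ t • x‖ ^ (2 - p / (p - 1)) *
        max (C - kappa d p q * ‖dilation d p q δ t • x‖ ^ (p / (p - 1))) 0) := by
  have hl := dilation_pos (d := d) (p := p) (q := q) h
  have hB := amplitude_pos (d := d) (p := p) (q := q) h
  have hκ := kappa_pos (d := d) hp hq hpq
  have hγ := gam_pos hp hpq
  have hp1 : p - 1 ≠ 0 := by linarith
  have hpq1 : q * (p - 1) - 1 ≠ 0 := by linarith
  have hb : 0 < p / (p - 1) := div_pos (by linarith) (by linarith)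
  have hw := wDelta_eq (C := C) (p := p) (q := q) h x
  have hn : ∀ y : 𝔼, ‖dilation d p q δ t • y‖ = dilation d p q δ t * ‖y‖ := fun y => by
    rw [norm_smul, Real.norm_of_nonneg hl.le]
  have hx' : 0 < ‖x‖ := norm_pos_iff.2 hx
  have hgrad : (fun y => wDelta d p q C δ t y) = fun y : 𝔼 =>
      (fun r : ℝ => amplitude d p q δ t * max (C - kappa d p q *
        (dilation d p q δ t * r) ^ (p / (p - 1))) 0 ^ gam p q) ‖y‖ := rfl
  rw [rhoDelta, hw, hgrad]
  rw [hn] at hxR ⊢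
  rw [rhoAmplitude]
  set l := dilation d p q δ t
  set B := amplitude d p q δ t
  set κ := kappa d p q
  set γ := gam p q
  set b := p / (p - 1) with hb_def
  have hr : 0 < l * ‖x‖ := by positivity
  have hlc : Continuous fun r : ℝ => l * r := by fun_prop
  rcases lt_or_gt_of_ne hxR with hlt | hgt
  · have hF := sub_pos_of_lt_radius hb hκ hCR hr.le hlt
    have hev : (fun r : ℝ => B * max (C - κ * (l * r) ^ b) 0 ^ γ) =ᶠ[𝓝 ‖x‖]
        fun r => B * (C - κ * (l * r) ^ b) ^ γ := by
      have hnh : ∀ᶠ r in 𝓝 ‖x‖, l * r ∈ Ioo 0 R :=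
        hlc.continuousAt.eventually_mem (Ioo_mem_nhds hr hlt)
      filter_upwards [hnh] with r hr'
      rw [max_eq_left (sub_pos_of_lt_radius hb hκ hCR hr'.1.le hr'.2).le]
    have hder := ((((((hasDerivAt_id ‖x‖).const_mul l).rpow_const (p := b)
      (Or.inl hr.ne')).const_mul κ).const_sub C).rpow_const (p := γ)
      (Or.inl hF.ne')).const_mul B
    rw [norm_gradient_comp_norm hx (hder.congr_of_eventuallyEq hev), max_eq_left hF.le]
    simp only [id]
    generalize C - κ * (l * ‖x‖) ^ b = F at hF
    generalize l * ‖x‖ = r at hr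
    have e1 : |B * (-(κ * (l * 1 * b * r ^ (b - 1))) * γ * F ^ (γ - 1))| =
        B * l * (γ * κ * b) * r ^ (b - 1) * F ^ (γ - 1) := by
      rw [show B * (-(κ * (l * 1 * b * r ^ (b - 1))) * γ * F ^ (γ - 1)) =
        -(B * l * (γ * κ * b) * r ^ (b - 1) * F ^ (γ - 1)) by ring, abs_neg,
        abs_of_pos (by positivity)]
    have x1 : (b - 1) * (p - 2) = 2 - b := by
      rw [hb_def]
      field_simp
      ring
    have x2 : (γ - 1) * (p - 2) + γ * ((p - 1) * (q - 1)) = 1 := by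
      have hγ1 : γ * (q * (p - 1) - 1) = p - 1 := div_mul_cancel₀ _ hpq1
      linear_combination hγ1
    rw [e1, Real.mul_rpow (by positivity) (by positivity),
      Real.mul_rpow (by positivity) (by positivity), Real.mul_rpow hB.le (by positivity),
      ← Real.rpow_mul hr.le, ← Real.rpow_mul hF.le, ← Real.rpow_mul hF.le, x1]
    have x3 : F ^ ((γ - 1) * (p - 2)) * F ^ (γ * ((p - 1) * (q - 1))) = F := by
      rw [← Real.rpow_add hF, x2, Real.rpow_one]
    linear_combination ((B * l * (γ * κ * b)) ^ (p - 2) * r ^ (2 - b) *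
      B ^ ((p - 1) * (q - 1))) * x3
  · have hev : (fun r : ℝ => B * max (C - κ * (l * r) ^ b) 0 ^ γ) =ᶠ[𝓝 ‖x‖] fun _ => 0 := by
      have hnh : ∀ᶠ r in 𝓝 ‖x‖, l * r ∈ Ioi R :=
        hlc.continuousAt.eventually_mem (Ioi_mem_nhds hgt)
      filter_upwards [hnh] with r hr'
      rw [max_sub_eq_zero_of_le hb hκ hR hCR (le_of_lt hr'), Real.zero_rpow hγ.ne', mul_zero]
    rw [norm_gradient_comp_norm hx ((hasDerivAt_const ‖x‖ (0 : ℝ)).congr_of_eventuallyEq hev),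
      max_sub_eq_zero_of_le hb hκ hR hCR hgt.le, Real.zero_rpow hγ.ne', mul_zero, mul_zero,
      mul_zero, abs_zero]
    -- `0 ^ 0 = 1`, so it matters that the two exponents do not vanish simultaneously.
    rcases eq_or_ne p 2 with rfl | hp2
    · rw [Real.zero_rpow (by linarith : ((2 : ℝ) - 1) * (q - 1) ≠ 0), mul_zero]
    · rw [Real.zero_rpow (sub_ne_zero.2 hp2), zero_mul]

/-- Measurability and finiteness of the space-time integral of a function that arises from a fixed
integrable one by dilations and multiplications depending on time. -/
theorem aemeasurable_and_lintegral_lt_top_of_selfSimilar {T : ℝ} {c l : ℝ → ℝ} {Φ : 𝔼 → ℝ≥0∞}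
    {f : ℝ → 𝔼 → ℝ≥0∞} (hcm : Measurable c) (hlm : Measurable l) (hΦm : Measurable Φ)
    (hcc : ContinuousOn c (Icc 0 T)) (hlc : ContinuousOn l (Icc 0 T))
    (hl : ∀ t ∈ Icc 0 T, 0 < l t) (hc : ∀ t ∈ Icc 0 T, 0 ≤ c t) (hΦ : ∫⁻ x, Φ x < ⊤)
    (hf : ∀ t ∈ Icc 0 T, ∀ x, f t x = ENNReal.ofReal (c t) * Φ (l t • x)) :
    AEMeasurable (fun z : ℝ × 𝔼 => f z.1 z.2) ((volume.restrict (Icc 0 T)).prod volume) ∧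
      ∫⁻ t in Icc 0 T, ∫⁻ x, f t x < ⊤ := by
  refine ⟨⟨fun z => ENNReal.ofReal (c z.1) * Φ (l z.1 • z.2), by fun_prop, ?_⟩, ?_⟩
  · filter_upwards [Measure.quasiMeasurePreserving_fst.ae
      (ae_restrict_mem (μ := volume) (measurableSet_Icc (a := (0 : ℝ)) (b := T)))] with z hz
    exact hf z.1 hz z.2
  · have hcont : ContinuousOn (fun t => c t * (l t ^ d)⁻¹) (Icc 0 T) :=
      hcc.mul ((hlc.pow d).inv₀ fun t ht => (pow_pos (hl t ht) d).ne')
    -- The inner integral is a function of `t`, bounded by compactness of `[0, T]`, times `∫⁻ Φ`.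
    obtain ⟨M, hM⟩ := isCompact_Icc.bddAbove_image hcont
    have hinner : ∀ t ∈ Icc 0 T, ∫⁻ x, f t x ≤ ENNReal.ofReal M * ∫⁻ x, Φ x := fun t ht => by
      simp_rw [hf t ht]
      rw [lintegral_const_mul' _ _ ENNReal.ofReal_ne_top, lintegral_comp_smul_of_pos (hl t ht),
        ← mul_assoc, ← ENNReal.ofReal_mul (hc t ht)]
      gcongr
      exact hM ⟨t, ht, rfl⟩
    refine (setLIntegral_mono' measurableSet_Icc hinner).trans_lt ?_
    rw [setLIntegral_const]
    exact ENNReal.mul_lt_top (ENNReal.mul_lt_top ENNReal.ofReal_lt_top hΦ) measure_Icc_lt_top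

end SelfSimilar

/-! ### The space-time integrals -/

section Conclusion

open Module Filter Topology Leibenson

variable {d : ℕ} [Nontrivial (EuclideanSpace ℝ (Fin d))]

local notation "𝔼" => EuclideanSpace ℝ (Fin d)

variable {p q C δ R : ℝ}

theorem Leibenson.rhoDelta_ae_eq {t : ℝ} (hp : 1 < p) (hq : 0 < q) (hpq : 1 < q * (p - 1))
    (h : 0 < t + δ) (hR : 0 < R) (hCR : kappa d p q * R ^ (p / (p - 1)) = C) :
    rhoDelta d p q C δ t =ᵐ[volume] fun x => rhoAmplitude d p q δ t *
      (‖dilation d p q δ t • x‖ ^ (2 - p / (p - 1)) *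
        max (C - kappa d p q * ‖dilation d p q δ t • x‖ ^ (p / (p - 1))) 0) := by
  have hl := dilation_pos (d := d) (p := p) (q := q) h
  filter_upwards [ae_ne_zero_and_norm_ne (d := d) (R / dilation d p q δ t)
    (div_pos hR hl).ne'] with x ⟨hx, hxR⟩
  refine rhoDelta_eq hp hq hpq h hR hCR hx fun h' => hxR ?_
  rw [← h', norm_smul, Real.norm_of_nonneg hl.le, mul_div_cancel_left₀ _ hl.ne']

theorem Leibenson.rhoDelta_rpow_ae_eq {t : ℝ} (s : ℝ) (hp : 1 < p) (hq : 0 < q)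
    (hpq : 1 < q * (p - 1)) (h : 0 < t + δ) (hR : 0 < R)
    (hCR : kappa d p q * R ^ (p / (p - 1)) = C) :
    (fun x : 𝔼 => rhoDelta d p q C δ t x ^ s) =ᵐ[volume] fun x => rhoAmplitude d p q δ t ^ s *
      (‖dilation d p q δ t • x‖ ^ ((2 - p / (p - 1)) * s) *
        max (C - kappa d p q * ‖dilation d p q δ t • x‖ ^ (p / (p - 1))) 0 ^ s) := by
  filter_upwards [rhoDelta_ae_eq (d := d) hp hq hpq h hR hCR] with x hx
  rw [hx, Real.mul_rpow (rhoAmplitude_pos hp hq hpq h).le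
    (mul_nonneg (by positivity) (le_max_right _ _)), Real.mul_rpow (by positivity)
    (le_max_right _ _), Real.rpow_mul (norm_nonneg _)]

/-- Existence of the Hessian of `ϱ_δ(t,·)` and integrability of its maximal function against `w_δ`,
where `R` is the radius of the free boundary in the self-similar variable. -/
theorem Leibenson.distribHessian_rhoDelta (hp : 1 < p) (hq : 0 < q) (hpq : 1 < q * (p - 1))
    (hC : 0 < C) (hδ : 0 < δ) (hbd : p / (p - 1) < d) (hR : 0 < R)
    (hCR : kappa d p q * R ^ (p / (p - 1)) = C) :
    (∀ t : ℝ, 0 ≤ t → ∃ D, IsDistribHessian (rhoDelta d p q C δ t) D) ∧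
      ∀ T : ℝ, ∀ D : ℝ → VectorMeasure 𝔼 (EuclideanSpace ℝ (Fin d × Fin d)),
        (∀ t ∈ Icc 0 T, IsDistribHessian (rhoDelta d p q C δ t) (D t)) →
        AEMeasurable (fun z : ℝ × 𝔼 => maximalMeasure (D z.1).variation z.2 *
            ENNReal.ofReal (wDelta d p q C δ z.1 z.2)) ((volume.restrict (Icc 0 T)).prod volume) ∧
        ∫⁻ t in Icc 0 T, ∫⁻ x, maximalMeasure (D t).variation x *
            ENNReal.ofReal (wDelta d p q C δ t x) < ⊤ := by
  have hb : 1 < p / (p - 1) := (one_lt_div (by linarith)).2 (by linarith)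
  have hκ := kappa_pos (d := d) hp hq hpq
  obtain ⟨D₀, hD₀, hint, K, hK, hbound⟩ := exists_isDistribHessian_profile (d := d) hb hbd hC hκ hR hCR
  have hfin := lintegral_maximalMeasure_mul_profile_lt_top hb hbd hC hκ hR hCR (gam_pos hp hpq)
    hK hbound
  have hex : ∀ t : ℝ, 0 ≤ t → IsDistribHessian (rhoDelta d p q C δ t)
      ((rhoAmplitude d p q δ t * ((dilation d p q δ t ^ d)⁻¹ * dilation d p q δ t ^ 2)) •
        D₀.map fun y => (dilation d p q δ t)⁻¹ • y) := fun t ht =>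
    (hD₀.comp_smul hint _ (dilation_pos (by linarith))).congr_ae
      (rhoDelta_ae_eq hp hq hpq (by linarith) hR hCR).symm
  refine ⟨fun t ht => ⟨_, hex t ht⟩, fun T D hD =>
    aemeasurable_and_lintegral_lt_top_of_selfSimilar
      (f := fun t x => maximalMeasure (D t).variation x *
        ENNReal.ofReal (wDelta d p q C δ t x))
      (c := fun t => rhoAmplitude d p q δ t * dilation d p q δ t ^ 2 * amplitude d p q δ t)
      (l := dilation d p q δ)
      ((measurable_rhoAmplitude.mul (measurable_dilation.pow_const 2)).mul measurable_amplitude)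
      measurable_dilation ((measurable_maximalMeasure _).mul (by fun_prop)) ?_
      ((continuousOn_dilation hδ).mono Icc_subset_Ici_self)
      (fun t ht => dilation_pos (add_pos_of_nonneg_of_pos ht.1 hδ)) (fun t ht => ?_) hfin fun t ht x => ?_⟩
  · exact (((continuousOn_rhoAmplitude hp hq hpq hδ).mul ((continuousOn_dilation hδ).pow 2)).mul
      (continuousOn_amplitude hδ)).mono Icc_subset_Ici_self
  · have h : 0 < t + δ := by linarith [ht.1]
    have := rhoAmplitude_pos (d := d) hp hq hpq h
    have := amplitude_pos (d := d) (p := p) (q := q) h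
    positivity
  · have h : 0 < t + δ := by linarith [ht.1]
    have hA := rhoAmplitude_pos (d := d) hp hq hpq h
    have hl := dilation_pos (d := d) (p := p) (q := q) h
    have hB := amplitude_pos (d := d) (p := p) (q := q) h
    have hemb : MeasurableEmbedding fun y : 𝔼 => (dilation d p q δ t)⁻¹ • y :=
      (Homeomorph.smulOfNeZero _ (inv_ne_zero hl.ne')).measurableEmbedding
    rw [(hD t ht).unique (hex t ht.1), VectorMeasure.variation_smul, hemb.variation_map,
      wDelta_eq h]
    set A := rhoAmplitude d p q δ t
    set l := dilation d p q δ t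
    set B := amplitude d p q δ t
    have e1 : maximalMeasure (‖A * ((l ^ d)⁻¹ * l ^ 2)‖₊ •
        Measure.map (fun y => l⁻¹ • y) D₀.variation) x =
        ENNReal.ofReal (A * l ^ 2) * maximalMeasure D₀.variation (l • x) := by
      have : (‖A * ((l ^ d)⁻¹ * l ^ 2)‖₊ • Measure.map (fun y => l⁻¹ • y) D₀.variation) =
          (ENNReal.ofReal (A * ((l ^ d)⁻¹ * l ^ 2))) •
            Measure.map (fun y => l⁻¹ • y) D₀.variation := by
        rw [← Real.enorm_of_nonneg (by positivity)]
        rfl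
      rw [this, maximalMeasure_smul, maximalMeasure_map_inv_smul hl, ← mul_assoc,
        ← ENNReal.ofReal_mul (by positivity)]
      congr 2
      field_simp
    rw [e1, ENNReal.ofReal_mul hB.le, ENNReal.ofReal_mul (by positivity : 0 ≤ A * l ^ 2)]
    simp only [Pi.mul_apply]
    ring

/-- Existence of the weak gradient of `ϱ_δ(t,·) ^ ((1 + γ) / 2)` and weighted square integrability of
its maximal function, where `R` is the radius of the free boundary in the self-similar variable. -/
theorem Leibenson.weakGradient_rhoDelta (hp : 1 < p) (hq : 0 < q) (hpq : 1 < q * (p - 1))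
    (hC : 0 < C) (hδ : 0 < δ) (hbd : p / (p - 1) < d) (hR : 0 < R)
    (hCR : kappa d p q * R ^ (p / (p - 1)) = C) (hw : |(p - 2) / (q * (p - 1) - 1)| < d) :
    (∀ t : ℝ, 0 ≤ t → ∃ G, IsWeakGradient
        (fun x => rhoDelta d p q C δ t x ^ ((1 + gam p q) / 2)) G) ∧
      ∀ T : ℝ, ∀ G : ℝ → 𝔼 → 𝔼,
        (∀ t ∈ Icc 0 T, IsWeakGradient
          (fun x => rhoDelta d p q C δ t x ^ ((1 + gam p q) / 2)) (G t)) →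
        AEMeasurable (fun z : ℝ × 𝔼 => maximalFun (G z.1) z.2 ^ 2 *
            ENNReal.ofReal (‖z.2‖ ^ (-((p - 2) / (q * (p - 1) - 1)))))
          ((volume.restrict (Icc 0 T)).prod volume) ∧
        ∫⁻ t in Icc 0 T, ∫⁻ x, maximalFun (G t) x ^ 2 *
            ENNReal.ofReal (‖x‖ ^ (-((p - 2) / (q * (p - 1) - 1)))) < ⊤ := by
  have hb : 1 < p / (p - 1) := (one_lt_div (by linarith)).2 (by linarith)
  have hκ := kappa_pos (d := d) hp hq hpq
  have hγ := gam_pos hp hpq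
  have hp1 : p - 1 ≠ 0 := by linarith
  have hpq1 : q * (p - 1) - 1 ≠ 0 := by linarith
  -- The weight exponent in terms of the profile; `hm` of the profile lemma becomes `b < d`.
  have hwγ : (p - 2) / (q * (p - 1) - 1) = (2 - p / (p - 1)) * gam p q := by
    rw [gam]
    field_simp
    ring
  obtain ⟨G₀, hG₀i, hG₀, hint, hfin⟩ := exists_isWeakGradient_profile (d := d)
    (m := (2 - p / (p - 1)) * ((1 + gam p q) / 2)) (e := (1 + gam p q) / 2)
    (w := (p - 2) / (q * (p - 1) - 1)) hb hC hκ hR hCR (by linarith) (abs_lt.1 hw).1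
    (abs_lt.1 hw).2 (by rw [hwγ]; linarith)
  set w := (p - 2) / (q * (p - 1) - 1)
  set s := (1 + gam p q) / 2
  have hex : ∀ t : ℝ, 0 ≤ t → IsWeakGradient (fun x => rhoDelta d p q C δ t x ^ s)
      (fun x => (rhoAmplitude d p q δ t ^ s * dilation d p q δ t) •
        G₀ (dilation d p q δ t • x)) := fun t ht =>
    (hG₀.comp_smul hint hG₀i _ (dilation_pos (by linarith))).congr_ae
      (rhoDelta_rpow_ae_eq s hp hq hpq (by linarith) hR hCR).symm
  refine ⟨fun t ht => ⟨_, hex t ht⟩, fun T G hG =>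
    aemeasurable_and_lintegral_lt_top_of_selfSimilar
      (f := fun t x => maximalFun (G t) x ^ 2 * ENNReal.ofReal (‖x‖ ^ (-w)))
      (c := fun t => (rhoAmplitude d p q δ t ^ s * dilation d p q δ t) ^ 2 *
        dilation d p q δ t ^ w)
      (l := dilation d p q δ)
      (((((measurable_rhoAmplitude.pow_const s).mul measurable_dilation).pow_const 2).mul
        (measurable_dilation.pow_const w)))
      measurable_dilation (((measurable_maximalMeasure _).pow_const 2).mul (by fun_prop)) ?_
      ((continuousOn_dilation hδ).mono Icc_subset_Ici_self)
      (fun t ht => dilation_pos (add_pos_of_nonneg_of_pos ht.1 hδ)) (fun t ht => ?_) hfin fun t ht x => ?_⟩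
  · refine ContinuousOn.mono ?_ Icc_subset_Ici_self
    exact ((((continuousOn_rhoAmplitude hp hq hpq hδ).rpow_const fun t ht => Or.inl
      (rhoAmplitude_pos hp hq hpq (add_pos_of_nonneg_of_pos ht hδ)).ne').mul
      (continuousOn_dilation hδ)).pow 2).mul ((continuousOn_dilation hδ).rpow_const fun t ht =>
        Or.inl (dilation_pos (add_pos_of_nonneg_of_pos ht hδ)).ne')
  · have := dilation_pos (d := d) (p := p) (q := q) (by linarith [ht.1] : 0 < t + δ)
    positivity
  · have h : 0 < t + δ := by linarith [ht.1]
    have hA := rhoAmplitude_pos (d := d) hp hq hpq h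
    have hl := dilation_pos (d := d) (p := p) (q := q) h
    rw [maximalFun_congr_ae ((hG t ht).unique_ae (hex t ht.1)), maximalFun_smul_comp_smul _ hl]
    set A := rhoAmplitude d p q δ t
    set l := dilation d p q δ t
    have e1 : ‖x‖ ^ (-w) = l ^ w * ‖l • x‖ ^ (-w) := by
      rw [norm_smul, Real.norm_of_nonneg hl.le, Real.mul_rpow hl.le (norm_nonneg _), ← mul_assoc,
        ← Real.rpow_add hl, add_neg_cancel, Real.rpow_zero, one_mul]
    rw [e1, ENNReal.ofReal_mul (by positivity), mul_pow, Real.enorm_of_nonneg (by positivity),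
      ENNReal.ofReal_mul (by positivity : 0 ≤ (A ^ s * l) ^ 2),
      ENNReal.ofReal_pow (by positivity)]
    simp only [Pi.mul_apply, maximalFun]
    ring

end Conclusion

theorem lemma6p6 (d : ℕ) (hd : 2 ≤ d) (p q C δ : ℝ) (hp : 1 < p) (hq : 0 < q) (hC : 0 < C)
    (hδ : 0 < δ) (hpd : (d : ℝ) / ((d : ℝ) - 1) < p) :
    (1 < q * (p - 1) →
      (∀ t : ℝ, 0 ≤ t → ∃ D, Leibenson.IsDistribHessian (Leibenson.rhoDelta d p q C δ t) D) ∧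
      ∀ T : ℝ, 0 < T →
        ∀ D : ℝ → VectorMeasure (EuclideanSpace ℝ (Fin d)) (EuclideanSpace ℝ (Fin d × Fin d)),
          (∀ t ∈ Icc 0 T, Leibenson.IsDistribHessian (Leibenson.rhoDelta d p q C δ t) (D t)) →
          AEMeasurable (fun z : ℝ × EuclideanSpace ℝ (Fin d) =>
              Leibenson.maximalMeasure (D z.1).variation z.2 *
                ENNReal.ofReal (Leibenson.wDelta d p q C δ z.1 z.2))
            ((volume.restrict (Icc 0 T)).prod volume) ∧
          ∫⁻ t in Icc 0 T, ∫⁻ x, Leibenson.maximalMeasure (D t).variation x *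
              ENNReal.ofReal (Leibenson.wDelta d p q C δ t x) < ⊤) ∧
    ((|p - 2| + d) / (d * (p - 1)) < q →
      (∀ t : ℝ, 0 ≤ t → ∃ G, Leibenson.IsWeakGradient
          (fun x => Leibenson.rhoDelta d p q C δ t x ^ ((1 + Leibenson.gam p q) / 2)) G) ∧
      ∀ T : ℝ, 0 < T →
        ∀ G : ℝ → EuclideanSpace ℝ (Fin d) → EuclideanSpace ℝ (Fin d),
          (∀ t ∈ Icc 0 T, Leibenson.IsWeakGradient
            (fun x => Leibenson.rhoDelta d p q C δ t x ^ ((1 + Leibenson.gam p q) / 2)) (G t)) →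
          AEMeasurable (fun z : ℝ × EuclideanSpace ℝ (Fin d) =>
              Leibenson.maximalFun (G z.1) z.2 ^ 2 *
                ENNReal.ofReal (‖z.2‖ ^ (-((p - 2) / (q * (p - 1) - 1)))))
            ((volume.restrict (Icc 0 T)).prod volume) ∧
          ∫⁻ t in Icc 0 T, ∫⁻ x, Leibenson.maximalFun (G t) x ^ 2 *
              ENNReal.ofReal (‖x‖ ^ (-((p - 2) / (q * (p - 1) - 1)))) < ⊤) := by
  have hd' : (2 : ℝ) ≤ d := by exact_mod_cast hd
  have hp1 : 0 < p - 1 := by linarith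
  have : Nonempty (Fin d) := ⟨⟨0, by omega⟩⟩
  have : Nontrivial (EuclideanSpace ℝ (Fin d)) :=
    (WithLp.equiv 2 (Fin d → ℝ)).nontrivial
  -- This is equivalent to `d / (d - 1) < p`.
  have hbd : p / (p - 1) < d := by
    rw [div_lt_iff₀ hp1]
    rw [div_lt_iff₀ (by linarith)] at hpd
    linarith
  have hb : 0 < p / (p - 1) := div_pos (by linarith) hp1
  have hrad : 1 < q * (p - 1) → ∃ R : ℝ, 0 < R ∧ Leibenson.kappa d p q * R ^ (p / (p - 1)) = C :=
    fun hpq => by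
      have hκ := Leibenson.kappa_pos (d := d) hp hq hpq
      refine ⟨(C / Leibenson.kappa d p q) ^ (p / (p - 1))⁻¹, by positivity, ?_⟩
      rw [← Real.rpow_mul (by positivity), inv_mul_cancel₀ hb.ne', Real.rpow_one,
        mul_div_cancel₀ _ hκ.ne']
  refine ⟨fun hpq => ?_, fun hq2 => ?_⟩
  · obtain ⟨R, hR, hCR⟩ := hrad hpq
    obtain ⟨h1, h2⟩ := Leibenson.distribHessian_rhoDelta hp hq hpq hC hδ hbd hR hCR
    exact ⟨h1, fun T _ => h2 T⟩
  · rw [div_lt_iff₀ (by positivity)] at hq2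
    have hlt : |p - 2| < d * (q * (p - 1) - 1) := by linarith
    -- The second hypothesis on `q` implies the first one, as `|p - 2| ≥ 0`.
    have hpq : 1 < q * (p - 1) := by
      have := pos_of_mul_pos_right ((abs_nonneg _).trans_lt hlt) (by linarith)
      linarith
    obtain ⟨R, hR, hCR⟩ := hrad hpq
    obtain ⟨h1, h2⟩ := Leibenson.weakGradient_rhoDelta hp hq hpq hC hδ hbd hR hCR (by
      rw [abs_div, abs_of_pos (by linarith : 0 < q * (p - 1) - 1), div_lt_iff₀ (by linarith)]
      exact hlt)
    exact ⟨h1, fun T _ => h2 T⟩
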